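/- **Setting.** Let $\mathcal G$ be a plabic graph with boundary vertices $b_1,\dots,b_n$ (each of degree 1), finitely many bivalent or trivalent internal vertices coloured white or black, no edge joining two boundary vertices and no component isolated from the boundary. It is drawn in the closed upper half-plane with straight edges that meet only at common endpoints, with the internal vertices in the open half-plane and $b_1,\dots,b_n$ on the real line from right to left (clockwise). In a perfect orientation $\mathcal O$ each white vertex has exactly one incoming and each black vertex exactly one outgoing edge; assume that $\mathcal G$ admits one. A gauge ray direction $\mathfrak l$ points into the upper half-plane, is not parallel to any edge, and the rays in direction $\mathfrak l$ from the boundary vertices contain no internal vertex. Two drawings are isotopic if the internal vertices of one can be moved continuously to those of the other through such drawings, the boundary vertices being fixed. For plane vectors let $s(f,g)\in\{1,0,-1\}$ be the sign of $f\times g$; let $\mathrm{wind}(f,g)=\pm1$ if $s(f,g)=s(f,\mathfrak l)=s(\mathfrak l,g)=\pm1$, and $\mathrm{wind}(f,g)=0$ otherwise; let $\mathrm{int}(e)$ be $s(\mathfrak l,e)$ times the number of intersections of $e$ with the gauge rays $\mathfrak l_i$ in direction $\mathfrak l$ from the boundary sources $b_i$ (starting points of rays are not counted). All identities below are modulo 2.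 The signature of $(\mathcal G,\mathcal O,\mathfrak l)$ is defined at an edge $e$ oriented from $U$ to $V$, where $e'$ is the incoming edge at $U$ if $U$ is white and $e''$ is the outgoing edge at $V$ if $V$ is black, by $\epsilon_{U,V}=\epsilon_{V,U}=\mathrm{int}(e)+\alpha+\beta$ with * $\alpha=1$ if $U$ is a boundary vertex, $\alpha=1+\mathrm{wind}(e',e)$ if $U$ is white, $\alpha=0$ if $U$ is black; * $\beta=\mathrm{wind}(e,e'')$ if $V$ is black, $\beta=0$ if $V$ is white or a boundary vertex. A gauge function $\eta$ takes values in $\{0,1\}$ on the internal vertices, is extended by $0$ to the boundary vertices, and transforms $\epsilon$ to $\hat\epsilon_{U,V}=\epsilon_{U,V}+\eta(U)+\eta(V)$; signatures related in this way are equivalent. A geometric signature of $\mathcal G$ is any signature equivalent to the signature of $(\mathcal G',\mathcal O,\mathfrak l)$ for some drawing $\mathcal G'$ isotopic to the given one, some perfect orientation $\mathcal O$ and some gauge ray direction $\mathfrak l$. **Theorem.** The geometric signatures of $\mathcal G$ form exactly one equivalence class. Moreover, any two triples $(\mathcal G,\mathcal O,\mathfrak l)$, $(\hat{\mathcal G},\hat{\mathcal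 O},\hat{\mathfrak l})$ with drawings isotopic to the given one are related by a finite composition of the following elementary transformations, and the sum of their gauge functions transforms the signature $\epsilon$ of the first triple to the signature $\hat\epsilon$ of the second. Each elementary transformation transforms the signature by the indicated gauge function. 1. *Reversal of the orientation* along a non-self-intersecting directed path $\mathcal P$ from a boundary source $b_i$ to a boundary sink $b_j$, or along a simple directed cycle $\mathcal Q$; the reversed orientation is again perfect. For a cycle, the region inside $\mathcal Q$ is marked $-$ and the one outside $+$. For a path, the disc is cut by $\mathcal P$, by $\mathfrak l_i$ oriented upwards and by the ray $\mathfrak l_j$ from $b_j$ oriented downwards; its boundary is divided into two arcs, each oriented from $b_j$ to $b_i$; a region is marked $+$ if its boundary is oriented (it lies on the same side of all the oriented curves that bound it) and $-$ otherwise. For an edge $e$ of $\mathcal P$ or $\mathcal Q$ let $\gamma_1(e)=0$ or $1$ if the region to the left of $e$ near its end is marked $+$ or $-$ respectively, and $\gamma_2(e)=\frac{1-s(e,\mathfrak l)}2$. If $U$ is not on $\mathcal P$ ($\mathcal Q$), then $\eta(U)=0$ or $1$ if $U$ lies in a $+$ or $-$ region respectively. If $U$ is on it, with $e_1$ the edge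 entering and $e_2$ the edge leaving $U$ along $\mathcal P$ ($\mathcal Q$) in the initial orientation, then $$\eta(U)=\begin{cases}\mathrm{wind}(e_1,e_2)+\gamma_1(e_1)+\gamma_2(e_2)+1,&U\text{ white},\\ \mathrm{wind}(e_1,e_2)+\gamma_1(e_1)+\gamma_2(e_1),&U\text{ black}.\end{cases}$$ 2. *Change of the gauge ray direction* from $\mathfrak l$ to $\hat{\mathfrak l}$: $\eta(U)=\mathrm{cr}(U)+\mathrm{par}(e)$, where $e$ is the unique incoming (outgoing) edge at $U$ if $U$ is white (black), $\mathrm{cr}(U)$ is the number of gauge rays (from boundary sources) that pass $U$ during the rotation from $\mathfrak l$ to $\hat{\mathfrak l}$ inside the disc, and $\mathrm{par}(e)=1$ if the direction of $e$ lies in the angle between $\mathfrak l$ and $\hat{\mathfrak l}$, and $0$ otherwise. 3. *Continuous motion of one internal vertex* $U$ through drawings of the graph, where $\mathfrak l$ is a gauge ray direction for the initial and the final drawing. Now let $\mathrm{cr}(U)$ be the number modulo 2 of times at which $U$ passes a gauge ray (from a boundary source), and $\mathrm{par}(e)$ the number modulo 2 of times at which the oriented edge $e$ passes the direction $\mathfrak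 l$ (both counted with sign). Then $\eta(U)=\mathrm{cr}(U)+\mathrm{par}(e)$ with $e$ the unique incoming (outgoing) edge at $U$ if $U$ is white (black); if $e=(U,V)$ is an edge oriented from $U$ to an internal vertex $V$, then $\eta(V)=\mathrm{par}(e)$ if $V$ is white and $0$ if $V$ is black; if $e=(W,U)$ is an edge oriented from an internal vertex $W$ to $U$, then $\eta(W)=\mathrm{par}(e)$ if $W$ is black and $0$ if $W$ is white; and $\eta=0$ at all other internal vertices. -/

import Mathlib

open Topology

noncomputable section

/-- Colours of the internal vertices. -/
inductive VertexColour
  | white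
  | black

/-- A plabic graph, combinatorially: `Sum.inl i` is the boundary vertex `b_i`, `Sum.inr v` is an
internal vertex.  Edges of a plabic graph are drawn as straight segments (see `IsDrawing`), hence
there are no loops and no multiple edges. -/
structure PlabicGraph (n : ℕ) (J : Type*) where
  graph : SimpleGraph (Fin n ⊕ J)
  colour : J → VertexColour
  boundary_degree : ∀ i : Fin n, (graph.neighborSet (Sum.inl i)).ncard = 1
  internal_degree : ∀ v : J, (graph.neighborSet (Sum.inr v)).ncard = 2 ∨
    (graph.neighborSet (Sum.inr v)).ncard = 3
  /-- edges lie inside the disc, not on its boundary -/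
  boundary_not_adj : ∀ i j : Fin n, ¬ graph.Adj (Sum.inl i) (Sum.inl j)
  /-- no component is isolated from the boundary -/
  reachable : ∀ v, ∃ i : Fin n, graph.Reachable (Sum.inl i) v

/-- `f × g`, positive iff the ordered pair `(f, g)` is positively oriented. -/
def planeCross (f g : ℂ) : ℝ := f.re * g.im - f.im * g.re

/-- The index `s(f, g) ∈ {1, 0, -1}`. -/
def orientSign (f g : ℂ) : ℤ := ((SignType.sign (planeCross f g) : SignType) : ℤ)

open Classical in
/-- The local winding number of the ordered pair of directions `(f, g)` with respect to the gauge
ray direction `l`. -/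
def windingNumber (l f g : ℂ) : ℤ :=
  if orientSign f g = 1 ∧ orientSign f l = 1 ∧ orientSign l g = 1 then 1
  else if orientSign f g = -1 ∧ orientSign f l = -1 ∧ orientSign l g = -1 then -1
  else 0

/-- `d` lies in the open angle between the directions `l` and `l'`. -/
def InAngle (l l' d : ℂ) : Prop := ∃ a b : ℝ, 0 < a ∧ 0 < b ∧ d = a * l + b * l'

open Classical in
/-- The number modulo 2 of times at which the moving nonzero vector `d` passes the direction `l`
(parallel, not antiparallel).  It is computed from a continuous angle `θ` from `l` to `d`: a passage
is a passage of `θ` through a multiple of `2π`. -/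
def passages (l : ℂ) (d : unitInterval → ℂ) : ZMod 2 :=
  if h : ∃ θ : unitInterval → ℝ, Continuous θ ∧
      ∀ t, ∃ r : ℝ, 0 < r ∧ d t = r * Complex.exp (θ t * Complex.I) * l
  then ((⌊h.choose 1 / (2 * Real.pi)⌋ - ⌊h.choose 0 / (2 * Real.pi)⌋ : ℤ) : ZMod 2)
  else 0

namespace PlabicGraph

variable {n : ℕ} {J : Type*} (G : PlabicGraph n J)

/-- A straight-line planar drawing of `G` in the closed upper half-plane.  The boundary vertices are
on the real line, clockwise along the boundary of the half-plane, that is, from right to left. -/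
structure IsDrawing (p : Fin n ⊕ J → ℂ) : Prop where
  boundary_real : ∀ i, (p (Sum.inl i)).im = 0
  boundary_clockwise : StrictAnti fun i => (p (Sum.inl i)).re
  internal_pos : ∀ v, 0 < (p (Sum.inr v)).im
  injective : Function.Injective p
  vertex_not_on_edge : ∀ u v w, G.graph.Adj u v → p w ∉ openSegment ℝ (p u) (p v)
  edges_disjoint : ∀ u v u' v', G.graph.Adj u v → G.graph.Adj u' v' → s(u, v) ≠ s(u', v') →
    Disjoint (openSegment ℝ (p u) (p v)) (openSegment ℝ (p u') (p v'))

/-- Two drawings are isotopic if the internal vertices can be moved continuously from their positions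
in the first one to those in the second one, the picture being a drawing of `G` at each time. -/
def Isotopic (p p' : Fin n ⊕ J → ℂ) : Prop :=
  JoinedIn {q | G.IsDrawing q ∧ ∀ i, q (Sum.inl i) = p (Sum.inl i)} p p'

/-- `O u v` means that there is an edge oriented from `u` to `v`. -/
structure IsPerfectOrientation (O : Fin n ⊕ J → Fin n ⊕ J → Prop) : Prop where
  adj_iff : ∀ u v, G.graph.Adj u v ↔ O u v ∨ O v u
  asymm : ∀ u v, O u v → ¬ O v u
  white : ∀ v, G.colour v = VertexColour.white → ∃! u, O u (Sum.inr v)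
  black : ∀ v, G.colour v = VertexColour.black → ∃! u, O (Sum.inr v) u

/-- `l` is a gauge ray direction for the drawing `p`. -/
structure IsGaugeDirection (p : Fin n ⊕ J → ℂ) (l : ℂ) : Prop where
  inward : 0 < l.im
  not_parallel : ∀ u v, G.graph.Adj u v → planeCross l (p v - p u) ≠ 0
  ray_avoids : ∀ (i : Fin n) (v : J) (t : ℝ), 0 ≤ t → p (Sum.inr v) ≠ p (Sum.inl i) + t * l

/-- A drawn plabic graph with a perfect orientation and a gauge ray direction. -/
structure GaugedGraph where
  pos : Fin n ⊕ J → ℂ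
  arc : Fin n ⊕ J → Fin n ⊕ J → Prop
  ray : ℂ
  drawing : G.IsDrawing pos
  perfect : G.IsPerfectOrientation arc
  gauge : G.IsGaugeDirection pos ray

/-- A gauge function on internal vertices, extended by `0` to the boundary vertices. -/
def extendGauge (η : J → ZMod 2) : Fin n ⊕ J → ZMod 2 := Sum.elim (fun _ => 0) η

/-- `ε'` is obtained from the signature `ε` by the gauge transformation with gauge function `η`. -/
def GaugeTransforms (η : J → ZMod 2) (ε ε' : Fin n ⊕ J → Fin n ⊕ J → ZMod 2) : Prop :=
  ∀ u v, G.graph.Adj u v → ε' u v = ε u v + extendGauge η u + extendGauge η v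

/-- Equivalence of edge signatures. -/
def GaugeEquivalent (ε ε' : Fin n ⊕ J → Fin n ⊕ J → ZMod 2) : Prop :=
  ∃ η : J → ZMod 2, G.GaugeTransforms η ε ε'

/-- The walk `w` traverses the edge `ab` from `a` to `b`. -/
def WalkArc {u v : Fin n ⊕ J} (w : G.graph.Walk u v) (a b : Fin n ⊕ J) : Prop :=
  ∃ h : G.graph.Adj a b, (⟨(a, b), h⟩ : G.graph.Dart) ∈ w.darts

/-- The orientation obtained from `O` by reversing the edges of the walk `w`, directed in `O`. -/
def reverseAlong (O : Fin n ⊕ J → Fin n ⊕ J → Prop) {u v : Fin n ⊕ J} (w : G.graph.Walk u v)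
    (a b : Fin n ⊕ J) : Prop :=
  (O a b ∧ ¬ G.WalkArc w a b) ∨ G.WalkArc w b a

open Classical in
/-- The positions after moving the internal vertex `u` to `z`. -/
def moveVertex (p : Fin n ⊕ J → ℂ) (u : J) (z : ℂ) : Fin n ⊕ J → ℂ :=
  Function.update p (Sum.inr u) z

variable {G}

namespace GaugedGraph

variable (N : G.GaugedGraph)

/-- The same drawing and gauge ray direction with another perfect orientation. -/
def withArc (O : Fin n ⊕ J → Fin n ⊕ J → Prop) (hO : G.IsPerfectOrientation O) : G.GaugedGraph :=
  { N with arc := O, perfect := hO }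

/-- The same drawing and orientation with another gauge ray direction. -/
def withRay (l : ℂ) (hl : G.IsGaugeDirection N.pos l) : G.GaugedGraph :=
  { N with ray := l, gauge := hl }

/-- The same orientation and gauge ray direction with other positions of the vertices. -/
def withPos (p : Fin n ⊕ J → ℂ) (hp : G.IsDrawing p) (hl : G.IsGaugeDirection p N.ray) :
    G.GaugedGraph :=
  { N with pos := p, drawing := hp, gauge := hl }

/-- The boundary vertex `b_i` is a source. -/
def IsSource (i : Fin n) : Prop := ∃ v, N.arc (Sum.inl i) v

/-- The boundary vertex `b_j` is a sink. -/
def IsSink (j : Fin n) : Prop := ∃ v, N.arc v (Sum.inl j)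

/-- The direction of the edge from `u` to `v`. -/
def vec (u v : Fin n ⊕ J) : ℂ := N.pos v - N.pos u

/-- The gauge ray starting at `b_i`.  The starting point is left out, so that the edge at `b_i` is
not counted as intersecting this ray. -/
def gaugeRay (i : Fin n) : Set ℂ := {z | ∃ t : ℝ, 0 < t ∧ z = N.pos (Sum.inl i) + t * N.ray}

/-- The other end of an edge incoming at the internal vertex `v`
(unique if `v` is white). -/
def incoming (v : J) : Fin n ⊕ J :=
  @Classical.epsilon _ ⟨Sum.inr v⟩ fun u => N.arc u (Sum.inr v)

/-- The other end of an edge outgoing at the internal vertex `v`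
(unique if `v` is black). -/
def outgoing (v : J) : Fin n ⊕ J :=
  @Classical.epsilon _ ⟨Sum.inr v⟩ fun u => N.arc (Sum.inr v) u

/-- The winding number of the consecutive edges `u → v → w`. -/
def wind (u v w : Fin n ⊕ J) : ℤ := windingNumber N.ray (N.vec u v) (N.vec v w)

/-- The intersection number of the edge `u → v`: the number of its intersections with the gauge rays
starting at the boundary sources (each ray meets it at most once), times `s(l, e)`. -/
def intersectionNumber (u v : Fin n ⊕ J) : ℤ :=
  ({i : Fin n | N.IsSource i ∧
      (N.gaugeRay i ∩ segment ℝ (N.pos u) (N.pos v)).Nonempty}.ncard : ℤ) *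
    orientSign N.ray (N.vec u v)

/-- The signature of the oriented edge `u → v`. -/
def arcSignature : Fin n ⊕ J → Fin n ⊕ J → ℤ
  | Sum.inr a, Sum.inl j =>
      match G.colour a with
      | VertexColour.black => N.intersectionNumber (Sum.inr a) (Sum.inl j)
      | VertexColour.white => 1 + N.intersectionNumber (Sum.inr a) (Sum.inl j)
          + N.wind (N.incoming a) (Sum.inr a) (Sum.inl j)
  | Sum.inl i, Sum.inr b =>
      match G.colour b with
      | VertexColour.black => 1 + N.intersectionNumber (Sum.inl i) (Sum.inr b)
          + N.wind (Sum.inl i) (Sum.inr b) (N.outgoing b)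
      | VertexColour.white => 1 + N.intersectionNumber (Sum.inl i) (Sum.inr b)
  | Sum.inr a, Sum.inr b =>
      match G.colour a, G.colour b with
      | VertexColour.black, VertexColour.white => N.intersectionNumber (Sum.inr a) (Sum.inr b)
      | VertexColour.white, VertexColour.white => 1 + N.intersectionNumber (Sum.inr a) (Sum.inr b)
          + N.wind (N.incoming a) (Sum.inr a) (Sum.inr b)
      | VertexColour.white, VertexColour.black => 1 + N.intersectionNumber (Sum.inr a) (Sum.inr b)
          + N.wind (N.incoming a) (Sum.inr a) (Sum.inr b)
          + N.wind (Sum.inr a) (Sum.inr b) (N.outgoing b)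
      | VertexColour.black, VertexColour.black => N.intersectionNumber (Sum.inr a) (Sum.inr b)
          + N.wind (Sum.inr a) (Sum.inr b) (N.outgoing b)
  | Sum.inl _, Sum.inl _ => 0

open Classical in
/-- The geometric signature `ε_{U,V} = ε_{V,U}` given by the explicit formulas, modulo 2.
Only its values at edges `UV` of the graph are meaningful. -/
def signature (u v : Fin n ⊕ J) : ZMod 2 :=
  if N.arc u v then (N.arcSignature u v : ZMod 2) else (N.arcSignature v u : ZMod 2)

/-! ### Reversal of the orientation along a path or a cycle -/

/-- The points of the edges of the walk `w`. -/
def trace {u v : Fin n ⊕ J} (w : G.graph.Walk u v) : Set ℂ :=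
  {z | ∃ a b, G.WalkArc w a b ∧ z ∈ segment ℝ (N.pos a) (N.pos b)}

/-- The interior of the disc, cut along the path `w` from `b_i` to `b_j` and along the gauge rays at
`b_i` and `b_j`.  Its connected components are the regions defined by the path. -/
def pathDomain (i j : Fin n) (w : G.graph.Walk (Sum.inl i) (Sum.inl j)) : Set ℂ :=
  {z | 0 < z.im} \ (N.trace w ∪ N.gaugeRay i ∪ N.gaugeRay j)

/-- The oriented curves bounding the regions: `(z, d)` belongs to this set if `z` is on one of them
and `d` is the direction of the curve at `z`.  The curves are the edges of the path in the initial
orientation, the ray at `b_i` oriented upwards, the ray at `b_j` oriented downwards, and the two arcs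
of the boundary of the disc (the real line with the point at infinity), oriented from `b_j` to
`b_i`. -/
def pathCurves (i j : Fin n) (w : G.graph.Walk (Sum.inl i) (Sum.inl j)) : Set (ℂ × ℂ) :=
  {q | ∃ a b, G.WalkArc w a b ∧ q.1 ∈ openSegment ℝ (N.pos a) (N.pos b) ∧ q.2 = N.vec a b} ∪
  {q | q.1 ∈ N.gaugeRay i ∧ q.2 = N.ray} ∪
  {q | q.1 ∈ N.gaugeRay j ∧ q.2 = -N.ray} ∪
  {q | q.1 ∈ openSegment ℝ (N.pos (Sum.inl j)) (N.pos (Sum.inl i)) ∧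
      q.2 = N.vec (Sum.inl j) (Sum.inl i)} ∪
  {q | q.1.im = 0 ∧ q.1 ∉ segment ℝ (N.pos (Sum.inl j)) (N.pos (Sum.inl i)) ∧
      q.2 = N.vec (Sum.inl i) (Sum.inl j)}

/-- The boundary of the region `R` is oriented: `R` does not have some of its boundary curves with
`R` on their left and some with `R` on their right. -/
def BoundaryOriented (i j : Fin n) (w : G.graph.Walk (Sum.inl i) (Sum.inl j)) (R : Set ℂ) : Prop :=
  ¬ ((∃ q ∈ N.pathCurves i j w, ∀ᶠ t : ℝ in 𝓝[>] 0, q.1 + t * (Complex.I * q.2) ∈ R) ∧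
     (∃ q ∈ N.pathCurves i j w, ∀ᶠ t : ℝ in 𝓝[>] 0, q.1 - t * (Complex.I * q.2) ∈ R))

/-- The union of the regions marked with `-` for a path from `b_i` to `b_j`. -/
def pathMinus (i j : Fin n) (w : G.graph.Walk (Sum.inl i) (Sum.inl j)) : Set ℂ :=
  {z | z ∈ N.pathDomain i j w ∧
    ¬ N.BoundaryOriented i j w (connectedComponentIn (N.pathDomain i j w) z)}

/-- The region marked with `-` for a cycle: the bounded component of its complement. -/
def cycleMinus {u : Fin n ⊕ J} (w : G.graph.Walk u u) : Set ℂ :=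
  {z | z ∈ {z : ℂ | 0 < z.im} \ N.trace w ∧
    Bornology.IsBounded (connectedComponentIn ({z : ℂ | 0 < z.im} \ N.trace w) z)}

open Classical in
/-- The index `γ₁` of the edge `a → b`: it is `1` if the region to the left of the edge and near its
ending point is marked with `-`, where `M` is the union of the regions marked with `-`. -/
def gammaOne (M : Set ℂ) (a b : Fin n ⊕ J) : ZMod 2 :=
  if ∀ᶠ δ : ℝ in 𝓝[>] 0, ∀ᶠ τ : ℝ in 𝓝[>] 0,
      N.pos b - δ * N.vec a b + τ * (Complex.I * N.vec a b) ∈ M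
  then 1 else 0

/-- The index `γ₂` of the edge `a → b`. -/
def gammaTwo (a b : Fin n ⊕ J) : ZMod 2 := (((1 - orientSign (N.vec a b) N.ray) / 2 : ℤ) : ZMod 2)

/-- The vertex preceding `v` on the walk `w`. -/
def previous {u u' : Fin n ⊕ J} (w : G.graph.Walk u u') (v : J) : Fin n ⊕ J :=
  @Classical.epsilon _ ⟨Sum.inr v⟩ fun a => G.WalkArc w a (Sum.inr v)

/-- The vertex following `v` on the walk `w`. -/
def following {u u' : Fin n ⊕ J} (w : G.graph.Walk u u') (v : J) : Fin n ⊕ J :=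
  @Classical.epsilon _ ⟨Sum.inr v⟩ fun a => G.WalkArc w (Sum.inr v) a

open Classical in
/-- The gauge function of the reversal of orientation along the path or cycle `w`, where `M` is the
union of the regions marked with `-`. -/
def reversalGauge {u u' : Fin n ⊕ J} (w : G.graph.Walk u u') (M : Set ℂ) (v : J) : ZMod 2 :=
  if Sum.inr v ∈ w.support then
    match G.colour v with
    | VertexColour.white =>
        (N.wind (previous w v) (Sum.inr v) (following w v) : ZMod 2)
          + N.gammaOne M (previous w v) (Sum.inr v)
          + N.gammaTwo (Sum.inr v) (following w v) + 1
    | VertexColour.black =>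
        (N.wind (previous w v) (Sum.inr v) (following w v) : ZMod 2)
          + N.gammaOne M (previous w v) (Sum.inr v)
          + N.gammaTwo (previous w v) (Sum.inr v)
  else if N.pos (Sum.inr v) ∈ M then 1 else 0

/-- `w` is a non-self-intersecting directed path from the boundary source `b_i` to the boundary sink
`b_j`. -/
def IsReversiblePath (i j : Fin n) (w : G.graph.Walk (Sum.inl i) (Sum.inl j)) : Prop :=
  N.IsSource i ∧ N.IsSink j ∧ w.IsPath ∧ ∀ a b, G.WalkArc w a b → N.arc a b

/-- `w` is a simple closed directed path. -/
def IsReversibleCycle {u : Fin n ⊕ J} (w : G.graph.Walk u u) : Prop :=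
  w.IsCycle ∧ ∀ a b, G.WalkArc w a b → N.arc a b

/-! ### Change of the gauge ray direction -/

open Classical in
/-- The gauge function of the change of the gauge ray direction to `l'`: `cr(v) + par(e)`, where
`cr(v)` is the number of gauge rays passing `v` during the rotation inside the disc, and `e` is the
unique incoming (outgoing) edge at `v` if `v` is white (black). -/
def rotationGauge (l' : ℂ) (v : J) : ZMod 2 :=
  ({i : Fin n | N.IsSource i ∧ InAngle N.ray l' (N.vec (Sum.inl i) (Sum.inr v))}.ncard : ZMod 2) +
    match G.colour v with
    | VertexColour.white => if InAngle N.ray l' (N.vec (N.incoming v) (Sum.inr v)) then 1 else 0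
    | VertexColour.black => if InAngle N.ray l' (N.vec (Sum.inr v) (N.outgoing v)) then 1 else 0

/-! ### Motion of an internal vertex -/

/-- The number modulo 2 of times at which the edge `a → b` passes the gauge ray direction, when the
vertex `u` moves along `c`. -/
def motionPar (u : J) (c : unitInterval → ℂ) (a b : Fin n ⊕ J) : ZMod 2 :=
  passages N.ray fun t => moveVertex N.pos u (c t) b - moveVertex N.pos u (c t) a

open Classical in
/-- The number modulo 2 of times at which the vertex `u`, moving along `c`, passes a gauge ray. -/
def motionCr (u : J) (c : unitInterval → ℂ) : ZMod 2 :=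
  ∑ i : Fin n, if N.IsSource i then passages N.ray fun t =>
    moveVertex N.pos u (c t) (Sum.inr u) - N.pos (Sum.inl i) else 0

open Classical in
/-- The gauge function of the motion of the internal vertex `u` along `c`. -/
def motionGauge (u : J) (c : unitInterval → ℂ) (v : J) : ZMod 2 :=
  if v = u then
    N.motionCr u c +
      match G.colour u with
      | VertexColour.white => N.motionPar u c (N.incoming u) (Sum.inr u)
      | VertexColour.black => N.motionPar u c (Sum.inr u) (N.outgoing u)
  else if N.arc (Sum.inr u) (Sum.inr v) then
    match G.colour v with
    | VertexColour.white => N.motionPar u c (Sum.inr u) (Sum.inr v)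
    | VertexColour.black => 0
  else if N.arc (Sum.inr v) (Sum.inr u) then
    match G.colour v with
    | VertexColour.black => N.motionPar u c (Sum.inr v) (Sum.inr u)
    | VertexColour.white => 0
  else 0

/-- The elementary transformations, with their gauge functions. -/
inductive Elementary : G.GaugedGraph → G.GaugedGraph → (J → ZMod 2) → Prop
  | path (N : G.GaugedGraph) (i j : Fin n) (w : G.graph.Walk (Sum.inl i) (Sum.inl j))
      (hw : N.IsReversiblePath i j w) (hO : G.IsPerfectOrientation (G.reverseAlong N.arc w)) :
      Elementary N (N.withArc _ hO) (N.reversalGauge w (N.pathMinus i j w))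
  | cycle (N : G.GaugedGraph) (u : Fin n ⊕ J) (w : G.graph.Walk u u)
      (hw : N.IsReversibleCycle w) (hO : G.IsPerfectOrientation (G.reverseAlong N.arc w)) :
      Elementary N (N.withArc _ hO) (N.reversalGauge w (N.cycleMinus w))
  | rotation (N : G.GaugedGraph) (l' : ℂ) (hl : G.IsGaugeDirection N.pos l') :
      Elementary N (N.withRay l' hl) (N.rotationGauge l')
  | motion (N : G.GaugedGraph) (u : J) (z : ℂ) (c : Path (N.pos (Sum.inr u)) z)
      (hc : ∀ t, G.IsDrawing (moveVertex N.pos u (c t)))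
      (hz : G.IsDrawing (moveVertex N.pos u z))
      (hl : G.IsGaugeDirection (moveVertex N.pos u z) N.ray) :
      Elementary N (N.withPos _ hz hl) (N.motionGauge u c)

/-- Compositions of elementary transformations, with the sums of their gauge functions. -/
inductive Composition : G.GaugedGraph → G.GaugedGraph → (J → ZMod 2) → Prop
  | refl (N : G.GaugedGraph) : Composition N N 0
  | step (N N' N'' : G.GaugedGraph) (η η' : J → ZMod 2) :
      Composition N N' η → Elementary N' N'' η' → Composition N N'' (η + η')

end GaugedGraph

variable (G)

/-- `ε` is a geometric signature on the plabic graph `G` drawn as `p`: it is equivalent to the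
explicit signature for some perfect orientation, some gauge ray direction, and some positions of the
vertices respecting the topology of the drawing. -/
def IsGeometricSignature (p : Fin n ⊕ J → ℂ) (ε : Fin n ⊕ J → Fin n ⊕ J → ZMod 2) : Prop :=
  ∃ N : G.GaugedGraph, G.Isotopic p N.pos ∧ G.GaugeEquivalent N.signature ε

end PlabicGraph

end

/-!
The proof rests on one local notion, the crossing parity of two plane vectors that are not
antiparallel: whether the short rotation from one to the other crosses the ray direction.  It is
computed from angles lifted to the real line, where a crossing is a change of the integer part of
the angle divided by `2π`.  Modulo 2 it is the local winding number (`windingNumber_cast`), and when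
the two vectors or the ray direction move, it changes by the number of passages through the ray
direction (`crossParity_motion`, `crossParity_rotation`).

The signature of an edge is a sum of contributions of its two ends (`signature_eq`): the number of
gauge rays on whose right the end lies, since a ray crosses an edge if it separates its ends, and a
winding term at the end.  When the ray direction changes or a vertex moves, all these contributions
change by numbers of passages.  The passages of the edge itself occur at both ends and cancel, and
what is left is a gauge function (`gaugeTransforms_of_passages`).

For the reversal along a path or a cycle, let the crossing count of a point be the parity of the
number of edges of the path that the ray from this point crosses, that is, the sum of the crossing
parities of these edges seen from the point.  It is constant off the path and jumps across it
(`IsSimpleCurve.crossCount_jump`); following the two sides of the path along its edges and around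
its vertices shows that they exhaust the complement (`IsSimpleCurveInUpper.exists_onSide`).  This is
the part of the Jordan curve theorem that is needed.  The marked regions are then determined by
parities: the inside of a cycle is where the crossing count is odd
(`IsSimpleCurveInUpper.isBounded_component_iff`), and a point is marked `-` for a path if its
crossing count differs from the parity telling whether it lies between the two rays
(`mem_pathMinus_iff`).  The latter parity is also the change of the number of rays on the left
or right of the point when the source moves from one end of the path to the other.  At a vertex of
the path the winding numbers with a third edge change according to the side of the path on which
this edge lies, which is the crossing count along it (`IsReversalData.crossParity_vertex`).
Comparing the contributions of all half-edges gives the gauge function of the reversal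
(`IsReversalData.gaugeTransforms`).

There remains the connectedness by elementary transformations.  Edges in which two perfect
orientations differ contain a path between boundary vertices or a cycle, whose reversal diminishes
their number (`exists_reversed_path_or_cycle`).  Being a drawing is an open condition
(`IsDrawing.eventually`), and a generic ray direction suits any two drawings
(`exists_common_gauge`), so that along an isotopy one can pass to nearby drawings by moving the
vertices one by one (`drawingsConnected_of_isotopic`).  Hence all geometric signatures are
equivalent.
-/

/-! ### Angles and crossings of the gauge ray direction -/

/-- The parity of the number of multiples of `2π` in `(0, x]`, or in `(x, 0]` if `x < 0`. -/
noncomputable def turnParity (x : ℝ) : ZMod 2 := ((⌊x / (2 * Real.pi)⌋ : ℤ) : ZMod 2)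

/-- `θ` is one of the values of the angle from `l` to the nonzero vector `f`. -/
def HasAngle (l f : ℂ) (θ : ℝ) : Prop :=
  ∃ r : ℝ, 0 < r ∧ f = r * Complex.exp (θ * Complex.I) * l

/-- The crossing parity: for `f` and `g` not antiparallel, it is `1` if the short rotation from `f`
to `g` crosses the direction `l`.  A vector in the direction `l` itself counts as lying to the left
of `l`, which makes the crossing parity meaningful for all pairs with `0 ∉ segment ℝ f g`. -/
noncomputable def crossParity (l f g : ℂ) : ZMod 2 :=
  turnParity (f / l).arg + turnParity ((f / l).arg + (g / f).arg)

lemma turnParity_add_int (x : ℝ) (k : ℤ) : turnParity (x + 2 * Real.pi * k) = turnParity x + k := by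
  unfold turnParity
  have : (x + 2 * Real.pi * k) / (2 * Real.pi) = x / (2 * Real.pi) + k := by
    field_simp
  rw [this, Int.floor_add_intCast]
  push_cast
  rfl

lemma turnParity_add_two_pi (x : ℝ) : turnParity (x + 2 * Real.pi) = turnParity x + 1 := by
  simpa using turnParity_add_int x 1

lemma turnParity_eq_of_mem {x : ℝ} (k : ℤ) (h0 : 2 * Real.pi * k ≤ x)
    (h1 : x < 2 * Real.pi * (k + 1)) : turnParity x = k := by
  unfold turnParity
  have hpi := Real.pi_pos
  congr 1
  rw [Int.floor_eq_iff]
  constructor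
  · rw [le_div_iff₀ (by positivity)]; linarith
  · rw [div_lt_iff₀ (by positivity)]; linarith

lemma turnParity_eq_zero {x : ℝ} (h0 : 0 ≤ x) (h1 : x < 2 * Real.pi) : turnParity x = 0 := by
  simpa using turnParity_eq_of_mem (x := x) 0 (by simpa using h0) (by simpa using h1)

lemma turnParity_eq_one {x : ℝ} (h0 : - (2 * Real.pi) ≤ x) (h1 : x < 0) : turnParity x = 1 := by
  have := turnParity_eq_of_mem (x := x) (-1) (by push_cast; linarith) (by push_cast; linarith)
  rw [this]; decide

namespace HasAngle

variable {l f g : ℂ} {θ φ : ℝ}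

lemma ne_zero (hl : l ≠ 0) (h : HasAngle l f θ) : f ≠ 0 := by
  obtain ⟨r, hr, rfl⟩ := h
  have : (r : ℂ) ≠ 0 := by exact_mod_cast hr.ne'
  simp [this, hl, Complex.exp_ne_zero]

lemma neg (h : HasAngle l f θ) : HasAngle l (-f) (θ + Real.pi) := by
  obtain ⟨r, hr, rfl⟩ := h
  refine ⟨r, hr, ?_⟩
  push_cast
  rw [add_mul, Complex.exp_add, Complex.exp_pi_mul_I]
  ring

lemma neg' (h : HasAngle l f θ) : HasAngle l (-f) (θ - Real.pi) := by
  obtain ⟨r, hr, rfl⟩ := h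
  refine ⟨r, hr, ?_⟩
  push_cast
  rw [sub_mul, Complex.exp_sub, Complex.exp_pi_mul_I]
  ring

lemma add_int (h : HasAngle l f θ) (k : ℤ) : HasAngle l f (θ + 2 * Real.pi * k) := by
  obtain ⟨r, hr, rfl⟩ := h
  refine ⟨r, hr, ?_⟩
  push_cast
  rw [add_mul, Complex.exp_add,
    show (2 : ℂ) * Real.pi * k * Complex.I = k * (2 * Real.pi * Complex.I) by ring,
    Complex.exp_int_mul_two_pi_mul_I]
  ring

lemma add_two_pi (h : HasAngle l f θ) : HasAngle l f (θ + 2 * Real.pi) := by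
  simpa using h.add_int 1

lemma sub_two_pi (h : HasAngle l f θ) : HasAngle l f (θ - 2 * Real.pi) := by
  simpa [sub_eq_add_neg] using h.add_int (-1)

lemma smul (h : HasAngle l f θ) {c : ℝ} (hc : 0 < c) : HasAngle l (c * f) θ := by
  obtain ⟨r, hr, rfl⟩ := h
  exact ⟨c * r, mul_pos hc hr, by push_cast; ring⟩

lemma exists_eq_add (hl : l ≠ 0) (h : HasAngle l f θ) (h' : HasAngle l f φ) :
    ∃ k : ℤ, φ = θ + 2 * Real.pi * k := by
  obtain ⟨r, hr, e⟩ := h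
  obtain ⟨r', hr', e'⟩ := h'
  have h1 : (r : ℂ) * Complex.exp (θ * Complex.I) = r' * Complex.exp (φ * Complex.I) :=
    mul_right_cancel₀ hl (e.symm.trans e')
  have h2 : r = r' := by
    have := congrArg norm h1
    simpa [Complex.norm_exp_ofReal_mul_I, abs_of_pos hr, abs_of_pos hr'] using this
  subst h2
  have h3 := mul_left_cancel₀ (by exact_mod_cast hr.ne' : (r : ℂ) ≠ 0) h1
  obtain ⟨k, hk⟩ := Complex.exp_eq_exp_iff_exists_int.mp h3.symm
  refine ⟨k, ?_⟩
  have : ((φ : ℂ)) * Complex.I = ((θ + 2 * Real.pi * k : ℝ) : ℂ) * Complex.I := by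
    rw [hk]; push_cast; ring
  exact_mod_cast mul_right_cancel₀ Complex.I_ne_zero this

lemma arg_div (hl : l ≠ 0) (hf : f ≠ 0) : HasAngle l f (f / l).arg := by
  refine ⟨‖f / l‖, norm_pos_iff.mpr (div_ne_zero hf hl), ?_⟩
  rw [Complex.norm_mul_exp_arg_mul_I]
  field_simp

/-- Angles add up: from `l` to `f` and from `f` to `g`. -/
lemma trans (h : HasAngle l f θ) (h' : HasAngle f g φ) : HasAngle l g (θ + φ) := by
  obtain ⟨r, hr, rfl⟩ := h
  obtain ⟨s, hs, rfl⟩ := h'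
  refine ⟨s * r, mul_pos hs hr, ?_⟩
  push_cast
  rw [add_mul, Complex.exp_add]
  ring

end HasAngle

lemma planeCross_hasAngle {l f g : ℂ} {θ φ : ℝ} (hl : l ≠ 0) (h : HasAngle l f θ)
    (h' : HasAngle l g φ) : ∃ c : ℝ, 0 < c ∧ planeCross f g = c * Real.sin (φ - θ) := by
  obtain ⟨r, hr, rfl⟩ := h
  obtain ⟨s, hs, rfl⟩ := h'
  have hl' : 0 < l.re ^ 2 + l.im ^ 2 := by
    have := Complex.normSq_pos.mpr hl
    rw [Complex.normSq_apply] at this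
    nlinarith
  refine ⟨r * s * (l.re ^ 2 + l.im ^ 2), by positivity, ?_⟩
  simp only [planeCross, Complex.mul_re, Complex.mul_im, Complex.ofReal_re, Complex.ofReal_im,
    Complex.exp_ofReal_mul_I_re, Complex.exp_ofReal_mul_I_im, Real.sin_sub]
  ring

lemma hasAngle_self (l : ℂ) : HasAngle l l 0 := ⟨1, one_pos, by simp⟩

lemma ne_zero_of_zero_notMem_segment {f g : ℂ} (h : (0 : ℂ) ∉ segment ℝ f g) : f ≠ 0 ∧ g ≠ 0 :=
  ⟨fun e => h (e ▸ left_mem_segment ℝ f g), fun e => h (e ▸ right_mem_segment ℝ f g)⟩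

/-- Vectors whose angles differ by an odd multiple of `π` are antiparallel. -/
lemma zero_mem_segment_of_angle {l f g : ℂ} {θ φ : ℝ} (h : HasAngle l f θ) (h' : HasAngle l g φ)
    (hc : Real.cos (φ - θ) = -1) : (0 : ℂ) ∈ segment ℝ f g := by
  obtain ⟨r, hr, rfl⟩ := h
  obtain ⟨s, hs, rfl⟩ := h'
  have e : Complex.exp (φ * Complex.I) = - Complex.exp (θ * Complex.I) := by
    have h1 : Real.sin (φ - θ) = 0 := by
      have := Real.sin_sq_add_cos_sq (φ - θ)
      rw [hc] at this
      nlinarith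
    have : Complex.exp ((φ - θ : ℝ) * Complex.I) = -1 := by
      apply Complex.ext
      · rw [Complex.exp_ofReal_mul_I_re, hc]; simp
      · rw [Complex.exp_ofReal_mul_I_im, h1]; simp
    have h2 : (φ : ℂ) * Complex.I = θ * Complex.I + (φ - θ : ℝ) * Complex.I := by push_cast; ring
    rw [h2, Complex.exp_add, this]; ring
  have hrs : (r : ℂ) + s ≠ 0 := by exact_mod_cast (add_pos hr hs).ne'
  refine ⟨s / (r + s), r / (r + s), by positivity, by positivity, ?_, ?_⟩
  · field_simp; ring
  · simp only [Complex.real_smul, e]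
    push_cast
    field_simp
    ring

lemma exists_angle_near {l f g : ℂ} {θ : ℝ} (h : HasAngle l f θ) (hfg : (0 : ℂ) ∉ segment ℝ f g) :
    ∃ φ, HasAngle l g φ ∧ |φ - θ| < Real.pi := by
  obtain ⟨hf, hg⟩ := ne_zero_of_zero_notMem_segment hfg
  have h' : HasAngle l g (θ + (g / f).arg) := h.trans (HasAngle.arg_div hf hg)
  refine ⟨_, h', ?_⟩
  rw [add_sub_cancel_left]
  refine lt_of_le_of_ne (Complex.abs_arg_le_pi _) fun e => hfg ?_
  apply zero_mem_segment_of_angle h h'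
  rw [add_sub_cancel_left, ← Real.cos_abs, e, Real.cos_pi]

/-- The crossing parity can be read off from any angles of the two vectors that differ by less
than `π`. -/
lemma crossParity_eq {l f g : ℂ} {θ φ : ℝ} (hl : l ≠ 0) (h : HasAngle l f θ) (h' : HasAngle l g φ)
    (hd : |φ - θ| < Real.pi) : crossParity l f g = turnParity θ + turnParity φ := by
  have hf := h.ne_zero hl
  have hg := h'.ne_zero hl
  obtain ⟨k, hk⟩ := h.exists_eq_add hl (HasAngle.arg_div hl hf)
  have h2 : HasAngle l g (θ + (g / f).arg) := h.trans (HasAngle.arg_div hf hg)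
  obtain ⟨m, hm⟩ := h2.exists_eq_add hl h'
  have hm0 : m = 0 := by
    have h3 : (g / f).arg ≤ Real.pi := Complex.arg_le_pi _
    have h4 : -Real.pi < (g / f).arg := Complex.neg_pi_lt_arg _
    rw [abs_lt] at hd
    have hpi := Real.pi_pos
    have h5 : (m : ℝ) < 1 := by
      by_contra! hc; nlinarith
    have h6 : (-1 : ℝ) < m := by
      by_contra! hc; nlinarith
    have h5' : m < 1 := by exact_mod_cast h5
    have h6' : -1 < m := by exact_mod_cast h6
    omega
  subst hm0
  have hm' : φ = θ + (g / f).arg := by simpa using hm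
  unfold crossParity
  rw [hk, show θ + 2 * Real.pi * k + (g / f).arg = φ + 2 * Real.pi * k by rw [hm']; ring,
    turnParity_add_int, turnParity_add_int,
    show turnParity θ + k + (turnParity φ + k) = turnParity θ + turnParity φ + ((k : ZMod 2) + k) by
      ring, CharTwo.add_self_eq_zero, add_zero]

/-- Up to a multiple of `2π`, an angle can be chosen in `[0, 2π)`. -/
lemma exists_angle_mem_Ico {l f : ℂ} (hl : l ≠ 0) (hf : f ≠ 0) :
    ∃ θ, HasAngle l f θ ∧ 0 ≤ θ ∧ θ < 2 * Real.pi := by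
  have h := HasAngle.arg_div hl hf
  have h3 : (f / l).arg ≤ Real.pi := Complex.arg_le_pi _
  have h4 : -Real.pi < (f / l).arg := Complex.neg_pi_lt_arg _
  have hpi := Real.pi_pos
  rcases le_or_gt 0 (f / l).arg with h0 | h0
  · exact ⟨_, h, h0, by linarith⟩
  · exact ⟨_, h.add_two_pi, by linarith, by linarith⟩

lemma orientSign_eq_one {f g : ℂ} (h : 0 < planeCross f g) : orientSign f g = 1 := by
  simp [orientSign, sign_pos h]

lemma orientSign_eq_neg_one {f g : ℂ} (h : planeCross f g < 0) : orientSign f g = -1 := by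
  simp [orientSign, sign_neg h]

lemma planeCross_pos_of_angle {l f g : ℂ} {θ φ : ℝ} (hl : l ≠ 0) (h : HasAngle l f θ)
    (h' : HasAngle l g φ) (h0 : 0 < φ - θ) (h1 : φ - θ < Real.pi) : 0 < planeCross f g := by
  obtain ⟨c, hc, e⟩ := planeCross_hasAngle hl h h'
  rw [e]; exact mul_pos hc (Real.sin_pos_of_pos_of_lt_pi h0 h1)

lemma planeCross_swap (f g : ℂ) : planeCross g f = - planeCross f g := by
  unfold planeCross; ring

lemma planeCross_neg_of_angle {l f g : ℂ} {θ φ : ℝ} (hl : l ≠ 0) (h : HasAngle l f θ)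
    (h' : HasAngle l g φ) (h0 : φ - θ < 0) (h1 : -Real.pi < φ - θ) : planeCross f g < 0 := by
  have := planeCross_pos_of_angle hl h' h (by linarith) (by linarith)
  rw [planeCross_swap]; linarith

lemma planeCross_eq_zero_of_angle {l f g : ℂ} {θ φ : ℝ} (hl : l ≠ 0) (h : HasAngle l f θ)
    (h' : HasAngle l g φ) (h0 : Real.sin (φ - θ) = 0) : planeCross f g = 0 := by
  obtain ⟨c, hc, e⟩ := planeCross_hasAngle hl h h'
  rw [e, h0, mul_zero]

/-- For vectors not parallel to `l`, the local winding number is the crossing parity. -/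
lemma windingNumber_cast {l f g : ℂ} (hl : l ≠ 0) (hf : planeCross l f ≠ 0)
    (hg : planeCross l g ≠ 0) (h : (0 : ℂ) ∉ segment ℝ f g) :
    (windingNumber l f g : ZMod 2) = crossParity l f g := by
  obtain ⟨hf0, hg0⟩ := ne_zero_of_zero_notMem_segment h
  have hpi := Real.pi_pos
  obtain ⟨θ, hθ, h0, h1⟩ := exists_angle_mem_Ico hl hf0
  obtain ⟨φ, hφ, hd⟩ := exists_angle_near hθ h
  rw [crossParity_eq hl hθ hφ hd, turnParity_eq_zero h0 h1, zero_add]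
  rw [abs_lt] at hd
  have hl0 := hasAngle_self l
  have hl1 := hl0.add_two_pi
  rw [zero_add] at hl1
  have hθ0 : θ ≠ 0 := by
    rintro rfl
    exact hf (planeCross_eq_zero_of_angle hl hl0 hθ (by simp))
  have hθπ : θ ≠ Real.pi := by
    rintro rfl
    exact hf (planeCross_eq_zero_of_angle hl hl0 hθ (by simp))
  have hφ0 : φ ≠ 0 := by
    rintro rfl
    exact hg (planeCross_eq_zero_of_angle hl hl0 hφ (by simp))
  have hφ2 : φ ≠ 2 * Real.pi := by
    rintro rfl
    exact hg (planeCross_eq_zero_of_angle hl hl0 hφ (by simp))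
  have hφπ : φ ≠ Real.pi := by
    rintro rfl
    exact hg (planeCross_eq_zero_of_angle hl hl0 hφ (by simp))
  have h0' : 0 < θ := lt_of_le_of_ne h0 (Ne.symm hθ0)
  -- The sides of `l` on which `f` and `g` lie are determined by the intervals of length `π`
  -- containing `θ ∈ (0, 2π)` and `φ ∈ (-π, 3π)`; the direction `l` is crossed exactly if `φ < 0`
  -- or `φ > 2π`.
  rcases lt_or_gt_of_ne hθπ with hθ1 | hθ1
  · have a1 : orientSign f l = -1 :=
      orientSign_eq_neg_one (planeCross_neg_of_angle hl hθ hl0 (by linarith) (by linarith))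
    rcases lt_or_gt_of_ne hφ0 with hφ1 | hφ1
    · have a2 : orientSign l g = -1 :=
        orientSign_eq_neg_one (planeCross_neg_of_angle hl hl0 hφ (by linarith) (by linarith))
      have a3 : orientSign f g = -1 :=
        orientSign_eq_neg_one (planeCross_neg_of_angle hl hθ hφ (by linarith) (by linarith))
      rw [turnParity_eq_one (by linarith) hφ1]
      simp only [windingNumber, a1, a2, a3]
      decide
    · rw [turnParity_eq_zero hφ1.le (by linarith)]
      rcases lt_or_gt_of_ne hφπ with hφ3 | hφ3
      · have a2 : orientSign l g = 1 :=
          orientSign_eq_one (planeCross_pos_of_angle hl hl0 hφ (by linarith) (by linarith))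
        simp [windingNumber, a1, a2]
      · have a3 : orientSign f g = 1 :=
          orientSign_eq_one (planeCross_pos_of_angle hl hθ hφ (by linarith) (by linarith))
        simp [windingNumber, a1, a3]
  · have a1 : orientSign f l = 1 :=
      orientSign_eq_one (planeCross_pos_of_angle hl hθ hl1 (by linarith) (by linarith))
    rcases lt_or_gt_of_ne hφ2 with hφ1 | hφ1
    · rw [turnParity_eq_zero (by linarith) hφ1]
      rcases lt_or_gt_of_ne hφπ with hφ3 | hφ3
      · have a3 : orientSign f g = -1 :=
          orientSign_eq_neg_one (planeCross_neg_of_angle hl hθ hφ (by linarith) (by linarith))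
        simp [windingNumber, a1, a3]
      · have a2 : orientSign l g = -1 :=
          orientSign_eq_neg_one (planeCross_neg_of_angle hl hl1 hφ (by linarith) (by linarith))
        simp [windingNumber, a1, a2]
    · have a2 : orientSign l g = 1 :=
        orientSign_eq_one (planeCross_pos_of_angle hl hl1 hφ (by linarith) (by linarith))
      have a3 : orientSign f g = 1 :=
        orientSign_eq_one (planeCross_pos_of_angle hl hθ hφ (by linarith) (by linarith))
      have : turnParity φ = 1 := by
        simpa using turnParity_eq_of_mem (x := φ) 1 (by push_cast; linarith)
          (by push_cast; linarith)
      rw [this]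
      simp only [windingNumber, a1, a2, a3]
      decide

/-- Along a path of nonzero vectors there is a continuous choice of the angle. -/
lemma exists_angle_lift {l : ℂ} (hl : l ≠ 0) {d : unitInterval → ℂ} (hd : Continuous d)
    (h0 : ∀ t, d t ≠ 0) {θ₀ : ℝ} (hθ : HasAngle l (d 0) θ₀) :
    ∃ θ : unitInterval → ℝ, Continuous θ ∧ (∀ t, HasAngle l (d t) (θ t)) ∧ θ 0 = θ₀ := by
  obtain ⟨r, hr, e⟩ := hθ
  let γ : C(unitInterval, {z : ℂ // z ≠ 0}) :=
    ⟨fun t => ⟨d t / l, div_ne_zero (h0 t) hl⟩, by fun_prop⟩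
  have hγ0 : γ 0 = ⟨_, Complex.exp_ne_zero (Real.log r + θ₀ * Complex.I)⟩ := by
    apply Subtype.ext
    change d 0 / l = Complex.exp (Real.log r + θ₀ * Complex.I)
    rw [e, Complex.exp_add, ← Complex.ofReal_exp, Real.exp_log hr]
    field_simp
  obtain ⟨Γ, hΓ, hΓ0⟩ := Complex.isCoveringMap_exp.exists_path_lifts γ
    (Real.log r + θ₀ * Complex.I) hγ0
  refine ⟨fun t => (Γ t).im, by fun_prop, fun t => ?_, ?_⟩
  · have : Complex.exp (Γ t) = d t / l := congrArg Subtype.val (congrFun hΓ t)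
    refine ⟨Real.exp (Γ t).re, Real.exp_pos _, ?_⟩
    rw [Complex.ofReal_exp, ← Complex.exp_add, Complex.re_add_im, this]
    field_simp
  · change (Γ 0).im = θ₀
    rw [hΓ0]; simp

/-- A continuous function avoiding the odd multiples of `π` and starting in
`(-π, π)` stays there. -/
lemma abs_lt_pi_of_continuous {f : unitInterval → ℝ} (hf : Continuous f) (h0 : |f 0| < Real.pi)
    (h : ∀ t, |f t| ≠ Real.pi) (t : unitInterval) : |f t| < Real.pi := by
  by_contra! hc
  obtain ⟨s, -, hs⟩ := (isPreconnected_univ (α := unitInterval)).intermediate_value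
    (Set.mem_univ 0) (Set.mem_univ t) (hf.abs.continuousOn) ⟨h0.le, hc⟩
  exact h s hs

/-- The number of passages does not depend on the choice of the continuous angle. -/
lemma passages_eq {l : ℂ} (hl : l ≠ 0) {d : unitInterval → ℂ} {θ : unitInterval → ℝ}
    (hθ : Continuous θ) (h : ∀ t, HasAngle l (d t) (θ t)) :
    passages l d = turnParity (θ 1) + turnParity (θ 0) := by
  have hex : ∃ θ : unitInterval → ℝ, Continuous θ ∧
      ∀ t, ∃ r : ℝ, 0 < r ∧ d t = r * Complex.exp (θ t * Complex.I) * l := ⟨θ, hθ, h⟩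
  rw [passages, dif_pos hex]
  have hc := hex.choose_spec.1
  have ha : ∀ t, HasAngle l (d t) (hex.choose t) := hex.choose_spec.2
  set φ := hex.choose
  choose k hk using fun t => (h t).exists_eq_add hl (ha t)
  -- the number of full turns between the two choices of the angle is constant
  have hkc : Continuous k := by
    have : Continuous fun t => ((k t : ℤ) : ℝ) := by
      have e : (fun t => ((k t : ℤ) : ℝ)) = fun t => (φ t - θ t) / (2 * Real.pi) := by
        funext t
        have := Real.pi_pos
        rw [hk t]; field_simp; ring
      rw [e]; fun_prop
    exact Int.isClosedEmbedding_coe_real.isEmbedding.continuous_iff.mpr this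
  have hk01 : k 1 = k 0 :=
    (isPreconnected_univ (α := unitInterval)).constant hkc.continuousOn (Set.mem_univ _)
      (Set.mem_univ _)
  have e : ∀ t, ((⌊φ t / (2 * Real.pi)⌋ : ℤ) : ZMod 2) = turnParity (θ t) + k t := fun t => by
    rw [← turnParity_add_int, ← hk t]; rfl
  rw [Int.cast_sub, e 1, e 0, hk01, CharTwo.sub_eq_add,
    show turnParity (θ 1) + k 0 + (turnParity (θ 0) + k 0)
      = turnParity (θ 1) + turnParity (θ 0) + ((k 0 : ZMod 2) + k 0) by ring,
    CharTwo.add_self_eq_zero, add_zero]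

/-- During a motion of two vectors that are never antiparallel, the crossing parity changes by the
number of times at which one of them passes the direction `l`. -/
lemma crossParity_motion {l : ℂ} (hl : l ≠ 0) {d₁ d₂ : unitInterval → ℂ} (h₁ : Continuous d₁)
    (h₂ : Continuous d₂) (h : ∀ t, (0 : ℂ) ∉ segment ℝ (d₁ t) (d₂ t)) :
    crossParity l (d₁ 1) (d₂ 1) = crossParity l (d₁ 0) (d₂ 0) + passages l d₁ + passages l d₂ := by
  have hn := fun t => ne_zero_of_zero_notMem_segment (h t)
  obtain ⟨θ₁, c₁, a₁, -⟩ := exists_angle_lift hl h₁ (fun t => (hn t).1)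
    (HasAngle.arg_div hl (hn 0).1)
  obtain ⟨φ, hφ, hd⟩ := exists_angle_near (a₁ 0) (h 0)
  obtain ⟨θ₂, c₂, a₂, e₂⟩ := exists_angle_lift hl h₂ (fun t => (hn t).2) hφ
  have hlt : ∀ t, |θ₂ t - θ₁ t| < Real.pi := by
    refine fun t => abs_lt_pi_of_continuous (f := fun t => θ₂ t - θ₁ t) (c₂.sub c₁)
      (by rw [e₂]; exact hd) (fun s hs => h s ?_) t
    apply zero_mem_segment_of_angle (a₁ s) (a₂ s)
    rw [← Real.cos_abs, hs, Real.cos_pi]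
  rw [crossParity_eq hl (a₁ 1) (a₂ 1) (hlt 1), crossParity_eq hl (a₁ 0) (a₂ 0) (hlt 0),
    passages_eq hl c₁ a₁, passages_eq hl c₂ a₂]
  generalize turnParity (θ₁ 0) = a
  generalize turnParity (θ₂ 0) = b
  generalize turnParity (θ₁ 1) = c
  generalize turnParity (θ₂ 1) = d
  revert a b c d
  decide

lemma passages_const {l : ℂ} (hl : l ≠ 0) {v : ℂ} (hv : v ≠ 0) : passages l (fun _ => v) = 0 := by
  rw [passages_eq (θ := fun _ => (v / l).arg) hl continuous_const
    (fun _ => HasAngle.arg_div hl hv), CharTwo.add_self_eq_zero]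

/-- Rotating `f` to `l` counts as a crossing when `f` lies on the right of `l`, since `l` itself
counts as lying on its left. -/
lemma crossParity_self_right {l f : ℂ} (hl : l ≠ 0) (h : (0 : ℂ) ∉ segment ℝ f l) :
    crossParity l f l = if planeCross l f < 0 then 1 else 0 := by
  obtain ⟨φ, hφ, hd⟩ := exists_angle_near (hasAngle_self l) (by rwa [segment_symm])
  rw [crossParity_eq hl hφ (hasAngle_self l) (by rwa [abs_sub_comm]),
    turnParity_eq_zero le_rfl (by positivity), add_zero]
  rw [sub_zero, abs_lt] at hd
  rcases lt_or_ge φ 0 with h0 | h0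
  · rw [if_pos (planeCross_neg_of_angle hl (hasAngle_self l) hφ (by linarith) (by linarith)),
      turnParity_eq_one (by linarith) h0]
  · rw [turnParity_eq_zero h0 (by linarith), if_neg]
    rcases h0.eq_or_lt with rfl | h0
    · rw [planeCross_eq_zero_of_angle hl (hasAngle_self l) hφ (by simp)]; simp
    · exact (planeCross_pos_of_angle hl (hasAngle_self l) hφ (by linarith) (by linarith)).not_gt

/-! ### Crossing parity of polygonal curves -/

/-- The side of the line through `0` in the direction `l` on which `x` lies: `1` on the right. -/
noncomputable def sideParity (l x : ℂ) : ZMod 2 :=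
  if planeCross l x < 0 then 1 else 0

lemma ne_zero_of_im_pos {l : ℂ} (hl : 0 < l.im) : l ≠ 0 := by
  rintro rfl; simp at hl

lemma zero_notMem_segment_of_im {f g : ℂ} (hf : f ≠ 0) (hf0 : 0 ≤ f.im) (hg : 0 < g.im) :
    (0 : ℂ) ∉ segment ℝ f g := by
  rintro ⟨a, b, ha, hb, hab, e⟩
  have h1 := congrArg Complex.im e
  simp only [Complex.add_im, Complex.real_smul, Complex.mul_im, Complex.ofReal_re,
    Complex.ofReal_im, zero_mul, add_zero, Complex.zero_im] at h1
  have hb0 : b = 0 := by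
    rcases hb.eq_or_lt with h | h
    · exact h.symm
    · nlinarith [mul_nonneg ha hf0, mul_pos h hg]
  subst hb0
  have : a = 1 := by linarith
  subst this
  simp at e
  exact hf e

lemma sub_zero_notMem_segment {a b z : ℂ} (h : z ∉ segment ℝ a b) :
    (0 : ℂ) ∉ segment ℝ (a - z) (b - z) := by
  rintro ⟨s, t, hs, ht, hst, e⟩
  refine h ⟨s, t, hs, ht, hst, ?_⟩
  simp only [Complex.real_smul] at e ⊢
  have : (s : ℂ) + t = 1 := by exact_mod_cast hst
  linear_combination e + z * this

lemma crossParity_upper {l x : ℂ} (hl : 0 < l.im) (hx : x ≠ 0) (hx0 : 0 ≤ x.im) :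
    crossParity l x l = sideParity l x := by
  rw [crossParity_self_right (ne_zero_of_im_pos hl) (zero_notMem_segment_of_im hx hx0 hl)]
  rfl

lemma crossParity_neg_self {l f : ℂ} (hl : l ≠ 0) (h : (0 : ℂ) ∉ segment ℝ f (-l)) :
    crossParity l f (-l) = 0 := by
  have hn := (hasAngle_self l).neg
  rw [zero_add] at hn
  obtain ⟨φ, hφ, hd⟩ := exists_angle_near hn (by rwa [segment_symm])
  have hpi := Real.pi_pos
  rw [crossParity_eq hl hφ hn (by rwa [abs_sub_comm])]
  rw [abs_lt] at hd
  rw [turnParity_eq_zero (by linarith) (by linarith), turnParity_eq_zero hpi.le (by linarith),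
    add_zero]

/-- A vector moving in the closed lower half-plane does not pass an upward direction. -/
lemma passages_lower {l : ℂ} (hl : 0 < l.im) {d : unitInterval → ℂ} (hd : Continuous d)
    (h0 : ∀ t, d t ≠ 0) (h : ∀ t, (d t).im ≤ 0) : passages l d = 0 := by
  have hl0 := ne_zero_of_im_pos hl
  have hs : ∀ t, (0 : ℂ) ∉ segment ℝ (d t) (-l) := fun t ht => by
    apply zero_notMem_segment_of_im (neg_ne_zero.mpr (h0 t)) (by simpa using h t) hl
    obtain ⟨a, b, ha, hb, hab, e⟩ := ht
    refine ⟨a, b, ha, hb, hab, ?_⟩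
    rw [smul_neg] at e
    rw [smul_neg, ← neg_eq_zero, neg_add, neg_neg]
    exact e
  have := crossParity_motion hl0 hd (continuous_const (y := -l)) hs
  rw [crossParity_neg_self hl0 (hs 0), crossParity_neg_self hl0 (hs 1),
    passages_const hl0 (neg_ne_zero.mpr hl0)] at this
  simpa using this.symm

/-- A vector moving in the closed upper half-plane passes an upward direction when it changes the
side. -/
lemma passages_upper {l : ℂ} (hl : 0 < l.im) {d : unitInterval → ℂ} (hd : Continuous d)
    (h0 : ∀ t, d t ≠ 0) (h : ∀ t, 0 ≤ (d t).im) :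
    sideParity l (d 1) = sideParity l (d 0) + passages l d := by
  have hl0 := ne_zero_of_im_pos hl
  have := crossParity_motion hl0 hd (continuous_const (y := l))
    (fun t => zero_notMem_segment_of_im (h0 t) (h t) hl)
  rw [passages_const hl0 hl0, crossParity_upper hl (h0 1) (h 1),
    crossParity_upper hl (h0 0) (h 0)] at this
  simpa using this

lemma crossParity_self_self {l f : ℂ} (hl : l ≠ 0) (hf : f ≠ 0) : crossParity l f f = 0 := by
  have h := HasAngle.arg_div hl hf
  rw [crossParity_eq hl h h (by simpa using Real.pi_pos), CharTwo.add_self_eq_zero]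

/-- The crossing parity is additive for triples of vectors whose triangle does not contain `0`. -/
lemma crossParity_triangle {l f g h : ℂ} (hl : l ≠ 0)
    (H : ∀ x ∈ segment ℝ f g, (0 : ℂ) ∉ segment ℝ x h) :
    crossParity l f g = crossParity l f h + crossParity l g h := by
  have hfg : ∀ x ∈ segment ℝ f g, x ≠ 0 := fun x hx =>
    (ne_zero_of_zero_notMem_segment (H x hx)).1
  have hh : h ≠ 0 := (ne_zero_of_zero_notMem_segment (H f (left_mem_segment ℝ f g))).2
  let d : unitInterval → ℂ := fun t => AffineMap.lineMap f g (t : ℝ)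
  have hd : Continuous d := by
    exact (AffineMap.lineMap_continuous (R := ℝ)).comp continuous_subtype_val
  have hm : ∀ t, d t ∈ segment ℝ f g := fun t => by
    rw [segment_eq_image_lineMap]; exact ⟨t, t.2, rfl⟩
  have d0 : d 0 = f := by simp [d]
  have d1 : d 1 = g := by simp [d]
  -- Moving `g` along the segment from `f` accounts for `crossParity l f g`; moving the same
  -- vector against the fixed `h` accounts for the other two terms.
  have e1 := crossParity_motion hl (continuous_const (y := f)) hd (fun t ht => by
    apply hfg 0 _ rfl
    exact (convex_segment f g).segment_subset (left_mem_segment ℝ f g) (hm t) ht)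
  have e2 := crossParity_motion hl hd (continuous_const (y := h)) (fun t => H _ (hm t))
  rw [d0, d1, passages_const hl (hfg f (left_mem_segment ℝ f g)),
    crossParity_self_self hl (hfg f (left_mem_segment ℝ f g))] at e1
  rw [d0, d1, passages_const hl hh] at e2
  rw [e1, e2, add_zero, add_zero, zero_add, ← add_assoc, CharTwo.add_self_eq_zero, zero_add]

/-- In the closed upper half-plane the crossing parity tells whether two vectors lie on different
sides of the gauge ray. -/
lemma crossParity_of_upper {l f g : ℂ} (hl : 0 < l.im) (hf : 0 ≤ f.im) (hg : 0 ≤ g.im)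
    (h : (0 : ℂ) ∉ segment ℝ f g) : crossParity l f g = sideParity l f + sideParity l g := by
  rw [crossParity_triangle (ne_zero_of_im_pos hl) (h := l), crossParity_upper hl _ hf,
    crossParity_upper hl _ hg]
  · exact (ne_zero_of_zero_notMem_segment h).2
  · exact (ne_zero_of_zero_notMem_segment h).1
  · intro x hx
    refine zero_notMem_segment_of_im (fun e => h (e ▸ hx)) ?_ hl
    exact (convex_halfSpace_im_ge 0).segment_subset hf hg hx

/-- The points of a finite family of segments. -/
def edgeTrace (E : Finset (ℂ × ℂ)) : Set ℂ := {z | ∃ e ∈ E, z ∈ segment ℝ e.1 e.2}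

/-- The parity of the number of segments of `E` crossed by the ray from `z` in the direction `l`.
As it is defined by angles seen from `z`, it needs no genericity of the ray, only that `z` is not
on the segments. -/
noncomputable def crossCount (l : ℂ) (E : Finset (ℂ × ℂ)) (z : ℂ) : ZMod 2 :=
  ∑ e ∈ E, crossParity l (e.1 - z) (e.2 - z)

/-- `B` is the boundary modulo 2 of the chain `E`: sums of a function over the ends of the
segments of `E` reduce to its sum over `B`. -/
def IsEdgeBoundary (E : Finset (ℂ × ℂ)) (B : Finset ℂ) : Prop :=
  ∀ g : ℂ → ZMod 2, ∑ e ∈ E, (g e.1 + g e.2) = ∑ p ∈ B, g p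

lemma isCompact_segment' (a b : ℂ) : IsCompact (segment ℝ a b) := by
  rw [segment_eq_image_lineMap]
  exact isCompact_Icc.image (AffineMap.lineMap_continuous (R := ℝ))

lemma isCompact_edgeTrace (E : Finset (ℂ × ℂ)) : IsCompact (edgeTrace E) := by
  have : edgeTrace E = ⋃ e ∈ E, segment ℝ e.1 e.2 := by
    ext z; simp [edgeTrace]
  rw [this]
  exact E.finite_toSet.isCompact_biUnion fun e _ => isCompact_segment' _ _

lemma notMem_segment_of_notMem_edgeTrace {E : Finset (ℂ × ℂ)} {z : ℂ} (h : z ∉ edgeTrace E)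
    {e : ℂ × ℂ} (he : e ∈ E) : z ∉ segment ℝ e.1 e.2 := fun hz => h ⟨e, he, hz⟩

/-- The crossing count changes along a path only through the ends of the chain. -/
lemma crossCount_path {l : ℂ} (hl : l ≠ 0) {E : Finset (ℂ × ℂ)} {B : Finset ℂ}
    (hB : IsEdgeBoundary E B) {γ : unitInterval → ℂ} (hγ : Continuous γ)
    (h : ∀ t, γ t ∉ edgeTrace E) :
    crossCount l E (γ 1) = crossCount l E (γ 0) + ∑ p ∈ B, passages l (fun t => p - γ t) := by
  rw [← hB (fun p => passages l (fun t => p - γ t)), crossCount, crossCount,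
    ← Finset.sum_add_distrib]
  refine Finset.sum_congr rfl fun e he => ?_
  rw [crossParity_motion (d₁ := fun t => e.1 - γ t) (d₂ := fun t => e.2 - γ t) hl (by fun_prop)
    (by fun_prop) (fun t => sub_zero_notMem_segment (notMem_segment_of_notMem_edgeTrace (h t) he)),
    add_assoc]

/-- The crossing count is constant on the regions of a chain whose ends are on the real line:
seen from the upper half-plane these ends do not pass the upward direction `l`. -/
lemma crossCount_joinedIn {l : ℂ} (hl : 0 < l.im) {E : Finset (ℂ × ℂ)} {B : Finset ℂ}
    (hB : IsEdgeBoundary E B) (hB0 : ∀ p ∈ B, p.im = 0 ∧ p ∈ edgeTrace E) {z z' : ℂ}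
    (h : JoinedIn ({z | 0 ≤ z.im} \ edgeTrace E) z z') : crossCount l E z = crossCount l E z' := by
  obtain ⟨γ, hγ⟩ := h
  have := crossCount_path (ne_zero_of_im_pos hl) hB γ.continuous (fun t => (hγ t).2)
  rw [γ.source, γ.target, Finset.sum_eq_zero, add_zero] at this
  · exact this.symm
  · intro p hp
    obtain ⟨hp0, hpE⟩ := hB0 p hp
    refine passages_lower hl (by fun_prop) (fun t e => (hγ t).2 ?_) (fun t => ?_)
    · rw [← sub_eq_zero.mp e]; exact hpE
    · have := (hγ t).1
      simp only [Set.mem_ofPred_eq] at this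
      simpa [hp0] using this

/-- The crossing count of a chain in the closed upper half-plane, at a point of the real line. -/
lemma crossCount_real {l : ℂ} (hl : 0 < l.im) {E : Finset (ℂ × ℂ)} {B : Finset ℂ}
    (hB : IsEdgeBoundary E B) (hE : ∀ e ∈ E, 0 ≤ e.1.im ∧ 0 ≤ e.2.im) {r : ℂ} (hr : r.im = 0)
    (h : r ∉ edgeTrace E) : crossCount l E r = ∑ p ∈ B, sideParity l (p - r) := by
  rw [← hB (fun p => sideParity l (p - r)), crossCount]
  refine Finset.sum_congr rfl fun e he => ?_
  obtain ⟨h1, h2⟩ := hE e he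
  exact crossParity_of_upper hl (by simpa [hr] using h1) (by simpa [hr] using h2)
    (sub_zero_notMem_segment (notMem_segment_of_notMem_edgeTrace h he))

/-- The crossing count vanishes above the chain. -/
lemma crossCount_above {l : ℂ} (hl : 0 < l.im) {E : Finset (ℂ × ℂ)} {z : ℂ}
    (h : ∀ e ∈ E, e.1.im < z.im ∧ e.2.im < z.im) : crossCount l E z = 0 := by
  refine Finset.sum_eq_zero fun e he => ?_
  have key : ∀ x : ℂ, x.im < 0 → (0 : ℂ) ∉ segment ℝ x (-l) := fun x hx ht => by
    apply zero_notMem_segment_of_im (f := -x) (by rintro e; simp [neg_eq_zero.mp e] at hx)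
      (by simpa using hx.le) hl
    obtain ⟨a, b, ha, hb, hab, e⟩ := ht
    refine ⟨a, b, ha, hb, hab, ?_⟩
    rw [smul_neg] at e
    rw [smul_neg, ← neg_eq_zero, neg_add, neg_neg]
    exact e
  obtain ⟨h1, h2⟩ := h e he
  have h1' : (e.1 - z).im < 0 := by simpa using h1
  have h2' : (e.2 - z).im < 0 := by simpa using h2
  rw [crossParity_triangle (ne_zero_of_im_pos hl) (h := -l) fun x hx => key x ?_,
    crossParity_neg_self (ne_zero_of_im_pos hl) (key _ h1'),
    crossParity_neg_self (ne_zero_of_im_pos hl) (key _ h2'), add_zero]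
  exact (convex_halfSpace_im_lt 0).segment_subset h1' h2' hx

/-! ### The two sides of a simple polygonal curve -/

/-- A finite family of oriented segments forming a simple polygonal curve (an arc or a closed
curve).  The field `connected` expresses that any two of the segments are linked by a chain of
consecutive ones. -/
structure IsSimpleCurve (E : Finset (ℂ × ℂ)) : Prop where
  ne : ∀ e ∈ E, e.1 ≠ e.2
  disjoint : ∀ e ∈ E, ∀ e' ∈ E, e ≠ e' →
    Disjoint (openSegment ℝ e.1 e.2) (openSegment ℝ e'.1 e'.2)
  fst_notMem : ∀ e ∈ E, ∀ e' ∈ E, e'.1 ∉ openSegment ℝ e.1 e.2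
  snd_notMem : ∀ e ∈ E, ∀ e' ∈ E, e'.2 ∉ openSegment ℝ e.1 e.2
  fst_inj : ∀ e ∈ E, ∀ e' ∈ E, e.1 = e'.1 → e = e'
  snd_inj : ∀ e ∈ E, ∀ e' ∈ E, e.2 = e'.2 → e = e'
  connected : ∀ P : ℂ × ℂ → Prop, (∀ e ∈ E, ∀ e' ∈ E, e.2 = e'.1 → (P e ↔ P e')) →
    ∀ e ∈ E, ∀ e' ∈ E, P e → P e'

/-- The points close to `x` on the side of the direction `d` are joined to `z` in `Ω`. -/
def Adheres (Ω : Set ℂ) (z x d : ℂ) : Prop :=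
  ∀ᶠ τ : ℝ in 𝓝[>] 0, JoinedIn Ω z (x + τ * d)

lemma eventually_scale {c : ℝ} (hc : 0 < c) {p : ℝ → Prop} (h : ∀ᶠ τ : ℝ in 𝓝[>] 0, p τ) :
    ∀ᶠ τ : ℝ in 𝓝[>] 0, p (c * τ) := by
  have : Filter.Tendsto (fun τ : ℝ => c * τ) (𝓝[>] 0) (𝓝[>] 0) := by
    apply tendsto_nhdsWithin_iff.mpr
    constructor
    · have : Filter.Tendsto (fun τ : ℝ => c * τ) (𝓝 0) (𝓝 (c * 0)) := by
        exact (continuous_const.mul continuous_id).tendsto 0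
      rw [mul_zero] at this
      exact this.mono_left nhdsWithin_le_nhds
    · filter_upwards [self_mem_nhdsWithin] with τ hτ
      exact mul_pos hc hτ
  exact this.eventually h

lemma Adheres.smul {Ω : Set ℂ} {z x d : ℂ} (h : Adheres Ω z x d) {c : ℝ} (hc : 0 < c) :
    Adheres Ω z x (c * d) := by
  filter_upwards [eventually_scale hc h] with τ hτ
  rw [show (τ : ℂ) * (c * d) = ((c * τ : ℝ) : ℂ) * d by push_cast; ring]
  exact hτ

lemma Adheres.of_smul {Ω : Set ℂ} {z x d : ℂ} {c : ℝ} (hc : 0 < c) (h : Adheres Ω z x (c * d)) :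
    Adheres Ω z x d := by
  have := h.smul (inv_pos.mpr hc)
  rwa [← mul_assoc, ← Complex.ofReal_mul, inv_mul_cancel₀ hc.ne', Complex.ofReal_one, one_mul]
    at this

lemma Adheres.trans {Ω : Set ℂ} {z z' x d : ℂ} (h' : JoinedIn Ω z' z) (h : Adheres Ω z x d) :
    Adheres Ω z' x d := by
  filter_upwards [h] with τ hτ using h'.trans hτ

lemma Adheres.joinedIn {Ω : Set ℂ} {z z' x d : ℂ} (h : Adheres Ω z x d) (h' : Adheres Ω z' x d) :
    JoinedIn Ω z z' := by
  obtain ⟨τ, h1, h2⟩ := (h.and h').exists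
  exact h1.trans h2.symm

lemma Adheres.mono {Ω Ω' : Set ℂ} {z x d : ℂ} (h : Adheres Ω z x d) (hs : Ω ⊆ Ω') :
    Adheres Ω' z x d := by
  filter_upwards [h] with τ hτ using hτ.mono hs

/-- Moving from a point of a segment at a right angle leaves the segment. -/
lemma notMem_segment_of_side {a b x : ℂ} (hab : a ≠ b) (hx : x ∈ segment ℝ a b) {τ : ℝ}
    (hτ : τ ≠ 0) : x + τ * (Complex.I * (b - a)) ∉ segment ℝ a b := by
  rw [segment_eq_image] at *
  obtain ⟨s, hs, rfl⟩ := hx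
  rintro ⟨t, ht, e⟩
  simp only [Complex.real_smul] at e
  have e' : ((t - s : ℝ) : ℂ) * (b - a) = τ * Complex.I * (b - a) := by
    push_cast
    push_cast at e
    linear_combination e
  have h3 := mul_right_cancel₀ (sub_ne_zero.mpr hab.symm) e'
  have h4 := congrArg Complex.im h3
  simp at h4
  exact hτ h4.symm

lemma isOpen_compl_edgeTrace_diff {E : Finset (ℂ × ℂ)} (p : ℂ × ℂ → Prop) :
    IsOpen {z : ℂ | ∀ e ∈ E, p e → z ∉ segment ℝ e.1 e.2} := by
  have : {z : ℂ | ∀ e ∈ E, p e → z ∉ segment ℝ e.1 e.2} =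
      ⋂ e ∈ E, {z : ℂ | p e → z ∉ segment ℝ e.1 e.2} := by
    ext z; simp
  rw [this]
  refine isOpen_biInter_finset fun e _ => ?_
  by_cases hp : p e
  · simp only [hp, true_imp_iff]
    exact (isCompact_segment' e.1 e.2).isClosed.isOpen_compl
  · simp [hp]

section SimpleCurve

variable {E : Finset (ℂ × ℂ)} {U : Set ℂ}

lemma mem_segment_of_mem_openSegment {a b x : ℂ} (h : x ∈ openSegment ℝ a b) :
    x ∈ segment ℝ a b := openSegment_subset_segment ℝ a b h

lemma IsSimpleCurve.notMem_segment (hE : IsSimpleCurve E) {e e' : ℂ × ℂ} (he : e ∈ E)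
    (he' : e' ∈ E) (hne : e' ≠ e) {x : ℂ} (hx : x ∈ openSegment ℝ e.1 e.2) :
    x ∉ segment ℝ e'.1 e'.2 := by
  intro h
  rw [← insert_endpoints_openSegment] at h
  rcases h with rfl | rfl | h
  · exact hE.fst_notMem e he e' he' hx
  · exact hE.snd_notMem e he e' he' hx
  · exact Set.disjoint_left.mp (hE.disjoint e' he' e he hne) h hx

/-- A curve-free region next to a segment of the curve can be followed along the segment. -/
lemma IsSimpleCurve.adheres_slide (hE : IsSimpleCurve E) (hU : IsOpen U) {e : ℂ × ℂ} (he : e ∈ E)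
    {x y z : ℂ} (hx : x ∈ openSegment ℝ e.1 e.2) (hy : y ∈ openSegment ℝ e.1 e.2)
    (hxy : segment ℝ x y ⊆ U) {s : ℝ} (hs : s ≠ 0)
    (h : Adheres (U \ edgeTrace E) z x (s * (Complex.I * (e.2 - e.1)))) :
    Adheres (U \ edgeTrace E) z y (s * (Complex.I * (e.2 - e.1))) := by
  set O : Set ℂ := U ∩ {z | ∀ e' ∈ E, e' ≠ e → z ∉ segment ℝ e'.1 e'.2} with hO
  have hOo : IsOpen O := hU.inter (isOpen_compl_edgeTrace_diff _)
  have hsub : segment ℝ x y ⊆ openSegment ℝ e.1 e.2 :=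
    (convex_openSegment e.1 e.2).segment_subset hx hy
  have hKO : segment ℝ x y ⊆ O := fun p hp =>
    ⟨hxy hp, fun e' he' hne => hE.notMem_segment he he' hne (hsub hp)⟩
  obtain ⟨δ, hδ, hth⟩ := (isCompact_segment' x y).exists_thickening_subset_open hOo hKO
  set d : ℂ := s * (Complex.I * (e.2 - e.1)) with hd
  have hsmall : ∀ᶠ τ : ℝ in 𝓝[>] 0, ‖(τ : ℂ) * d‖ < δ := by
    have : Filter.Tendsto (fun τ : ℝ => ‖(τ : ℂ) * d‖) (𝓝 0) (𝓝 ‖((0 : ℝ) : ℂ) * d‖) :=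
      (by fun_prop : Continuous fun τ : ℝ => ‖(τ : ℂ) * d‖).tendsto 0
    simp only [Complex.ofReal_zero, zero_mul, norm_zero] at this
    exact (this.mono_left nhdsWithin_le_nhds).eventually (gt_mem_nhds hδ)
  filter_upwards [h, hsmall, self_mem_nhdsWithin] with τ h1 h2 h3
  refine h1.trans (JoinedIn.of_segment_subset fun q hq => ?_)
  obtain ⟨p, hp, rfl⟩ : ∃ p ∈ segment ℝ x y, p + τ * d = q := by
    have := segment_translate_image ℝ (τ * d) x y
    rw [add_comm x, add_comm y, ← this] at hq
    obtain ⟨p, hp, rfl⟩ := hq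
    exact ⟨p, hp, add_comm _ _⟩
  have hq : p + τ * d ∈ O := hth (by
    rw [Metric.mem_thickening_iff]
    exact ⟨p, hp, by simpa [dist_eq_norm] using h2⟩)
  refine ⟨hq.1, ?_⟩
  rintro ⟨e', he', hm⟩
  by_cases hne : e' = e
  · subst hne
    refine notMem_segment_of_side (hE.ne e' he') (mem_segment_of_mem_openSegment (hsub hp))
      (τ := τ * s) (mul_ne_zero (ne_of_gt h3) hs) ?_
    convert hm using 2
    rw [hd]; push_cast; ring
  · exact hq.2 e' he' hne hm

/-- The points near an interior point of a segment of the curve lie on one of its sides. -/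
lemma IsSimpleCurve.eventually_side (hE : IsSimpleCurve E) (hU : IsOpen U) {e : ℂ × ℂ} (he : e ∈ E)
    {x : ℂ} (hx : x ∈ openSegment ℝ e.1 e.2) (hxU : x ∈ U) :
    ∀ᶠ y in 𝓝 x, y ∉ edgeTrace E → ∃ s : ℝ, (s = 1 ∨ s = -1) ∧
      0 < s * planeCross (e.2 - e.1) (y - x) ∧
      Adheres (U \ edgeTrace E) y x (s * (Complex.I * (e.2 - e.1))) := by
  set O : Set ℂ := U ∩ {z | ∀ e' ∈ E, e' ≠ e → z ∉ segment ℝ e'.1 e'.2} with hO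
  have hOo : IsOpen O := hU.inter (isOpen_compl_edgeTrace_diff _)
  have hxO : x ∈ O := ⟨hxU, fun e' he' hne => hE.notMem_segment he he' hne hx⟩
  obtain ⟨r, hr, hb⟩ := Metric.isOpen_iff.mp hOo x hxO
  have hne := sub_ne_zero.mpr (hE.ne e he).symm
  set v := e.2 - e.1 with hv
  have hv2 : 0 < v.re ^ 2 + v.im ^ 2 := by
    have := Complex.normSq_pos.mpr hne
    rw [Complex.normSq_apply] at this
    nlinarith
  -- half-discs are free of the curve
  have hhalf : ∀ s : ℝ, ∀ q ∈ Metric.ball x r, 0 < s * planeCross v (q - x) →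
      q ∈ U \ edgeTrace E := by
    intro s q hq hs
    refine ⟨(hb hq).1, ?_⟩
    rintro ⟨e', he', hm⟩
    by_cases hee : e' = e
    · subst hee
      have : planeCross v (q - x) = 0 := by
        have hx' := mem_segment_of_mem_openSegment hx
        rw [segment_eq_image] at hm hx'
        obtain ⟨t, -, rfl⟩ := hm
        obtain ⟨t', -, rfl⟩ := hx'
        simp only [planeCross, hv, Complex.real_smul, Complex.sub_re, Complex.sub_im,
          Complex.add_re, Complex.add_im, Complex.mul_re, Complex.mul_im, Complex.ofReal_re,
          Complex.ofReal_im]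
        ring
      rw [this, mul_zero] at hs
      exact lt_irrefl _ hs
    · exact (hb hq).2 e' he' hee hm
  have hline : ∀ᶠ y in 𝓝 x, planeCross v (y - x) = 0 → y ∈ segment ℝ e.1 e.2 := by
    -- the coordinate of `y` along the segment
    obtain ⟨t₀, ht₀, hxt⟩ : ∃ t ∈ Set.Ioo (0 : ℝ) 1, e.1 + t * v = x := by
      rw [openSegment_eq_image] at hx
      obtain ⟨t, ht, rfl⟩ := hx
      exact ⟨t, ht, by simp only [Complex.real_smul, hv]; push_cast; ring⟩
    let T : ℂ → ℝ := fun y => t₀ + ((y - x).re * v.re + (y - x).im * v.im) /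
      (v.re ^ 2 + v.im ^ 2)
    have hT : Continuous T := by fun_prop
    have hTx : T x ∈ Set.Ioo (0 : ℝ) 1 := by simpa [T] using ht₀
    filter_upwards [hT.continuousAt.preimage_mem_nhds (isOpen_Ioo.mem_nhds hTx)] with y hy h0
    rw [segment_eq_image]
    refine ⟨T y, ⟨hy.1.le, hy.2.le⟩, ?_⟩
    have e1 : y - x = (((y - x).re * v.re + (y - x).im * v.im) / (v.re ^ 2 + v.im ^ 2) : ℝ) * v :=
        by
      unfold planeCross at h0
      apply Complex.ext
      · simp only [Complex.re_ofReal_mul]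
        field_simp
        linear_combination (-v.im) * h0
      · simp only [Complex.im_ofReal_mul]
        field_simp
        linear_combination (v.re) * h0
    have e2 : y = e.1 + (T y : ℂ) * v := by
      have : (T y : ℂ) * v = t₀ * v + (y - x) := by
        conv_rhs => rw [e1]
        simp only [T]; push_cast; ring
      rw [this]; linear_combination -hxt
    conv_rhs => rw [e2]
    simp only [Complex.real_smul, hv]; push_cast; ring
  filter_upwards [hline, Metric.ball_mem_nhds x hr] with y hy hyr hyE
  have hc0 : planeCross v (y - x) ≠ 0 := fun h0 => hyE ⟨e, he, hy h0⟩
  obtain ⟨s, hs, hsc⟩ : ∃ s : ℝ, (s = 1 ∨ s = -1) ∧ 0 < s * planeCross v (y - x) := by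
    rcases lt_or_gt_of_ne hc0 with h | h
    · exact ⟨-1, Or.inr rfl, by linarith⟩
    · exact ⟨1, Or.inl rfl, by linarith⟩
  refine ⟨s, hs, hsc, ?_⟩
  have hs2 : s * s = 1 := by rcases hs with rfl | rfl <;> norm_num
  have hsmall : ∀ᶠ τ : ℝ in 𝓝[>] 0, x + (τ : ℂ) * (s * (Complex.I * v)) ∈ Metric.ball x r := by
    have : Filter.Tendsto (fun τ : ℝ => x + (τ : ℂ) * (s * (Complex.I * v))) (𝓝 0)
        (𝓝 (x + ((0 : ℝ) : ℂ) * (s * (Complex.I * v)))) :=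
      (by fun_prop : Continuous fun τ : ℝ => x + (τ : ℂ) * (s * (Complex.I * v))).tendsto 0
    simp only [Complex.ofReal_zero, zero_mul, add_zero] at this
    exact (this.mono_left nhdsWithin_le_nhds).eventually (Metric.ball_mem_nhds x hr)
  filter_upwards [hsmall, self_mem_nhdsWithin] with τ h1 h2
  refine JoinedIn.of_segment_subset fun q hq => hhalf s q ?_ ?_
  · exact (convex_ball x r).segment_subset hyr h1 hq
  · have hconv : Convex ℝ {q : ℂ | 0 < s * planeCross v (q - x)} := by
      intro p hp q hq a b ha hb hab
      simp only [Set.mem_ofPred_eq] at hp hq ⊢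
      have : s * planeCross v (a • p + b • q - x) =
          a * (s * planeCross v (p - x)) + b * (s * planeCross v (q - x)) := by
        obtain rfl : b = 1 - a := by linarith
        simp only [planeCross, Complex.real_smul, Complex.sub_re, Complex.sub_im,
          Complex.add_re, Complex.add_im, Complex.mul_re, Complex.mul_im, Complex.ofReal_re,
          Complex.ofReal_im]
        ring
      rw [this]
      rcases ha.eq_or_lt with h | h
      · have : b = 1 := by linarith
        rw [← h, this]; linarith
      · have := mul_pos h hp
        have := mul_nonneg hb hq.le
        linarith
    refine hconv.segment_subset (x := y) hsc ?_ hq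
    simp only [Set.mem_ofPred_eq, planeCross, Complex.sub_re, Complex.sub_im,
      Complex.add_re, Complex.add_im, Complex.mul_re, Complex.mul_im, Complex.ofReal_re,
      Complex.ofReal_im, Complex.I_re, Complex.I_im]
    have : 0 < τ * (v.re ^ 2 + v.im ^ 2) := mul_pos h2 hv2
    nlinarith

/-! ### The jump of the crossing count across the curve -/

lemma hasAngle_mul {v w : ℂ} (hw : w ≠ 0) : HasAngle v (w * v) w.arg :=
  ⟨‖w‖, norm_pos_iff.mpr hw, by rw [Complex.norm_mul_exp_arg_mul_I]⟩

lemma arg_add_mul_I_bounds {a σ : ℝ} (ha : 0 < a) :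
    |((a : ℂ) + σ * Complex.I).arg| < Real.pi / 2 ∧
      (0 < σ → 0 < ((a : ℂ) + σ * Complex.I).arg) ∧
      (σ < 0 → ((a : ℂ) + σ * Complex.I).arg < 0) := by
  refine ⟨?_, fun h => ?_, fun h => ?_⟩
  · rw [Complex.abs_arg_lt_pi_div_two_iff]
    left; simpa using ha
  · refine lt_of_le_of_ne (Complex.arg_nonneg_iff.mpr (by simpa using h.le)) fun e => ?_
    have := (Complex.arg_eq_zero_iff.mp e.symm).2
    simp at this
    exact h.ne' this
  · exact Complex.arg_neg_iff.mpr (by simpa using h)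

lemma add_mul_I_ne_zero {a σ : ℝ} (ha : 0 < a) : (a : ℂ) + σ * Complex.I ≠ 0 := fun h => by
  have := congrArg Complex.re h
  simp at this
  exact ha.ne' this

lemma continuous_arg_add_mul_I {a : ℝ} (ha : 0 < a) :
    Continuous fun σ : ℝ => ((a : ℂ) + σ * Complex.I).arg := by
  refine continuous_iff_continuousAt.mpr fun σ => ?_
  refine ContinuousAt.comp (g := Complex.arg) (f := fun σ : ℝ => (a : ℂ) + σ * Complex.I)
    (Complex.continuousAt_arg ?_) (by fun_prop)
  left; simpa using ha

/-- When a point moves across a segment, the crossing parity of the segment, corrected by the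
passages of its ends, jumps. -/
lemma crossParity_jump {l v : ℂ} (hl : l ≠ 0) (hv : v ≠ 0) {a b : ℝ} (ha : 0 < a) (hb : 0 < b)
    {σ : unitInterval → ℝ} (hσ : Continuous σ) (h0 : σ 0 < 0) (h1 : 0 < σ 1)
    {f g : unitInterval → ℂ} (hf : ∀ t, f t = -((a + σ t * Complex.I) * v))
    (hg : ∀ t, g t = (b + (-σ t : ℝ) * Complex.I) * v) :
    crossParity l (f 1) (g 1) = crossParity l (f 0) (g 0) + passages l f + passages l g + 1 := by
  have hvl := HasAngle.arg_div hl hv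
  set A : unitInterval → ℝ := fun t => ((a : ℂ) + σ t * Complex.I).arg with hA
  set A' : unitInterval → ℝ := fun t => ((b : ℂ) + (-σ t : ℝ) * Complex.I).arg with hA'
  set φ := (v / l).arg
  have cA : Continuous A := (continuous_arg_add_mul_I ha).comp hσ
  have cA' : Continuous A' := (continuous_arg_add_mul_I hb).comp hσ.neg
  have af : ∀ t, HasAngle l (f t) (φ + A t + Real.pi) := fun t => by
    rw [hf]; exact (hvl.trans (hasAngle_mul (add_mul_I_ne_zero ha))).neg
  have ag : ∀ t, HasAngle l (g t) (φ + A' t) := fun t => by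
    rw [hg]; exact hvl.trans (hasAngle_mul (add_mul_I_ne_zero hb))
  have bA := fun t => arg_add_mul_I_bounds (a := a) (σ := σ t) ha
  have bA' := fun t => arg_add_mul_I_bounds (a := b) (σ := -σ t) hb
  have e0 : crossParity l (f 0) (g 0) = turnParity (φ + A 0 + Real.pi) + turnParity (φ + A' 0) := by
    apply crossParity_eq hl (af 0) (ag 0)
    have h2 := (bA 0).2.2 h0
    have h3 := (bA' 0).2.1 (by linarith)
    have h4 := abs_lt.mp (bA 0).1
    have h5 := abs_lt.mp (bA' 0).1
    rw [abs_lt]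
    constructor <;> simp only [hA, hA'] <;> linarith
  have e1 : crossParity l (f 1) (g 1) =
      turnParity (φ + A 1 + Real.pi - 2 * Real.pi) + turnParity (φ + A' 1) := by
    apply crossParity_eq hl (af 1).sub_two_pi (ag 1)
    have h2 := (bA 1).2.1 h1
    have h3 := (bA' 1).2.2 (by linarith)
    have h4 := abs_lt.mp (bA 1).1
    have h5 := abs_lt.mp (bA' 1).1
    rw [abs_lt]
    constructor <;> simp only [hA, hA'] <;> linarith
  have e2 := turnParity_add_two_pi (φ + A 1 + Real.pi - 2 * Real.pi)
  rw [sub_add_cancel] at e2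
  rw [e1, e0, passages_eq hl (by fun_prop) af, passages_eq hl (by fun_prop) ag, e2]
  generalize turnParity (φ + A 1 + Real.pi - 2 * Real.pi) = p
  generalize turnParity (φ + A 0 + Real.pi) = q
  generalize turnParity (φ + A' 1) = r
  generalize turnParity (φ + A' 0) = s
  revert p q r s
  decide

/-- The crossing count jumps across each segment of the curve. -/
lemma IsSimpleCurve.crossCount_jump (hE : IsSimpleCurve E) {l : ℂ} (hl : 0 < l.im) {B : Finset ℂ}
    (hB : IsEdgeBoundary E B) (hB0 : ∀ p ∈ B, p.im = 0) {e : ℂ × ℂ} (he : e ∈ E) {x : ℂ}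
    (hx : x ∈ openSegment ℝ e.1 e.2) (hxH : 0 < x.im) :
    ∀ᶠ τ : ℝ in 𝓝[>] 0, crossCount l E (x + τ * (Complex.I * (e.2 - e.1))) =
      crossCount l E (x - τ * (Complex.I * (e.2 - e.1))) + 1 := by
  have hl0 := ne_zero_of_im_pos hl
  have hne := sub_ne_zero.mpr (hE.ne e he).symm
  set v := e.2 - e.1 with hv
  set O : Set ℂ := {z | 0 < z.im} ∩ {z | ∀ e' ∈ E, e' ≠ e → z ∉ segment ℝ e'.1 e'.2} with hO
  have hOo : IsOpen O := (isOpen_lt continuous_const Complex.continuous_im).inter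
    (isOpen_compl_edgeTrace_diff _)
  have hxO : x ∈ O := ⟨hxH, fun e' he' hne => hE.notMem_segment he he' hne hx⟩
  obtain ⟨r, hr, hb⟩ := Metric.isOpen_iff.mp hOo x hxO
  have hvn : 0 < ‖v‖ := norm_pos_iff.mpr hne
  have hsmall : ∀ᶠ τ : ℝ in 𝓝[>] 0, τ < r / ‖v‖ :=
    nhdsWithin_le_nhds (gt_mem_nhds (div_pos hr hvn))
  filter_upwards [hsmall, self_mem_nhdsWithin] with τ h1 h2
  have h2' : 0 < τ := h2
  rw [lt_div_iff₀ hvn] at h1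
  -- The path `γ` crosses the segment `e` at `x` at a right angle and meets no other segment.
  let σ : unitInterval → ℝ := fun t => (2 * (t : ℝ) - 1) * τ
  have hσ : Continuous σ := by fun_prop
  have hσ1 : ∀ t, |σ t| ≤ τ := fun t => by
    have := t.2.1; have := t.2.2
    rw [abs_mul, abs_of_pos h2']
    have : |2 * (t : ℝ) - 1| ≤ 1 := abs_le.mpr ⟨by linarith, by linarith⟩
    nlinarith
  let γ : unitInterval → ℂ := fun t => x + σ t * (Complex.I * v)
  have hγ : Continuous γ := by fun_prop
  have hγO : ∀ t, γ t ∈ O := fun t => hb (by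
    rw [Metric.mem_ball, dist_eq_norm]
    simp only [γ, add_sub_cancel_left, norm_mul, Complex.norm_I, one_mul, Complex.norm_real,
      Real.norm_eq_abs]
    nlinarith [hσ1 t])
  have γ0 : γ 0 = x - τ * (Complex.I * v) := by simp [γ, σ]; ring
  have σ1 : σ 1 = τ := by simp only [σ, Set.Icc.coe_one]; ring
  have γ1 : γ 1 = x + τ * (Complex.I * v) := by simp only [γ, σ1]
  obtain ⟨s, hs, hxs⟩ : ∃ s ∈ Set.Ioo (0 : ℝ) 1, e.1 + s * v = x := by
    rw [openSegment_eq_image] at hx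
    obtain ⟨t, ht, rfl⟩ := hx
    exact ⟨t, ht, by simp only [Complex.real_smul, hv]; push_cast; ring⟩
  have hje : crossParity l (e.1 - γ 1) (e.2 - γ 1) = crossParity l (e.1 - γ 0) (e.2 - γ 0)
      + passages l (fun t => e.1 - γ t) + passages l (fun t => e.2 - γ t) + 1 := by
    refine crossParity_jump (f := fun t => e.1 - γ t) (g := fun t => e.2 - γ t) hl0 hne
      (a := s) (b := 1 - s) hs.1 (by linarith [hs.2]) hσ (by simp [σ]; exact h2')
      (by simp [σ]; linarith) (fun t => ?_) (fun t => ?_)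
    · simp only [γ]; rw [← hxs]; ring
    · simp only [γ]; rw [← hxs]
      push_cast
      have : e.2 = e.1 + v := by rw [hv]; ring
      rw [this]; ring
  have hjo : ∀ e' ∈ E.erase e, crossParity l (e'.1 - γ 1) (e'.2 - γ 1) =
      crossParity l (e'.1 - γ 0) (e'.2 - γ 0)
      + (passages l (fun t => e'.1 - γ t) + passages l (fun t => e'.2 - γ t)) := by
    intro e' he'
    obtain ⟨hne', he'⟩ := Finset.mem_erase.mp he'
    rw [crossParity_motion (d₁ := fun t => e'.1 - γ t) (d₂ := fun t => e'.2 - γ t) hl0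
      (by fun_prop) (by fun_prop)
      (fun t => sub_zero_notMem_segment ((hγO t).2 e' he' hne')), add_assoc]
  -- The passages of the ends of the segments cancel, except at the boundary points of the chain,
  -- which are below `γ`.
  have hsum : ∑ e' ∈ E, (passages l (fun t => e'.1 - γ t) + passages l (fun t => e'.2 - γ t)) =
      0 := by
    rw [hB (fun p => passages l (fun t => p - γ t))]
    refine Finset.sum_eq_zero fun p hp => passages_lower hl (by fun_prop) (fun t h0 => ?_)
      (fun t => ?_)
    · have := (hγO t).1
      rw [← sub_eq_zero.mp h0] at this
      exact absurd (hB0 p hp) (ne_of_gt this)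
    · have : 0 < (γ t).im := (hγO t).1
      simp [hB0 p hp, this.le]
  rw [← γ0, ← γ1]
  unfold crossCount
  rw [← Finset.add_sum_erase _ _ he] at hsum
  rw [← Finset.add_sum_erase _ _ he, ← Finset.add_sum_erase _ _ he, hje,
    Finset.sum_congr rfl hjo, Finset.sum_add_distrib]
  linear_combination hsum

/-! ### The sides of the curve at a vertex -/

/-- The point at distance `ρ` from `v` in the direction of angle `θ`. -/
noncomputable def polarPoint (v : ℂ) (ρ θ : ℝ) : ℂ := v + ρ * Complex.exp (θ * Complex.I)

/-- An open circular sector contained in `Ω` joins the germs at its two sides. -/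
lemma joinedIn_sector {Ω : Set ℂ} {v : ℂ} {r α β : ℝ}
    (hΩ : ∀ ρ θ, 0 < ρ → ρ < r → α < θ → θ < β → polarPoint v ρ θ ∈ Ω) {ρ θ ρ' θ' : ℝ}
    (h0 : 0 < ρ) (h1 : ρ < r) (h2 : α < θ) (h3 : θ < β)
    (h0' : 0 < ρ') (h1' : ρ' < r) (h2' : α < θ') (h3' : θ' < β) :
    JoinedIn Ω (polarPoint v ρ θ) (polarPoint v ρ' θ') := by
  have hconv : Convex ℝ (Set.Ioo (0 : ℝ) r ×ˢ Set.Ioo α β) := (convex_Ioo _ _).prod (convex_Ioo _ _)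
  have hp : JoinedIn (Set.Ioo (0 : ℝ) r ×ˢ Set.Ioo α β) (ρ, θ) (ρ', θ') :=
    JoinedIn.of_segment_subset (hconv.segment_subset ⟨⟨h0, h1⟩, h2, h3⟩ ⟨⟨h0', h1'⟩, h2', h3'⟩)
  have := hp.map (f := fun p : ℝ × ℝ => polarPoint v p.1 p.2) (by unfold polarPoint; fun_prop)
  refine this.mono ?_
  rintro _ ⟨p, hp, rfl⟩
  exact hΩ _ _ hp.1.1 hp.1.2 hp.2.1 hp.2.2

lemma polarPoint_eq (v : ℂ) {ρ₀ θ : ℝ} (τ : ℝ) :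
    polarPoint v ρ₀ θ + τ * (Complex.I * Complex.exp (θ * Complex.I)) =
      polarPoint v ‖(ρ₀ : ℂ) + τ * Complex.I‖ (θ + ((ρ₀ : ℂ) + τ * Complex.I).arg) := by
  unfold polarPoint
  push_cast
  rw [add_mul (θ : ℂ), Complex.exp_add]
  have := Complex.norm_mul_exp_arg_mul_I ((ρ₀ : ℂ) + τ * Complex.I)
  linear_combination -(Complex.exp (θ * Complex.I)) * this

/-- The points near a point of the ray of angle `θ`, on its left (`s > 0`) or right (`s < 0`), have
an angle slightly larger or smaller than `θ`. -/
lemma eventually_polarPoint (v : ℂ) {ρ₀ r θ ε s : ℝ} (h0 : 0 < ρ₀) (h1 : ρ₀ < r) (hε : 0 < ε)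
    (hs : s = 1 ∨ s = -1) :
    ∀ᶠ τ : ℝ in 𝓝[>] 0, ∃ ρ δ : ℝ, 0 < ρ ∧ ρ < r ∧ 0 < δ ∧ δ < ε ∧
      polarPoint v ρ₀ θ + τ * (s * (Complex.I * Complex.exp (θ * Complex.I))) =
        polarPoint v ρ (θ + s * δ) := by
  have c1 : Filter.Tendsto (fun τ : ℝ => ‖(ρ₀ : ℂ) + (s * τ : ℝ) * Complex.I‖) (𝓝 0) (𝓝 ρ₀) := by
    have : Continuous fun τ : ℝ => ‖(ρ₀ : ℂ) + (s * τ : ℝ) * Complex.I‖ := by fun_prop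
    convert this.tendsto 0 using 2
    simp [abs_of_pos h0]
  have c2 : Filter.Tendsto (fun τ : ℝ => ((ρ₀ : ℂ) + (s * τ : ℝ) * Complex.I).arg) (𝓝 0) (𝓝 0) := by
    have : Continuous fun τ : ℝ => ((ρ₀ : ℂ) + (s * τ : ℝ) * Complex.I).arg :=
      (continuous_arg_add_mul_I h0).comp (by fun_prop)
    convert this.tendsto 0 using 2
    simp [Complex.arg_ofReal_of_nonneg h0.le]
  have e1 := (c1.mono_left (nhdsWithin_le_nhds (s := Set.Ioi 0))).eventually (gt_mem_nhds h1)
  have e2 := (c2.mono_left (nhdsWithin_le_nhds (s := Set.Ioi 0))).eventually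
    (Ioo_mem_nhds (neg_lt_zero.mpr hε) hε)
  filter_upwards [e1, e2, self_mem_nhdsWithin] with τ h2 h3 h4
  have h4' : 0 < τ := h4
  have hb := arg_add_mul_I_bounds (a := ρ₀) (σ := s * τ) h0
  have hs2 : s * s = 1 := by rcases hs with rfl | rfl <;> norm_num
  refine ⟨_, s * ((ρ₀ : ℂ) + (s * τ : ℝ) * Complex.I).arg,
    norm_pos_iff.mpr (add_mul_I_ne_zero (σ := s * τ) h0), h2, ?_, ?_, ?_⟩
  · rcases hs with rfl | rfl
    · rw [one_mul]; exact hb.2.1 (by linarith)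
    · have := hb.2.2 (by linarith); linarith
  · rcases hs with rfl | rfl
    · rw [one_mul]; exact h3.2
    · linarith [h3.1]
  · rw [← mul_assoc s, hs2, one_mul, ← polarPoint_eq]
    push_cast; ring

lemma adheres_sector_start_iff {Ω : Set ℂ} {z v : ℂ} {r α β ρ₀ : ℝ} (hαβ : α < β)
    (hΩ : ∀ ρ θ, 0 < ρ → ρ < r → α < θ → θ < β → polarPoint v ρ θ ∈ Ω) (h0 : 0 < ρ₀)
    (h1 : ρ₀ < r) :
    Adheres Ω z (polarPoint v ρ₀ α) ((1 : ℝ) * (Complex.I * Complex.exp (α * Complex.I))) ↔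
      ∀ ρ θ, 0 < ρ → ρ < r → α < θ → θ < β → JoinedIn Ω z (polarPoint v ρ θ) := by
  have hev := eventually_polarPoint v (θ := α) h0 h1 (sub_pos.mpr hαβ) (Or.inl rfl : (1 : ℝ) =
      1 ∨ _)
  constructor
  · intro h ρ θ a1 a2 a3 a4
    obtain ⟨τ, hτ, ρ', δ, b1, b2, b3, b4, e⟩ := (h.and hev).exists
    rw [e] at hτ
    exact hτ.trans (joinedIn_sector hΩ b1 b2 (by linarith) (by linarith) a1 a2 a3 a4)
  · intro h
    filter_upwards [hev] with τ ⟨ρ', δ, b1, b2, b3, b4, e⟩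
    rw [e]
    exact h _ _ b1 b2 (by linarith) (by linarith)

lemma adheres_sector_end_iff {Ω : Set ℂ} {z v : ℂ} {r α β ρ₀ : ℝ} (hαβ : α < β)
    (hΩ : ∀ ρ θ, 0 < ρ → ρ < r → α < θ → θ < β → polarPoint v ρ θ ∈ Ω) (h0 : 0 < ρ₀)
    (h1 : ρ₀ < r) :
    Adheres Ω z (polarPoint v ρ₀ β) ((-1 : ℝ) * (Complex.I * Complex.exp (β * Complex.I))) ↔
      ∀ ρ θ, 0 < ρ → ρ < r → α < θ → θ < β → JoinedIn Ω z (polarPoint v ρ θ) := by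
  have hev := eventually_polarPoint v (θ := β) h0 h1 (sub_pos.mpr hαβ)
    (Or.inr rfl : (-1 : ℝ) = 1 ∨ _)
  constructor
  · intro h ρ θ a1 a2 a3 a4
    obtain ⟨τ, hτ, ρ', δ, b1, b2, b3, b4, e⟩ := (h.and hev).exists
    rw [e] at hτ
    exact hτ.trans (joinedIn_sector hΩ b1 b2 (by linarith) (by linarith) a1 a2 a3 a4)
  · intro h
    filter_upwards [hev] with τ ⟨ρ', δ, b1, b2, b3, b4, e⟩
    rw [e]
    exact h _ _ b1 b2 (by linarith) (by linarith)

lemma polarPoint_mem_segment {v c : ℂ} {ρ θ α : ℝ} (hc : HasAngle 1 (c - v) α) (hρ : 0 < ρ)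
    (h : polarPoint v ρ θ ∈ segment ℝ v c) : ∃ k : ℤ, θ = α + 2 * Real.pi * k := by
  rw [segment_eq_image] at h
  obtain ⟨t, ht, e⟩ := h
  simp only [Complex.real_smul, polarPoint] at e
  have e' : (t : ℂ) * (c - v) = ρ * Complex.exp (θ * Complex.I) := by
    push_cast at e; linear_combination e
  have ht0 : 0 < t := by
    refine lt_of_le_of_ne ht.1 fun h0 => ?_
    rw [← h0, Complex.ofReal_zero, zero_mul] at e'
    have : (ρ : ℂ) ≠ 0 := by exact_mod_cast hρ.ne'
    exact mul_ne_zero this (Complex.exp_ne_zero _) e'.symm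
  have h1 := hc.smul ht0
  rw [e'] at h1
  exact h1.exists_eq_add one_ne_zero ⟨ρ, hρ, by ring⟩

lemma HasAngle.eq_norm {f : ℂ} {θ : ℝ} (h : HasAngle 1 f θ) :
    f = ‖f‖ * Complex.exp (θ * Complex.I) := by
  obtain ⟨r, hr, rfl⟩ := h
  simp [Complex.norm_exp_ofReal_mul_I, abs_of_pos hr]

lemma polarPoint_mem_openSegment {v c : ℂ} {ρ α : ℝ} (hc : HasAngle 1 (c - v) α) (hρ : 0 < ρ)
    (h : ρ < ‖c - v‖) : polarPoint v ρ α ∈ openSegment ℝ v c := by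
  have hn : 0 < ‖c - v‖ := hρ.trans h
  rw [openSegment_eq_image]
  refine ⟨ρ / ‖c - v‖, ⟨div_pos hρ hn, (div_lt_one hn).mpr h⟩, ?_⟩
  simp only [Complex.real_smul, polarPoint]
  have e := hc.eq_norm
  have hn' : ((‖c - v‖ : ℝ) : ℂ) ≠ 0 := by exact_mod_cast hn.ne'
  have : ((ρ / ‖c - v‖ : ℝ) : ℂ) * (c - v) = ρ * Complex.exp (α * Complex.I) := by
    conv_lhs => rw [e]
    rw [norm_mul, Complex.norm_exp_ofReal_mul_I, Complex.norm_real, norm_norm]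
    push_cast
    field_simp
  push_cast at this ⊢
  linear_combination this

lemma dist_polarPoint (v : ℂ) {ρ θ : ℝ} (hρ : 0 < ρ) : dist (polarPoint v ρ θ) v = ρ := by
  simp [polarPoint, dist_eq_norm, Complex.norm_exp_ofReal_mul_I, abs_of_pos hρ]

lemma exists_polarPoint (v y : ℂ) (hy : y ≠ v) (α : ℝ) :
    ∃ θ, α ≤ θ ∧ θ < α + 2 * Real.pi ∧ y = polarPoint v (dist y v) θ := by
  have h := HasAngle.arg_div one_ne_zero (sub_ne_zero.mpr hy)
  obtain ⟨k, hk, -⟩ := existsUnique_add_zsmul_mem_Ico (a := 2 * Real.pi) Real.two_pi_pos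
    ((y - v) / 1).arg α
  refine ⟨_, hk.1, hk.2, ?_⟩
  have h2 := (h.add_int k).eq_norm
  unfold polarPoint
  rw [dist_eq_norm, show k • (2 * Real.pi) = 2 * Real.pi * (k : ℝ) by simp [mul_comm], ← h2]
  ring

/-- Around a vertex of the curve, the curve consists of two rays. -/
lemma IsSimpleCurve.exists_sector_radius (hE : IsSimpleCurve E) (hU : IsOpen U) {e₁ e₂ : ℂ × ℂ}
    (h₁ : e₁ ∈ E) (h₂ : e₂ ∈ E) {v : ℂ} (hv₁ : e₁.2 = v) (hv₂ : e₂.1 = v) (hvU : v ∈ U) :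
    ∃ r > 0, r ≤ ‖e₁.1 - v‖ ∧ r ≤ ‖e₂.2 - v‖ ∧ Metric.ball v r ⊆ U ∧
      ∀ α β, HasAngle 1 (e₂.2 - v) α → HasAngle 1 (e₁.1 - v) β → ∀ ρ θ, 0 < ρ → ρ < r →
        (∀ k : ℤ, θ ≠ α + 2 * Real.pi * k) → (∀ k : ℤ, θ ≠ β + 2 * Real.pi * k) →
        polarPoint v ρ θ ∈ U \ edgeTrace E := by
  set O : Set ℂ := U ∩ {z | ∀ e' ∈ E, (e' ≠ e₁ ∧ e' ≠ e₂) → z ∉ segment ℝ e'.1 e'.2} with hO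
  have hOo : IsOpen O := hU.inter (isOpen_compl_edgeTrace_diff _)
  have hvO : v ∈ O := by
    refine ⟨hvU, fun e' he' hne hm => ?_⟩
    rw [← insert_endpoints_openSegment] at hm
    rcases hm with h | h | h
    · exact hne.2 (hE.fst_inj _ he' _ h₂ (h.symm.trans hv₂.symm))
    · exact hne.1 (hE.snd_inj _ he' _ h₁ (h.symm.trans hv₁.symm))
    · exact hE.fst_notMem e' he' e₂ h₂ (hv₂ ▸ h)
  obtain ⟨r, hr, hb⟩ := Metric.isOpen_iff.mp hOo v hvO
  have n1 : 0 < ‖e₁.1 - v‖ := norm_pos_iff.mpr (sub_ne_zero.mpr (hv₁ ▸ hE.ne e₁ h₁))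
  have n2 : 0 < ‖e₂.2 - v‖ := norm_pos_iff.mpr (sub_ne_zero.mpr (hv₂ ▸ (hE.ne e₂ h₂).symm))
  refine ⟨min r (min ‖e₁.1 - v‖ ‖e₂.2 - v‖), lt_min hr (lt_min n1 n2),
    (min_le_right _ _).trans (min_le_left _ _), (min_le_right _ _).trans (min_le_right _ _),
    (Metric.ball_subset_ball (min_le_left _ _)).trans (hb.trans Set.inter_subset_left), ?_⟩
  intro α β hα hβ ρ θ h0 h1 hθα hθβ
  have hball : polarPoint v ρ θ ∈ O := hb (by
    rw [Metric.mem_ball, dist_polarPoint v h0]; exact h1.trans_le (min_le_left _ _))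
  refine ⟨hball.1, ?_⟩
  rintro ⟨e', he', hm⟩
  by_cases c1 : e' = e₁
  · subst c1
    rw [hv₁, segment_symm] at hm
    obtain ⟨k, hk⟩ := polarPoint_mem_segment hβ h0 hm
    exact hθβ k hk
  by_cases c2 : e' = e₂
  · subst c2
    rw [hv₂] at hm
    obtain ⟨k, hk⟩ := polarPoint_mem_segment hα h0 hm
    exact hθα k hk
  exact hball.2 e' he' ⟨c1, c2⟩ hm

lemma ne_add_of_mem_Ioo {θ α β : ℝ} (h1 : α < θ) (h2 : θ < β) (h3 : β ≤ α + 2 * Real.pi) (k : ℤ) :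
    θ ≠ α + 2 * Real.pi * k ∧ θ ≠ β + 2 * Real.pi * k := by
  have hpi := Real.pi_pos
  constructor
  · intro h
    have a1 : (0 : ℝ) < k := by by_contra! hc; nlinarith
    have a2 : (k : ℝ) < 1 := by by_contra! hc; nlinarith
    have a1' : 0 < k := by exact_mod_cast a1
    have a2' : k < 1 := by exact_mod_cast a2
    omega
  · intro h
    have a1 : (-1 : ℝ) < k := by by_contra! hc; nlinarith
    have a2 : (k : ℝ) < 0 := by by_contra! hc; nlinarith
    have a1' : -1 < k := by exact_mod_cast a1
    have a2' : k < 0 := by exact_mod_cast a2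
    omega

lemma sector_left {α β θ : ℝ} (h1 : α < θ) (h2 : θ < β) (h3 : β < α + 2 * Real.pi) :
    (∀ k : ℤ, θ ≠ α + 2 * Real.pi * k) ∧ (∀ k : ℤ, θ ≠ β + 2 * Real.pi * k) :=
  ⟨fun k => (ne_add_of_mem_Ioo h1 h2 h3.le k).1, fun k => (ne_add_of_mem_Ioo h1 h2 h3.le k).2⟩

lemma sector_right {α β θ : ℝ} (h0 : α < β) (h1 : β < θ) (h2 : θ < α + 2 * Real.pi) :
    (∀ k : ℤ, θ ≠ α + 2 * Real.pi * k) ∧ (∀ k : ℤ, θ ≠ β + 2 * Real.pi * k) := by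
  refine ⟨fun k h => ?_, fun k => (ne_add_of_mem_Ioo h1 h2 (by linarith) k).1⟩
  refine (ne_add_of_mem_Ioo h1 h2 (by linarith) (k - 1)).2 ?_
  rw [h]; push_cast; ring

/-- The direction of an incoming segment, as a germ at its end. -/
lemma adheres_incoming_iff {Ω : Set ℂ} {z x v : ℂ} {e : ℂ × ℂ} (hv : e.2 = v) (hne : e.1 ≠ e.2)
    {β s : ℝ} (hβ : HasAngle 1 (e.1 - v) β) :
    Adheres Ω z x (s * (Complex.I * (e.2 - e.1))) ↔
      Adheres Ω z x ((-s : ℝ) * (Complex.I * Complex.exp (β * Complex.I))) := by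
  have n1 : 0 < ‖e.1 - v‖ := norm_pos_iff.mpr (sub_ne_zero.mpr (hv ▸ hne))
  have : (s : ℂ) * (Complex.I * (e.2 - e.1)) =
      ‖e.1 - v‖ * (((-s : ℝ) : ℂ) * (Complex.I * Complex.exp (β * Complex.I))) := by
    have := hβ.eq_norm
    rw [hv]
    push_cast
    linear_combination (-s * Complex.I : ℂ) * this
  rw [this]
  exact ⟨fun h => h.of_smul n1, fun h => h.smul n1⟩

lemma adheres_outgoing_iff {Ω : Set ℂ} {z x v : ℂ} {e : ℂ × ℂ} (hv : e.1 = v) (hne : e.1 ≠ e.2)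
    {α s : ℝ} (hα : HasAngle 1 (e.2 - v) α) :
    Adheres Ω z x (s * (Complex.I * (e.2 - e.1))) ↔
      Adheres Ω z x (s * (Complex.I * Complex.exp (α * Complex.I))) := by
  have n1 : 0 < ‖e.2 - v‖ := norm_pos_iff.mpr (sub_ne_zero.mpr (hv ▸ hne.symm))
  have : (s : ℂ) * (Complex.I * (e.2 - e.1)) =
      ‖e.2 - v‖ * ((s : ℂ) * (Complex.I * Complex.exp (α * Complex.I))) := by
    have := hα.eq_norm
    rw [hv]
    linear_combination (s * Complex.I : ℂ) * this
  rw [this]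
  exact ⟨fun h => h.of_smul n1, fun h => h.smul n1⟩

/-- The angles of the two segments at a vertex can be arranged in cyclic order. -/
lemma IsSimpleCurve.exists_angles (hE : IsSimpleCurve E) {e₁ e₂ : ℂ × ℂ} (h₁ : e₁ ∈ E)
    (h₂ : e₂ ∈ E) {v : ℂ} (hv₁ : e₁.2 = v) (hv₂ : e₂.1 = v) :
    ∃ α β, HasAngle 1 (e₂.2 - v) α ∧ HasAngle 1 (e₁.1 - v) β ∧ α < β ∧ β < α + 2 * Real.pi := by
  have n1 : e₁.1 ≠ v := hv₁ ▸ hE.ne e₁ h₁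
  have n2 : e₂.2 ≠ v := hv₂ ▸ (hE.ne e₂ h₂).symm
  have hα := HasAngle.arg_div one_ne_zero (sub_ne_zero.mpr n2)
  have hβ := HasAngle.arg_div one_ne_zero (sub_ne_zero.mpr n1)
  set α := ((e₂.2 - v) / 1).arg
  obtain ⟨k, hk, -⟩ := existsUnique_add_zsmul_mem_Ico (a := 2 * Real.pi) Real.two_pi_pos
    ((e₁.1 - v) / 1).arg α
  have hβ' := hβ.add_int k
  rw [show 2 * Real.pi * (k : ℝ) = k • (2 * Real.pi) by simp [mul_comm]] at hβ'
  refine ⟨α, _, hα, hβ', lt_of_le_of_ne hk.1 fun h => ?_, hk.2⟩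
  -- two segments leaving `v` in the same direction would overlap
  rw [← h] at hβ'
  have m1 : 0 < ‖e₁.1 - v‖ := norm_pos_iff.mpr (sub_ne_zero.mpr n1)
  have m2 : 0 < ‖e₂.2 - v‖ := norm_pos_iff.mpr (sub_ne_zero.mpr n2)
  have hmin : 0 < min ‖e₁.1 - v‖ ‖e₂.2 - v‖ := lt_min m1 m2
  have p1 := polarPoint_mem_openSegment hβ' (half_pos hmin)
    ((half_lt_self hmin).trans_le (min_le_left _ _))
  have p2 := polarPoint_mem_openSegment hα (half_pos hmin)
    ((half_lt_self hmin).trans_le (min_le_right _ _))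
  rw [openSegment_symm, ← hv₁] at p1
  rw [← hv₂] at p2
  have hne : e₁ ≠ e₂ := by
    rintro rfl
    exact hE.ne e₁ h₁ (hv₂.trans hv₁.symm)
  rw [hv₁.trans hv₂.symm] at p1
  exact Set.disjoint_left.mp (hE.disjoint e₁ h₁ e₂ h₂ hne) (by rw [hv₁.trans hv₂.symm]; exact p1) p2

/-- At a vertex, with the outgoing segment at the angle `α` and the incoming one at the angle `β`,
the sector from `α` to `β` is on the left of the curve. -/
lemma IsSimpleCurve.adheres_left_iff_sector (hE : IsSimpleCurve E) {e₁ e₂ : ℂ × ℂ}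
    (h₁ : e₁ ∈ E) (h₂ : e₂ ∈ E) {v z : ℂ} (hv₁ : e₁.2 = v) (hv₂ : e₂.1 = v) {α β r ρ₀ : ℝ}
    (hα : HasAngle 1 (e₂.2 - v) α) (hβ : HasAngle 1 (e₁.1 - v) β) (hαβ : α < β) {Ω : Set ℂ}
    (hΩ : ∀ ρ θ, 0 < ρ → ρ < r → α < θ → θ < β → polarPoint v ρ θ ∈ Ω)
    (h0 : 0 < ρ₀) (h1 : ρ₀ < r) :
    (Adheres Ω z (polarPoint v ρ₀ β) ((1 : ℝ) * (Complex.I * (e₁.2 - e₁.1))) ↔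
      ∀ ρ θ, 0 < ρ → ρ < r → α < θ → θ < β → JoinedIn Ω z (polarPoint v ρ θ)) ∧
    (Adheres Ω z (polarPoint v ρ₀ α) ((1 : ℝ) * (Complex.I * (e₂.2 - e₂.1))) ↔
      ∀ ρ θ, 0 < ρ → ρ < r → α < θ → θ < β → JoinedIn Ω z (polarPoint v ρ θ)) := by
  constructor
  · rw [adheres_incoming_iff hv₁ (hE.ne _ h₁) hβ]
    exact adheres_sector_end_iff hαβ hΩ h0 h1
  · rw [adheres_outgoing_iff hv₂ (hE.ne _ h₂) hα]
    exact adheres_sector_start_iff hαβ hΩ h0 h1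

/-- The remaining sector, from `β` to `α + 2π`, is on the right of the curve. -/
lemma IsSimpleCurve.adheres_right_iff_sector (hE : IsSimpleCurve E) {e₁ e₂ : ℂ × ℂ}
    (h₁ : e₁ ∈ E) (h₂ : e₂ ∈ E) {v z : ℂ} (hv₁ : e₁.2 = v) (hv₂ : e₂.1 = v) {α β r ρ₀ : ℝ}
    (hα : HasAngle 1 (e₂.2 - v) α) (hβ : HasAngle 1 (e₁.1 - v) β) (hβα : β < α + 2 * Real.pi)
    {Ω : Set ℂ}
    (hΩ : ∀ ρ θ, 0 < ρ → ρ < r → β < θ → θ < α + 2 * Real.pi → polarPoint v ρ θ ∈ Ω)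
    (h0 : 0 < ρ₀) (h1 : ρ₀ < r) :
    (Adheres Ω z (polarPoint v ρ₀ β) ((-1 : ℝ) * (Complex.I * (e₁.2 - e₁.1))) ↔
      ∀ ρ θ, 0 < ρ → ρ < r → β < θ → θ < α + 2 * Real.pi → JoinedIn Ω z (polarPoint v ρ θ)) ∧
    (Adheres Ω z (polarPoint v ρ₀ α) ((-1 : ℝ) * (Complex.I * (e₂.2 - e₂.1))) ↔
      ∀ ρ θ, 0 < ρ → ρ < r → β < θ → θ < α + 2 * Real.pi → JoinedIn Ω z (polarPoint v ρ θ)) := by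
  constructor
  · rw [adheres_incoming_iff hv₁ (hE.ne _ h₁) hβ, neg_neg]
    exact adheres_sector_start_iff hβα hΩ h0 h1
  · rw [adheres_outgoing_iff hv₂ (hE.ne _ h₂) hα.add_two_pi]
    have : polarPoint v ρ₀ α = polarPoint v ρ₀ (α + 2 * Real.pi) := by
      unfold polarPoint
      push_cast
      rw [add_mul, Complex.exp_add, Complex.exp_two_pi_mul_I, mul_one]
    rw [this]
    exact adheres_sector_end_iff hβα hΩ h0 h1

/-- A curve-free region next to the curve can be followed across a vertex. -/
lemma IsSimpleCurve.adheres_turn (hE : IsSimpleCurve E) (hU : IsOpen U) {e₁ e₂ : ℂ × ℂ}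
    (h₁ : e₁ ∈ E) (h₂ : e₂ ∈ E) (hv : e₁.2 = e₂.1) (hvU : e₂.1 ∈ U) {s : ℝ} (hs : s = 1 ∨ s = -1) :
    ∃ x₁ ∈ openSegment ℝ e₁.1 e₁.2, ∃ x₂ ∈ openSegment ℝ e₂.1 e₂.2, ∀ z,
      Adheres (U \ edgeTrace E) z x₁ (s * (Complex.I * (e₁.2 - e₁.1))) ↔
      Adheres (U \ edgeTrace E) z x₂ (s * (Complex.I * (e₂.2 - e₂.1))) := by
  obtain ⟨α, β, hα, hβ, hαβ, hβα⟩ := hE.exists_angles h₁ h₂ hv rfl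
  obtain ⟨r, hr, hr1, hr2, -, hΩ⟩ := hE.exists_sector_radius hU h₁ h₂ hv rfl hvU
  have hΩ' := hΩ α β hα hβ
  have p1 := polarPoint_mem_openSegment hβ (half_pos hr) ((half_lt_self hr).trans_le hr1)
  have p2 := polarPoint_mem_openSegment hα (half_pos hr) ((half_lt_self hr).trans_le hr2)
  refine ⟨polarPoint e₂.1 (r / 2) β, by rw [openSegment_symm, hv]; exact p1,
    polarPoint e₂.1 (r / 2) α, p2, fun z => ?_⟩
  rcases hs with rfl | rfl
  · have := hE.adheres_left_iff_sector (z := z) h₁ h₂ hv rfl hα hβ hαβ (Ω := U \ edgeTrace E)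
      (r := r) (fun ρ θ a1 a2 a3 a4 => hΩ' ρ θ a1 a2 (sector_left a3 a4 hβα).1
        (sector_left a3 a4 hβα).2) (half_pos hr) (half_lt_self hr)
    exact this.1.trans this.2.symm
  · have := hE.adheres_right_iff_sector (z := z) h₁ h₂ hv rfl hα hβ hβα (Ω := U \ edgeTrace E)
      (r := r) (fun ρ θ a1 a2 a3 a4 => hΩ' ρ θ a1 a2 (sector_right hαβ a3 a4).1
        (sector_right hαβ a3 a4).2) (half_pos hr) (half_lt_self hr)
    exact this.1.trans this.2.symm

/-- The points near a vertex of the curve lie on one of its sides. -/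
lemma IsSimpleCurve.eventually_side_vertex (hE : IsSimpleCurve E) (hU : IsOpen U) {e₁ e₂ : ℂ × ℂ}
    (h₁ : e₁ ∈ E) (h₂ : e₂ ∈ E) (hv : e₁.2 = e₂.1) (hvU : e₂.1 ∈ U) :
    ∀ᶠ y in 𝓝 e₂.1, y ∉ edgeTrace E → ∃ s : ℝ, (s = 1 ∨ s = -1) ∧
      ∃ x ∈ openSegment ℝ e₁.1 e₁.2,
        Adheres (U \ edgeTrace E) y x (s * (Complex.I * (e₁.2 - e₁.1))) := by
  obtain ⟨α, β, hα, hβ, hαβ, hβα⟩ := hE.exists_angles h₁ h₂ hv rfl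
  obtain ⟨r, hr, hr1, hr2, -, hΩ⟩ := hE.exists_sector_radius hU h₁ h₂ hv rfl hvU
  have hΩ' := hΩ α β hα hβ
  have p1 := polarPoint_mem_openSegment hβ (half_pos hr) ((half_lt_self hr).trans_le hr1)
  rw [openSegment_symm, ← hv, hv] at p1
  filter_upwards [Metric.ball_mem_nhds e₂.1 hr] with y hy hyE
  have hne : y ≠ e₂.1 := fun h => hyE ⟨e₂, h₂, h ▸ left_mem_segment ℝ _ _⟩
  obtain ⟨θ, hθ1, hθ2, hyθ⟩ := exists_polarPoint e₂.1 y hne α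
  have hd : 0 < dist y e₂.1 := dist_pos.mpr hne
  have hdr : dist y e₂.1 < r := hy
  have hθα : α ≠ θ := by
    rintro rfl
    refine hyE ⟨e₂, h₂, ?_⟩
    rw [hyθ]
    exact mem_segment_of_mem_openSegment (polarPoint_mem_openSegment hα hd (hdr.trans_le hr2))
  have hθβ : θ ≠ β := by
    rintro rfl
    refine hyE ⟨e₁, h₁, ?_⟩
    rw [hyθ, hv, segment_symm]
    exact mem_segment_of_mem_openSegment (polarPoint_mem_openSegment hβ hd (hdr.trans_le hr1))
  have hα' := lt_of_le_of_ne hθ1 hθα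
  rcases lt_or_gt_of_ne hθβ with hlt | hgt
  · have hΩL : ∀ ρ θ, 0 < ρ → ρ < r → α < θ → θ < β → polarPoint e₂.1 ρ θ ∈ U \ edgeTrace E :=
      fun ρ θ a1 a2 a3 a4 => hΩ' ρ θ a1 a2 (sector_left a3 a4 hβα).1 (sector_left a3 a4 hβα).2
    refine ⟨1, Or.inl rfl, polarPoint e₂.1 (r / 2) β, by rw [hv]; exact p1, ?_⟩
    rw [(hE.adheres_left_iff_sector h₁ h₂ hv rfl hα hβ hαβ hΩL (half_pos hr) (half_lt_self hr)).1,
      hyθ]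
    exact fun ρ θ' a1 a2 a3 a4 => joinedIn_sector hΩL hd hdr hα' hlt a1 a2 a3 a4
  · have hΩR : ∀ ρ θ, 0 < ρ → ρ < r → β < θ → θ < α + 2 * Real.pi →
        polarPoint e₂.1 ρ θ ∈ U \ edgeTrace E :=
      fun ρ θ a1 a2 a3 a4 => hΩ' ρ θ a1 a2 (sector_right hαβ a3 a4).1 (sector_right hαβ a3 a4).2
    refine ⟨-1, Or.inr rfl, polarPoint e₂.1 (r / 2) β, by rw [hv]; exact p1, ?_⟩
    rw [(hE.adheres_right_iff_sector h₁ h₂ hv rfl hα hβ hβα hΩR (half_pos hr) (half_lt_self hr)).1,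
      hyθ]
    exact fun ρ θ' a1 a2 a3 a4 => joinedIn_sector hΩR hd hdr hgt hθ2 a1 a2 a3 a4

/-! ### Simple curves in the upper half-plane -/

/-- The open upper half-plane. -/
def upperPlane : Set ℂ := {z | 0 < z.im}

lemma isOpen_upperPlane : IsOpen upperPlane := isOpen_lt continuous_const Complex.continuous_im

lemma convex_upperPlane : Convex ℝ upperPlane := convex_halfSpace_im_gt 0

/-- A simple polygonal curve in the upper half-plane, possibly with ends on the real line. -/
structure IsSimpleCurveInUpper (E : Finset (ℂ × ℂ)) : Prop extends IsSimpleCurve E where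
  upper : ∀ e ∈ E, openSegment ℝ e.1 e.2 ⊆ upperPlane
  not_real : ∀ e ∈ E, ∀ e' ∈ E, e.2 = e'.1 → e'.1.im ≠ 0
  fst_im : ∀ e ∈ E, 0 ≤ e.1.im
  snd_im : ∀ e ∈ E, 0 ≤ e.2.im
  exists_prev : ∀ e ∈ E, 0 < e.1.im → ∃ e' ∈ E, e'.2 = e.1
  exists_next : ∀ e ∈ E, 0 < e.2.im → ∃ e' ∈ E, e'.1 = e.2

/-- The component of `z` in the complement of the curve lies along the curve, on the left (`s = 1`)
or on the right (`s = -1`). -/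
def OnSide (E : Finset (ℂ × ℂ)) (s : ℝ) (z : ℂ) : Prop :=
  ∀ e ∈ E, ∀ x ∈ openSegment ℝ e.1 e.2,
    Adheres (upperPlane \ edgeTrace E) z x (s * (Complex.I * (e.2 - e.1)))

/-- A path from outside a closed set into it has a first point in the set. -/
lemma exists_first_hit {F K : Set ℂ} {z w : ℂ} (h : JoinedIn F z w) (hK : IsClosed K) (hz : z ∉ K)
    (hw : w ∈ K) : ∃ x ∈ K ∩ F, ∀ p : ℂ → Prop, (∀ᶠ y in 𝓝 x, p y) →
      ∃ y, p y ∧ JoinedIn (F \ K) z y := by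
  obtain ⟨γ, hγ⟩ := h
  have hc : IsCompact (γ ⁻¹' K) := (hK.preimage γ.continuous).isCompact
  obtain ⟨t, ht, hmin⟩ := hc.exists_isLeast ⟨1, by simpa using hw⟩
  have h0 : (0 : unitInterval) < t := by
    rcases (unitInterval.nonneg' (t := t)).eq_or_lt with h | h
    · rw [← h] at ht; simp at ht; exact absurd ht hz
    · exact h
  refine ⟨γ t, ⟨ht, hγ t⟩, fun p hp => ?_⟩
  have h1 : ∀ᶠ s in 𝓝[<] t, p (γ s) :=
    (γ.continuous.continuousAt.eventually hp).filter_mono nhdsWithin_le_nhds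
  have : (𝓝[<] t).NeBot := nhdsLT_neBot_of_exists_lt ⟨0, h0⟩
  obtain ⟨s, hs, hst⟩ := (h1.and self_mem_nhdsWithin).exists
  refine ⟨γ s, hs, ?_⟩
  have hpc : JoinedIn (Set.Icc (0 : ℝ) s) 0 s := JoinedIn.of_segment_subset
    ((convex_Icc _ _).segment_subset (Set.left_mem_Icc.mpr s.2.1) (Set.right_mem_Icc.mpr s.2.1))
  have := hpc.map γ.continuous_extend
  rw [γ.extend_zero, γ.extend_apply s.2] at this
  refine this.mono ?_
  rintro _ ⟨u, hu, rfl⟩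
  have hu' : u ∈ Set.Icc (0 : ℝ) 1 := ⟨hu.1, hu.2.trans s.2.2⟩
  rw [γ.extend_apply hu']
  exact ⟨hγ _, fun hm => not_le.mpr (lt_of_le_of_lt (show (⟨u, hu'⟩ : unitInterval) ≤ s from hu.2)
    hst) (hmin hm)⟩

namespace IsSimpleCurveInUpper

variable (hE : IsSimpleCurveInUpper E)
include hE

/-- Points near a point of the curve lie on one of its sides. -/
lemma eventually_near (hU : IsOpen U) (hUH : U ⊆ upperPlane) {x : ℂ}
    (hx : x ∈ edgeTrace E) (hxU : x ∈ U) :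
    ∀ᶠ y in 𝓝 x, y ∉ edgeTrace E → ∃ s : ℝ, (s = 1 ∨ s = -1) ∧ ∃ e ∈ E,
      ∃ x' ∈ openSegment ℝ e.1 e.2,
        Adheres (U \ edgeTrace E) y x' (s * (Complex.I * (e.2 - e.1))) := by
  obtain ⟨e, he, hm⟩ := hx
  rw [← insert_endpoints_openSegment] at hm
  rcases hm with rfl | rfl | hm
  · obtain ⟨e', he', hv⟩ := hE.exists_prev e he (hUH hxU)
    filter_upwards [hE.eventually_side_vertex hU he' he hv hxU] with y hy hyE
    obtain ⟨s, hs, x, hx, h⟩ := hy hyE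
    exact ⟨s, hs, e', he', x, hx, h⟩
  · obtain ⟨e', he', hv⟩ := hE.exists_next e he (hUH hxU)
    rw [← hv] at hxU ⊢
    filter_upwards [hE.eventually_side_vertex hU he he' hv.symm hxU] with y hy hyE
    obtain ⟨s, hs, x, hx, h⟩ := hy hyE
    exact ⟨s, hs, e, he, x, hx, h⟩
  · filter_upwards [hE.eventually_side hU he hm hxU] with y hy hyE
    obtain ⟨s, hs, -, h⟩ := hy hyE
    exact ⟨s, hs, e, he, x, hm, h⟩

/-- A path to the curve adheres to one of its sides. -/
lemma exists_adheres_of_joinedIn (hU : IsOpen U) (hUH : U ⊆ upperPlane) {z w : ℂ}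
    (h : JoinedIn U z w) (hz : z ∉ edgeTrace E) (hw : w ∈ edgeTrace E) :
    ∃ s : ℝ, (s = 1 ∨ s = -1) ∧ ∃ e ∈ E, ∃ x ∈ openSegment ℝ e.1 e.2,
      Adheres (U \ edgeTrace E) z x (s * (Complex.I * (e.2 - e.1))) := by
  obtain ⟨x, ⟨hx, hxU⟩, hp⟩ := exists_first_hit h (isCompact_edgeTrace E).isClosed hz hw
  obtain ⟨y, hy, hzy⟩ := hp _ (hE.eventually_near hU hUH hx hxU)
  obtain ⟨s, hs, e, he, x', hx', ha⟩ := hy hzy.target_mem.2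
  exact ⟨s, hs, e, he, x', hx', ha.trans hzy⟩

/-- A side of the curve can be followed along the whole curve. -/
lemma onSide_of_adheres {s : ℝ} (hs : s = 1 ∨ s = -1) {z : ℂ} {e : ℂ × ℂ} (he : e ∈ E) {x : ℂ}
    (hx : x ∈ openSegment ℝ e.1 e.2)
    (h : Adheres (upperPlane \ edgeTrace E) z x (s * (Complex.I * (e.2 - e.1)))) :
    OnSide E s z := by
  have hs0 : s ≠ 0 := by rcases hs with rfl | rfl <;> norm_num
  have slide : ∀ e ∈ E, ∀ x ∈ openSegment ℝ e.1 e.2, ∀ y ∈ openSegment ℝ e.1 e.2,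
      Adheres (upperPlane \ edgeTrace E) z x (s * (Complex.I * (e.2 - e.1))) →
      Adheres (upperPlane \ edgeTrace E) z y (s * (Complex.I * (e.2 - e.1))) :=
    fun e he x hx y hy => hE.adheres_slide isOpen_upperPlane he hx hy
      (((convex_openSegment _ _).segment_subset hx hy).trans (hE.upper e he)) hs0
  intro e' he'
  refine hE.connected (fun e => ∀ x ∈ openSegment ℝ e.1 e.2,
    Adheres (upperPlane \ edgeTrace E) z x (s * (Complex.I * (e.2 - e.1)))) ?_ e he e' he'
    (fun y hy => slide e he x hx y hy h)
  intro e₁ h₁ e₂ h₂ hv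
  have hvU : e₂.1 ∈ upperPlane := by
    -- a vertex between two segments of the curve is not on the real line
    by_contra hc
    have h0 : e₂.1.im = 0 := le_antisymm (not_lt.mp hc) (hE.fst_im e₂ h₂)
    exact hE.not_real e₁ h₁ e₂ h₂ hv h0
  obtain ⟨x₁, hx₁, x₂, hx₂, hiff⟩ := hE.adheres_turn isOpen_upperPlane h₁ h₂ hv hvU hs
  exact ⟨fun h y hy => slide e₂ h₂ x₂ hx₂ y hy ((hiff z).mp (h x₁ hx₁)),
    fun h y hy => slide e₁ h₁ x₁ hx₁ y hy ((hiff z).mpr (h x₂ hx₂))⟩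

/-- The complement of the curve has at most two components, its two sides. -/
lemma exists_onSide (hne : E.Nonempty) {z : ℂ} (hz : z ∈ upperPlane \ edgeTrace E) :
    ∃ s : ℝ, (s = 1 ∨ s = -1) ∧ OnSide E s z := by
  obtain ⟨e, he⟩ := hne
  obtain ⟨x, hx⟩ : (openSegment ℝ e.1 e.2).Nonempty := by
    rw [openSegment_eq_image]
    exact ⟨_, ⟨1 / 2, by norm_num, rfl⟩⟩
  obtain ⟨s, hs, e', he', x', hx', ha⟩ := hE.exists_adheres_of_joinedIn isOpen_upperPlane
    subset_rfl (JoinedIn.of_segment_subset (convex_upperPlane.segment_subset hz.1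
      (hE.upper e he hx))) hz.2 ⟨e, he, mem_segment_of_mem_openSegment hx⟩
  exact ⟨s, hs, hE.onSide_of_adheres hs he' hx' ha⟩

/-- Both sides of the curve are inhabited, close to each of its points. -/
lemma eventually_onSide {s : ℝ} (hs : s = 1 ∨ s = -1) {e : ℂ × ℂ} (he : e ∈ E) {x : ℂ}
    (hx : x ∈ openSegment ℝ e.1 e.2) :
    ∀ᶠ τ : ℝ in 𝓝[>] 0, x + τ * (s * (Complex.I * (e.2 - e.1))) ∈ upperPlane \ edgeTrace E ∧
      OnSide E s (x + τ * (s * (Complex.I * (e.2 - e.1)))) := by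
  have hs2 : s * s = 1 := by rcases hs with rfl | rfl <;> norm_num
  have hs0 : s ≠ 0 := by rcases hs with rfl | rfl <;> norm_num
  have hne := sub_ne_zero.mpr (hE.ne e he).symm
  have ht : Filter.Tendsto (fun τ : ℝ => x + (τ : ℂ) * (s * (Complex.I * (e.2 - e.1)))) (𝓝[>] 0)
      (𝓝 x) := by
    have : Continuous fun τ : ℝ => x + (τ : ℂ) * (s * (Complex.I * (e.2 - e.1))) := by fun_prop
    convert (this.tendsto 0).mono_left nhdsWithin_le_nhds using 2
    simp
  have hn : ∀ᶠ y in 𝓝 x, ∀ e' ∈ E, e' ≠ e → y ∉ segment ℝ e'.1 e'.2 :=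
    (isOpen_compl_edgeTrace_diff _).mem_nhds fun e' he' hne => hE.notMem_segment he he' hne hx
  filter_upwards [ht.eventually (hE.eventually_side isOpen_upperPlane he hx (hE.upper e he hx)),
    ht.eventually hn, ht.eventually (isOpen_upperPlane.mem_nhds (hE.upper e he hx)),
    self_mem_nhdsWithin] with τ h1 h2 h3 h4
  have h4' : 0 < τ := h4
  have hyE : x + (τ : ℂ) * (s * (Complex.I * (e.2 - e.1))) ∉ edgeTrace E := by
    rintro ⟨e', he', hm⟩
    by_cases hee : e' = e
    · subst hee
      refine notMem_segment_of_side (hE.ne e' he') (mem_segment_of_mem_openSegment hx)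
        (τ := τ * s) (mul_ne_zero h4'.ne' hs0) ?_
      convert hm using 2
      push_cast; ring
    · exact h2 e' he' hee hm
  refine ⟨⟨h3, hyE⟩, ?_⟩
  -- The point lies on some side `s'`; the sign of the cross product shows that `s' = s`.
  obtain ⟨s', hs', hpos, ha⟩ := h1 hyE
  have : s' = s := by
    set v := e.2 - e.1
    have hv2 : 0 < v.re ^ 2 + v.im ^ 2 := by
      have := Complex.normSq_pos.mpr hne
      rw [Complex.normSq_apply] at this
      nlinarith
    have hcross : planeCross v (x + (τ : ℂ) * (s * (Complex.I * v)) - x) =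
        s * (τ * (v.re ^ 2 + v.im ^ 2)) := by
      simp only [planeCross, Complex.sub_re, Complex.sub_im,
        Complex.add_re, Complex.add_im, Complex.mul_re, Complex.mul_im, Complex.ofReal_re,
        Complex.ofReal_im, Complex.I_re, Complex.I_im]
      ring
    rw [hcross] at hpos
    have := mul_pos h4' hv2
    rcases hs with rfl | rfl <;> rcases hs' with rfl | rfl <;> first | rfl | (exfalso; linarith)
  subst this
  exact hE.onSide_of_adheres hs he hx ha

omit hE in
lemma joinedIn_of_onSide (hne : E.Nonempty) {s : ℝ} {z z' : ℂ} (h : OnSide E s z)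
    (h' : OnSide E s z') : JoinedIn (upperPlane \ edgeTrace E) z z' := by
  obtain ⟨e, he⟩ := hne
  obtain ⟨x, hx⟩ : (openSegment ℝ e.1 e.2).Nonempty := by
    rw [openSegment_eq_image]
    exact ⟨_, ⟨1 / 2, by norm_num, rfl⟩⟩
  exact (h e he x hx).joinedIn (h' e he x hx)

/-- The crossing count is constant on each side of the curve, with different values. -/
lemma exists_crossCount_onSide (hne : E.Nonempty) {l : ℂ} (hl : 0 < l.im) {B : Finset ℂ}
    (hB : IsEdgeBoundary E B) (hB0 : ∀ p ∈ B, p.im = 0 ∧ p ∈ edgeTrace E) :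
    ∃ c : ZMod 2, (∀ z, OnSide E 1 z → crossCount l E z = c) ∧
      ∀ z, OnSide E (-1) z → crossCount l E z = c + 1 := by
  have hne' := hne
  obtain ⟨e, he⟩ := hne
  obtain ⟨x, hx⟩ : (openSegment ℝ e.1 e.2).Nonempty := by
    rw [openSegment_eq_image]
    exact ⟨_, ⟨1 / 2, by norm_num, rfl⟩⟩
  obtain ⟨τ, ⟨h1, h2⟩, h3⟩ := (((hE.eventually_onSide (Or.inl rfl) he hx).and
    (hE.eventually_onSide (Or.inr rfl) he hx)).and (hE.toIsSimpleCurve.crossCount_jump hl hB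
      (fun p hp => (hB0 p hp).1) he hx (hE.upper e he hx))).exists
  have hmono : upperPlane \ edgeTrace E ⊆ {z : ℂ | 0 ≤ z.im} \ edgeTrace E :=
    Set.sdiff_subset_sdiff_left fun z (hz : 0 < z.im) => hz.le
  have e1 : x + (τ : ℂ) * (((1 : ℝ) : ℂ) * (Complex.I * (e.2 - e.1))) =
      x + τ * (Complex.I * (e.2 - e.1)) := by push_cast; ring
  have e2 : x + (τ : ℂ) * (((-1 : ℝ) : ℂ) * (Complex.I * (e.2 - e.1))) =
      x - τ * (Complex.I * (e.2 - e.1)) := by push_cast; ring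
  rw [e1] at h1
  rw [e2] at h2
  refine ⟨_, fun z hz => crossCount_joinedIn hl hB hB0
    ((joinedIn_of_onSide hne' hz h1.2).mono hmono), fun z hz => ?_⟩
  rw [crossCount_joinedIn hl hB hB0 ((joinedIn_of_onSide hne' hz h2.2).mono hmono), h3, add_assoc,
    CharTwo.add_self_eq_zero, add_zero]

/-- Near a vertex of the curve, the directions between the outgoing and the incoming segment
(counterclockwise) point to the left side, and the other ones to the right side. -/
lemma eventually_onSide_vertex {e₁ e₂ : ℂ × ℂ} (h₁ : e₁ ∈ E) (h₂ : e₂ ∈ E) (hv : e₁.2 = e₂.1)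
    (hvU : e₂.1 ∈ upperPlane) {α β : ℝ} (hα : HasAngle 1 (e₂.2 - e₂.1) α)
    (hβ : HasAngle 1 (e₁.1 - e₂.1) β) (hαβ : α < β) (hβα : β < α + 2 * Real.pi) {f : ℂ} {φ : ℝ}
    (hφ : HasAngle 1 f φ) (s : ℝ)
    (h : (s = 1 ∧ α < φ ∧ φ < β) ∨ (s = -1 ∧ β < φ ∧ φ < α + 2 * Real.pi)) :
    ∀ᶠ τ : ℝ in 𝓝[>] 0, OnSide E s (e₂.1 + τ * f) := by
  obtain ⟨r, hr, hr1, hr2, -, hΩ⟩ := hE.exists_sector_radius isOpen_upperPlane h₁ h₂ hv rfl hvU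
  have hΩ' := hΩ α β hα hβ
  have hf : 0 < ‖f‖ := norm_pos_iff.mpr (hφ.ne_zero one_ne_zero)
  have hsmall : ∀ᶠ τ : ℝ in 𝓝[>] 0, τ < r / ‖f‖ :=
    nhdsWithin_le_nhds (gt_mem_nhds (div_pos hr hf))
  have p1 := polarPoint_mem_openSegment hβ (half_pos hr) ((half_lt_self hr).trans_le hr1)
  rw [openSegment_symm, ← hv, hv] at p1
  filter_upwards [hsmall, self_mem_nhdsWithin] with τ h1 h2
  have h2' : 0 < τ := h2
  rw [lt_div_iff₀ hf] at h1
  have hy : e₂.1 + (τ : ℂ) * f = polarPoint e₂.1 (τ * ‖f‖) φ := by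
    unfold polarPoint
    have := hφ.eq_norm
    push_cast
    linear_combination (τ : ℂ) * this
  rw [hy]
  have hpos : 0 < τ * ‖f‖ := mul_pos h2' hf
  rcases h with ⟨rfl, a1, a2⟩ | ⟨rfl, a1, a2⟩
  · have hΩL : ∀ ρ θ, 0 < ρ → ρ < r → α < θ → θ < β →
        polarPoint e₂.1 ρ θ ∈ upperPlane \ edgeTrace E :=
      fun ρ θ a1 a2 a3 a4 => hΩ' ρ θ a1 a2 (sector_left a3 a4 hβα).1 (sector_left a3 a4 hβα).2
    refine hE.onSide_of_adheres (Or.inl rfl) h₁ (x := polarPoint e₂.1 (r / 2) β)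
      (by rw [hv]; exact p1) ?_
    rw [(hE.adheres_left_iff_sector h₁ h₂ hv rfl hα hβ hαβ hΩL (half_pos hr) (half_lt_self hr)).1]
    exact fun ρ θ' b1 b2 b3 b4 => joinedIn_sector hΩL hpos h1 a1 a2 b1 b2 b3 b4
  · have hΩR : ∀ ρ θ, 0 < ρ → ρ < r → β < θ → θ < α + 2 * Real.pi →
        polarPoint e₂.1 ρ θ ∈ upperPlane \ edgeTrace E :=
      fun ρ θ a1 a2 a3 a4 => hΩ' ρ θ a1 a2 (sector_right hαβ a3 a4).1 (sector_right hαβ a3 a4).2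
    refine hE.onSide_of_adheres (Or.inr rfl) h₁ (x := polarPoint e₂.1 (r / 2) β)
      (by rw [hv]; exact p1) ?_
    rw [(hE.adheres_right_iff_sector h₁ h₂ hv rfl hα hβ hβα hΩR (half_pos hr) (half_lt_self hr)).1]
    exact fun ρ θ' b1 b2 b3 b4 => joinedIn_sector hΩR hpos h1 a1 a2 b1 b2 b3 b4

end IsSimpleCurveInUpper

/-! ### The regions cut out by a closed curve -/

lemma zmodTwo_eq_zero_or_one (a : ZMod 2) : a = 0 ∨ a = 1 := by
  revert a; decide

lemma mem_connectedComponentIn_iff_joinedIn {F : Set ℂ} (hF : IsOpen F) {z y : ℂ} (hz : z ∈ F) :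
    y ∈ connectedComponentIn F z ↔ JoinedIn F z y := by
  constructor
  · intro hy
    have ho : IsOpen (connectedComponentIn F z) := hF.connectedComponentIn
    have hc : IsConnected (connectedComponentIn F z) := isConnected_connectedComponentIn_iff.mpr hz
    have := (ho.isConnected_iff_isPathConnected.mp hc).joinedIn z (mem_connectedComponentIn hz) y hy
    exact this.mono (connectedComponentIn_subset F z)
  · intro h
    exact ((isPathConnected_pathComponentIn
        hz).isConnected.isPreconnected.subset_connectedComponentIn
      (mem_pathComponentIn_self hz) pathComponentIn_subset) h

lemma upperPlane_diff_subset {T : Set ℂ} : upperPlane \ T ⊆ {z : ℂ | 0 ≤ z.im} \ T :=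
  Set.sdiff_subset_sdiff_left fun z (hz : 0 < z.im) => hz.le

lemma IsSimpleCurveInUpper.ends_mem_edgeTrace {e : ℂ × ℂ} (he : e ∈ E) :
    e.1 ∈ edgeTrace E ∧ e.2 ∈ edgeTrace E :=
  ⟨⟨e, he, left_mem_segment ℝ _ _⟩, ⟨e, he, right_mem_segment ℝ _ _⟩⟩

/-- The bounded component of the complement of a simple closed curve consists of the points with odd
crossing count. -/
lemma IsSimpleCurveInUpper.isBounded_component_iff (hE : IsSimpleCurveInUpper E) (hne : E.Nonempty)
    {l : ℂ} (hl : 0 < l.im) (hB : IsEdgeBoundary E ∅) {z : ℂ} (hz : z ∈ upperPlane \ edgeTrace E) :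
    Bornology.IsBounded (connectedComponentIn (upperPlane \ edgeTrace E) z) ↔
      crossCount l E z = 1 := by
  have hΩ : IsOpen (upperPlane \ edgeTrace E) :=
    isOpen_upperPlane.sdiff (isCompact_edgeTrace E).isClosed
  have hB0 : ∀ p ∈ (∅ : Finset ℂ), p.im = 0 ∧ p ∈ edgeTrace E := by simp
  have hconst : ∀ {z z'}, JoinedIn (upperPlane \ edgeTrace E) z z' →
      crossCount l E z = crossCount l E z' := fun h =>
    crossCount_joinedIn hl hB hB0 (h.mono upperPlane_diff_subset)
  obtain ⟨K, hK0, hK⟩ := (isCompact_edgeTrace E).isBounded.exists_pos_norm_lt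
  -- outside of a square the curve can be left behind by moving upwards
  have hup : ∀ y : ℂ, 0 < y.im → (K ≤ |y.re| ∨ K ≤ y.im) → ∀ T : ℝ, 0 ≤ T →
      JoinedIn (upperPlane \ edgeTrace E) y (y + T * Complex.I) := by
    intro y hy hfar T hT
    refine JoinedIn.of_segment_subset ?_
    rw [segment_eq_image']
    rintro _ ⟨s, hs, rfl⟩
    beta_reduce
    have hre : (y + s • (y + T * Complex.I - y)).re = y.re := by simp
    have him : (y + s • (y + T * Complex.I - y)).im = y.im + s * T := by simp
    have hsT := mul_nonneg hs.1 hT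
    refine ⟨show (0 : ℝ) < (y + s • (y + T * Complex.I - y)).im by rw [him]; linarith, fun hm => ?_⟩
    have hlt := hK _ hm
    have h1 := (Complex.abs_re_le_norm _).trans_lt hlt
    have h2 := (Complex.abs_im_le_norm _).trans_lt hlt
    rw [hre] at h1
    rw [him] at h2
    rcases hfar with h | h
    · linarith
    · have := le_abs_self (y.im + s * T); linarith
  have hfar0 : ∀ y : ℂ, 0 < y.im → (K ≤ |y.re| ∨ K ≤ y.im) → crossCount l E y = 0 := by
    intro y hy hfar
    rw [hconst (hup y hy hfar K hK0.le)]
    refine crossCount_above hl fun e he => ?_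
    obtain ⟨m1, m2⟩ := ends_mem_edgeTrace he
    have h1 := (le_abs_self _).trans_lt ((Complex.abs_im_le_norm _).trans_lt (hK _ m1))
    have h2 := (le_abs_self _).trans_lt ((Complex.abs_im_le_norm _).trans_lt (hK _ m2))
    have : (y + K * Complex.I).im = y.im + K := by simp
    rw [this]
    exact ⟨by linarith, by linarith⟩
  constructor
  · intro hb
    by_contra h1
    have h0 : crossCount l E z = 0 := (zmodTwo_eq_zero_or_one _).resolve_right h1
    have hw : 0 < ((K : ℂ) * Complex.I).im := by simpa using hK0
    have hwK : K ≤ ((K : ℂ) * Complex.I).im := by simp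
    have hwΩ : (K : ℂ) * Complex.I ∈ upperPlane \ edgeTrace E :=
      (hup _ hw (Or.inr hwK) 0 le_rfl).source_mem
    -- `z` lies on the same side as the points far above the curve
    have hj : JoinedIn (upperPlane \ edgeTrace E) z (K * Complex.I) := by
      obtain ⟨c, hc1, hc2⟩ := hE.exists_crossCount_onSide hne hl hB hB0
      obtain ⟨s, hs, hzs⟩ := hE.exists_onSide hne hz
      obtain ⟨s', hs', hws⟩ := hE.exists_onSide hne hwΩ
      have hw0 := hfar0 _ hw (Or.inr hwK)
      have : s = s' := by
        rcases hs with rfl | rfl <;> rcases hs' with rfl | rfl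
        · rfl
        · rw [hc1 z hzs] at h0
          rw [hc2 _ hws, h0] at hw0
          simp at hw0
        · rw [hc2 z hzs] at h0
          rw [hc1 _ hws] at hw0
          rw [hw0] at h0
          simp at h0
        · rfl
      subst this
      exact joinedIn_of_onSide hne hzs hws
    obtain ⟨M, hM⟩ := hb.exists_norm_le
    have hm := hM _ ((mem_connectedComponentIn_iff_joinedIn hΩ hz).mpr
      (hj.trans (hup _ hw (Or.inr hwK) (|M| + 1) (by positivity))))
    have h2 : ((K : ℂ) * Complex.I + (|M| + 1 : ℝ) * Complex.I).im = K + (|M| + 1) := by simp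
    have h3 := (le_abs_self _).trans ((Complex.abs_im_le_norm _).trans hm)
    rw [h2] at h3
    linarith [le_abs_self M]
  · intro h1
    refine (Metric.isBounded_closedBall (x := (0 : ℂ)) (r := K + K)).subset fun y hy => ?_
    have hj := (mem_connectedComponentIn_iff_joinedIn hΩ hz).mp hy
    have hy0 : 0 < y.im := hj.target_mem.1
    have hnf : ¬ (K ≤ |y.re| ∨ K ≤ y.im) := fun hf => by
      rw [hconst hj, hfar0 y hy0 hf] at h1
      exact zero_ne_one h1
    push Not at hnf
    rw [mem_closedBall_zero_iff]
    refine (Complex.norm_le_abs_re_add_abs_im y).trans ?_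
    rw [abs_of_pos hy0]
    linarith [hnf.1, hnf.2]

/-! ### The regions cut out by an arc and two parallel rays -/

/-- The open ray from `p` in the direction `l`. -/
def rayFrom (l p : ℂ) : Set ℂ := {z | ∃ t : ℝ, 0 < t ∧ z = p + t * l}

/-- Whether `z` lies between the lines through `p` and `q` in the direction `l`. -/
noncomputable def stripParity (l p q z : ℂ) : ZMod 2 := sideParity l (z - p) + sideParity l (z - q)

/-- A simple polygonal arc in the upper half-plane from the point `p` to the point `q` of the real
line. -/
structure IsCuttingArc (E : Finset (ℂ × ℂ)) (p q : ℂ) : Prop extends IsSimpleCurveInUpper E where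
  start_real : p.im = 0
  end_real : q.im = 0
  start_ne_end : p ≠ q
  real_mem : ∀ x ∈ edgeTrace E, x.im = 0 → x = p ∨ x = q
  exists_first : ∃ e ∈ E, e.1 = p
  snd_ne_start : ∀ e ∈ E, e.2 ≠ p
  end_mem : q ∈ edgeTrace E
  boundary : IsEdgeBoundary E {p, q}

lemma mem_rayFrom_iff {l p z : ℂ} (hl : 0 < l.im) (hp : p.im = 0) (hz : 0 < z.im) :
    z ∈ rayFrom l p ↔ planeCross l (z - p) = 0 := by
  constructor
  · rintro ⟨t, -, rfl⟩
    simp [planeCross]; ring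
  · intro h
    refine ⟨z.im / l.im, div_pos hz hl, ?_⟩
    simp only [planeCross, Complex.sub_re, Complex.sub_im, hp] at h
    apply Complex.ext
    · simp only [Complex.add_re, Complex.re_ofReal_mul]
      field_simp; linarith
    · simp only [Complex.add_im, Complex.im_ofReal_mul, hp]
      field_simp; ring

lemma planeCross_real {l x : ℂ} (hx : x.im = 0) : planeCross l x = -(l.im * x.re) := by
  simp [planeCross, hx]

lemma sideParity_of_pos {l x : ℂ} (h : 0 < planeCross l x) : sideParity l x = 0 := by
  simp [sideParity, h.le]

lemma sideParity_of_neg {l x : ℂ} (h : planeCross l x < 0) : sideParity l x = 1 := by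
  simp [sideParity, h]

lemma sideParity_neg {l x : ℂ} (h : planeCross l x ≠ 0) :
    sideParity l (-x) = sideParity l x + 1 := by
  have e : planeCross l (-x) = - planeCross l x := by simp [planeCross]; ring
  rcases lt_or_gt_of_ne h with h | h
  · rw [sideParity_of_neg h, sideParity_of_pos (by rw [e]; linarith)]; decide
  · rw [sideParity_of_pos h, sideParity_of_neg (by rw [e]; linarith)]; decide

/-- The side of `l` is locally constant off the line of `l`. -/
lemma sideParity_eventuallyEq {l x : ℂ} (h : planeCross l x ≠ 0) :
    ∀ᶠ y in 𝓝 x, sideParity l y = sideParity l x := by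
  have hc : Continuous fun y => planeCross l y := by unfold planeCross; fun_prop
  rcases lt_or_gt_of_ne h with h | h
  · filter_upwards [hc.continuousAt.eventually (gt_mem_nhds h)] with y hy
    rw [sideParity_of_neg h, sideParity_of_neg hy]
  · filter_upwards [hc.continuousAt.eventually (lt_mem_nhds h)] with y hy
    rw [sideParity_of_pos h, sideParity_of_pos hy]

lemma stripParity_eventuallyEq {l p q x : ℂ} (hp : planeCross l (x - p) ≠ 0)
    (hq : planeCross l (x - q) ≠ 0) : ∀ᶠ y in 𝓝 x, stripParity l p q y = stripParity l p q x := by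
  have c1 : Continuous fun y : ℂ => y - p := by fun_prop
  have c2 : Continuous fun y : ℂ => y - q := by fun_prop
  filter_upwards [c1.continuousAt.eventually (sideParity_eventuallyEq hp),
    c2.continuousAt.eventually (sideParity_eventuallyEq hq)] with y h1 h2
  unfold stripParity
  rw [h1, h2]

/-- A locally constant function is constant along paths. -/
lemma eq_of_joinedIn {α : Type*} {F : Set ℂ} {f : ℂ → α} (hf : ∀ x ∈ F, ∀ᶠ y in 𝓝 x, f y = f x)
    {z z' : ℂ} (h : JoinedIn F z z') : f z = f z' := by
  obtain ⟨γ, hγ⟩ := h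
  have hl : IsLocallyConstant (f ∘ γ) := (IsLocallyConstant.iff_eventually_eq _).mpr fun t =>
    γ.continuous.continuousAt.eventually (hf (γ t) (hγ t))
  have h01 := hl.apply_eq_of_preconnectedSpace 0 1
  simpa using h01

namespace IsCuttingArc

variable {p q l : ℂ} (hE : IsCuttingArc E p q) (hl : 0 < l.im)
include hE

lemma nonempty : E.Nonempty := by
  obtain ⟨e, he, -⟩ := hE.exists_first
  exact ⟨e, he⟩

lemma boundary_mem : ∀ x ∈ ({p, q} : Finset ℂ), x.im = 0 ∧ x ∈ edgeTrace E := by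
  intro x hx
  rw [Finset.mem_insert, Finset.mem_singleton] at hx
  rcases hx with rfl | rfl
  · obtain ⟨e, he, h⟩ := hE.exists_first
    exact ⟨hE.start_real, h ▸ (IsSimpleCurveInUpper.ends_mem_edgeTrace he).1⟩
  · exact ⟨hE.end_real, hE.end_mem⟩

include hl

lemma crossCount_eq_of_joinedIn {z z' : ℂ} (h : JoinedIn ({z | 0 ≤ z.im} \ edgeTrace E) z z') :
    crossCount l E z = crossCount l E z' :=
  crossCount_joinedIn hl hE.boundary hE.boundary_mem h

omit hE in
lemma planeCross_ne_zero {r p : ℂ} (hr : r.im = 0) (hp : p.im = 0) (h : r ≠ p) :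
    planeCross l (r - p) ≠ 0 := by
  rw [planeCross_real (by simp [hr, hp])]
  have : (r - p).re ≠ 0 := fun h0 => h (Complex.ext (by simpa [sub_eq_zero] using h0) (hr.trans
      hp.symm))
  exact neg_ne_zero.mpr (mul_ne_zero hl.ne' this)

/-- On the real line, the crossing count tells the points between the ends from the others. -/
lemma crossCount_real_eq {r : ℂ} (hr : r.im = 0) (hrp : r ≠ p) (hrq : r ≠ q) :
    crossCount l E r = stripParity l p q r := by
  have hrE : r ∉ edgeTrace E := fun h => (hE.real_mem r h hr).elim hrp hrq
  rw [crossCount_real hl hE.boundary (fun e he => ⟨hE.fst_im e he, hE.snd_im e he⟩) hr hrE,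
    Finset.sum_pair hE.start_ne_end, stripParity, ← neg_sub r p, ← neg_sub r q,
    sideParity_neg (planeCross_ne_zero hl hr hE.start_real hrp),
    sideParity_neg (planeCross_ne_zero hl hr hE.end_real hrq)]
  generalize sideParity l (r - p) = a
  generalize sideParity l (r - q) = b
  revert a b; decide

end IsCuttingArc

lemma sideParity_real_pos {l x : ℂ} (hl : 0 < l.im) (hx : x.im = 0) (h : 0 < x.re) :
    sideParity l x = 1 :=
  sideParity_of_neg (by rw [planeCross_real hx]; nlinarith)

lemma sideParity_real_neg {l x : ℂ} (hl : 0 < l.im) (hx : x.im = 0) (h : x.re < 0) :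
    sideParity l x = 0 :=
  sideParity_of_pos (by rw [planeCross_real hx]; nlinarith)

lemma angle_mem_of_im_pos {f : ℂ} (hf : 0 < f.im) : 0 < f.arg ∧ f.arg < Real.pi := by
  have h1 : 0 ≤ f.arg := Complex.arg_nonneg_iff.mpr hf.le
  refine ⟨lt_of_le_of_ne h1 fun h => ?_, lt_of_le_of_ne (Complex.arg_le_pi f) fun h => ?_⟩
  · exact hf.ne' (Complex.arg_eq_zero_iff.mp h.symm).2
  · exact hf.ne' (Complex.arg_eq_pi_iff.mp h).2

lemma polarPoint_im (v : ℂ) (ρ θ : ℝ) : (polarPoint v ρ θ).im = v.im + ρ * Real.sin θ := by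
  simp [polarPoint, Complex.exp_ofReal_mul_I_im]

lemma polarPoint_pi (v : ℂ) (ρ : ℝ) : polarPoint v ρ Real.pi = v - ρ := by
  simp [polarPoint, Complex.exp_pi_mul_I]; ring

lemma polarPoint_zero (v : ℂ) (ρ : ℝ) : polarPoint v ρ 0 = v + ρ := by
  simp [polarPoint]

namespace IsCuttingArc

variable {p q l : ℂ} (hE : IsCuttingArc E p q) (hl : 0 < l.im)
include hE

/-- Near its starting point the arc is a segment leaving the real line. -/
lemma exists_start_sector : ∃ e ∈ E, e.1 = p ∧ ∃ φ, 0 < φ ∧ φ < Real.pi ∧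
    HasAngle 1 (e.2 - p) φ ∧ ∃ r > 0, r ≤ ‖e.2 - p‖ ∧ ∀ ρ θ, 0 < ρ → ρ < r → 0 ≤ θ →
      θ ≤ Real.pi → θ ≠ φ → polarPoint p ρ θ ∉ edgeTrace E := by
  obtain ⟨e, he, hep⟩ := hE.exists_first
  have him : 0 < (e.2 - p).im := by
    have hm : (1 / 2 : ℝ) • e.1 + (1 / 2 : ℝ) • e.2 ∈ openSegment ℝ e.1 e.2 :=
      ⟨1 / 2, 1 / 2, by norm_num, by norm_num, by norm_num, rfl⟩
    have h2 : 0 < ((1 / 2 : ℝ) • e.1 + (1 / 2 : ℝ) • e.2).im := hE.upper e he hm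
    rw [Complex.add_im, Complex.smul_im, Complex.smul_im, hep, hE.start_real] at h2
    simp only [smul_eq_mul] at h2
    rw [Complex.sub_im, hE.start_real]
    linarith
  have hφ := angle_mem_of_im_pos him
  have hne : e.2 - p ≠ 0 := by rintro h; simp [h] at him
  have hang : HasAngle 1 (e.2 - p) (e.2 - p).arg := by
    simpa using HasAngle.arg_div one_ne_zero hne
  have hvO : p ∈ {z : ℂ | ∀ e' ∈ E, e' ≠ e → z ∉ segment ℝ e'.1 e'.2} := by
    intro e' he' hne hm
    rw [← insert_endpoints_openSegment] at hm
    rcases hm with h | h | h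
    · exact hne (hE.fst_inj _ he' _ he (h.symm.trans hep.symm))
    · exact hE.snd_ne_start e' he' h.symm
    · exact hE.fst_notMem e' he' e he (hep ▸ h)
  obtain ⟨r, hr, hb⟩ := Metric.isOpen_iff.mp (isOpen_compl_edgeTrace_diff (E := E) (· ≠ e)) p hvO
  refine ⟨e, he, hep, _, hφ.1, hφ.2, hang, min r ‖e.2 - p‖, lt_min hr (norm_pos_iff.mpr hne),
    min_le_right _ _, ?_⟩
  rintro ρ θ h0 h1 h2 h3 h4 ⟨e', he', hm⟩
  by_cases hee : e' = e
  · subst hee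
    rw [hep] at hm
    obtain ⟨k, hk⟩ := polarPoint_mem_segment hang h0 hm
    have hpi := Real.pi_pos
    have a1 : (k : ℝ) < 1 := by by_contra! hc; nlinarith [hφ.1]
    have a2 : (-1 : ℝ) < k := by by_contra! hc; nlinarith [hφ.2]
    have a1' : k < 1 := by exact_mod_cast a1
    have a2' : -1 < k := by exact_mod_cast a2
    obtain rfl : k = 0 := by omega
    exact h4 (by simpa using hk)
  · refine hb ?_ e' he' hee hm
    rw [Metric.mem_ball, dist_polarPoint p h0]
    exact h1.trans_le (min_le_left _ _)

include hl

/-- Each side of the arc reaches the real line on the corresponding side of its starting point. -/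
lemma exists_real_near_start {s : ℝ} (hs : s = 1 ∨ s = -1) {δ : ℝ} (hδ : 0 < δ) :
    ∃ ρ, 0 < ρ ∧ ρ < δ ∧ ∀ z, OnSide E s z →
      crossCount l E z = crossCount l E (p - s * ρ) ∧
      ∀ P : ℂ → Prop, (∀ᶠ y in 𝓝 (p - (s : ℂ) * ρ), P y) →
        ∃ y, P y ∧ JoinedIn (upperPlane \ edgeTrace E) z y := by
  obtain ⟨e, he, hep, φ, hφ0, hφπ, hang, r, hr, hr2, hfree⟩ := hE.exists_start_sector
  have hρr : min (r / 2) (δ / 2) < r := (min_le_left _ _).trans_lt (half_lt_self hr)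
  have hρ0 : 0 < min (r / 2) (δ / 2) := lt_min (half_pos hr) (half_pos hδ)
  refine ⟨min (r / 2) (δ / 2), hρ0, (min_le_right _ _).trans_lt (half_lt_self hδ), fun z hz => ?_⟩
  set ρ := min (r / 2) (δ / 2)
  have hpos := polarPoint_mem_openSegment hang hρ0 (hρr.trans_le hr2)
  have hcont : Continuous fun θ : ℝ => polarPoint p ρ θ := by unfold polarPoint; fun_prop
  have hupper : ∀ ρ' θ, 0 < ρ' → ρ' < r → 0 < θ → θ < Real.pi → θ ≠ φ →
      polarPoint p ρ' θ ∈ upperPlane \ edgeTrace E := fun ρ' θ h0 h1 h2 h3 h4 => by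
    refine ⟨?_, hfree ρ' θ h0 h1 h2.le h3.le h4⟩
    change 0 < (polarPoint p ρ' θ).im
    rw [polarPoint_im, hE.start_real, zero_add]
    exact mul_pos h0 (Real.sin_pos_of_pos_of_lt_pi h2 h3)
  have hadh := hz e he (polarPoint p ρ φ) (by rw [hep]; exact hpos)
  rw [adheres_outgoing_iff hep (hE.ne e he) hang] at hadh
  have harc : ∀ θ₁ θ₂, (∀ θ ∈ segment ℝ θ₁ θ₂, 0 ≤ θ ∧ θ ≤ Real.pi ∧ θ ≠ φ) →
      JoinedIn ({z | 0 ≤ z.im} \ edgeTrace E) (polarPoint p ρ θ₁) (polarPoint p ρ θ₂) := by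
    intro θ₁ θ₂ h
    refine ((JoinedIn.of_segment_subset (subset_rfl : segment ℝ θ₁ θ₂ ⊆ _)).map hcont).mono ?_
    rintro _ ⟨θ, hθ, rfl⟩
    obtain ⟨h1, h2, h3⟩ := h θ hθ
    refine ⟨?_, hfree ρ θ hρ0 hρr h1 h2 h3⟩
    change 0 ≤ (polarPoint p ρ θ).im
    rw [polarPoint_im, hE.start_real, zero_add]
    exact mul_nonneg hρ0.le (Real.sin_nonneg_of_nonneg_of_le_pi h1 h2)
  -- On a small half-circle around `p`, the left side of the arc extends to the angle `π` and the
  -- right side to the angle `0`; these are the points `p - s ρ`.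
  rcases hs with rfl | rfl
  · have hsec := (adheres_sector_start_iff (β := Real.pi) hφπ (fun ρ θ a1 a2 a3 a4 =>
      hupper ρ θ a1 a2 (by linarith) a4 a3.ne') hρ0 hρr).mp hadh
    have e1 : p - ((1 : ℝ) : ℂ) * ρ = polarPoint p ρ Real.pi := by
      rw [polarPoint_pi]; push_cast; ring
    rw [e1]
    constructor
    · rw [hE.crossCount_eq_of_joinedIn hl ((hsec ρ ((φ + Real.pi) / 2) hρ0 hρr (by linarith)
        (by linarith)).mono upperPlane_diff_subset)]
      refine hE.crossCount_eq_of_joinedIn hl (harc _ _ fun θ hθ => ?_)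
      rw [segment_eq_Icc (by linarith)] at hθ
      exact ⟨by linarith [hθ.1], hθ.2, by intro h; linarith [hθ.1]⟩
    · intro P hP
      have h1 : ∀ᶠ θ in 𝓝[<] Real.pi, P (polarPoint p ρ θ) :=
        (hcont.continuousAt.eventually hP).filter_mono nhdsWithin_le_nhds
      obtain ⟨θ, hθ, h2, h3⟩ := (h1.and ((Ioo_mem_nhdsLT hφπ))).exists
      exact ⟨_, hθ, hsec ρ θ hρ0 hρr h2 h3⟩
  · have hsec := (adheres_sector_end_iff (α := 0) hφ0 (fun ρ θ a1 a2 a3 a4 =>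
      hupper ρ θ a1 a2 a3 (by linarith) a4.ne) hρ0 hρr).mp hadh
    have e1 : p - ((-1 : ℝ) : ℂ) * ρ = polarPoint p ρ 0 := by
      rw [polarPoint_zero]; push_cast; ring
    rw [e1]
    constructor
    · rw [hE.crossCount_eq_of_joinedIn hl ((hsec ρ (φ / 2) hρ0 hρr (by linarith)
        (by linarith)).mono upperPlane_diff_subset)]
      refine hE.crossCount_eq_of_joinedIn hl (harc _ _ fun θ hθ => ?_)
      rw [segment_symm, segment_eq_Icc (by linarith)] at hθ
      exact ⟨hθ.1, by linarith [hθ.2], by intro h; linarith [hθ.2]⟩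
    · intro P hP
      have h1 : ∀ᶠ θ in 𝓝[>] (0 : ℝ), P (polarPoint p ρ θ) :=
        (hcont.continuousAt.eventually hP).filter_mono nhdsWithin_le_nhds
      obtain ⟨θ, hθ, h2, h3⟩ := (h1.and ((Ioo_mem_nhdsGT hφ0))).exists
      exact ⟨_, hθ, hsec ρ θ hρ0 hρr h2 h3⟩

omit hl in
lemma exists_onSide_one : ∃ z, OnSide E 1 z := by
  obtain ⟨e, he⟩ := hE.nonempty
  obtain ⟨x, hx⟩ : (openSegment ℝ e.1 e.2).Nonempty := by
    rw [openSegment_eq_image]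
    exact ⟨_, ⟨1 / 2, by norm_num, rfl⟩⟩
  obtain ⟨τ, hτ⟩ := (hE.eventually_onSide (Or.inl rfl) he hx).exists
  exact ⟨_, hτ.2⟩

/-- The crossing counts on the left and on the right of the arc. -/
lemma crossCount_onSide : (∀ z, OnSide E 1 z → crossCount l E z = sideParity l (p - q)) ∧
    ∀ z, OnSide E (-1) z → crossCount l E z = sideParity l (p - q) + 1 := by
  obtain ⟨c, hc1, hc2⟩ := hE.exists_crossCount_onSide hE.nonempty hl hE.boundary hE.boundary_mem
  obtain ⟨z, hz⟩ := hE.exists_onSide_one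
  have hre : (p - q).re ≠ 0 := fun h0 => hE.start_ne_end
    (Complex.ext (by simpa [sub_eq_zero] using h0) (hE.start_real.trans hE.end_real.symm))
  obtain ⟨ρ, hρ0, hρ, h⟩ := hE.exists_real_near_start hl (Or.inl rfl) (abs_pos.mpr hre)
  have h1 := (h z hz).1
  have him : (p - ((1 : ℝ) : ℂ) * ρ).im = 0 := by simp [hE.start_real]
  have hpq : (p - ((1 : ℝ) : ℂ) * ρ - q).im = 0 := by simp [hE.start_real, hE.end_real]
  have hpp : (p - ((1 : ℝ) : ℂ) * ρ - p).im = 0 := by simp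
  have hpp' : (p - ((1 : ℝ) : ℂ) * ρ - p).re < 0 := by simpa using hρ0
  have hpqr : (p - ((1 : ℝ) : ℂ) * ρ - q).re = (p - q).re - ρ := by simp; ring
  have hpqi : (p - q).im = 0 := by simp [hE.start_real, hE.end_real]
  -- As `ρ` is less than the distance of `p` and `q`, moving from `p` by `ρ` does not pass `q`.
  have hne : (p - ((1 : ℝ) : ℂ) * ρ - q).re ≠ 0 ∧
      sideParity l (p - ((1 : ℝ) : ℂ) * ρ - q) = sideParity l (p - q) := by
    rcases lt_or_gt_of_ne hre with h0 | h0
    · have : (p - ((1 : ℝ) : ℂ) * ρ - q).re < 0 := by rw [hpqr]; linarith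
      exact ⟨this.ne, by rw [sideParity_real_neg hl hpq this, sideParity_real_neg hl hpqi h0]⟩
    · rw [abs_of_pos h0] at hρ
      have : 0 < (p - ((1 : ℝ) : ℂ) * ρ - q).re := by rw [hpqr]; linarith
      exact ⟨this.ne', by rw [sideParity_real_pos hl hpq this, sideParity_real_pos hl hpqi h0]⟩
  rw [hE.crossCount_real_eq hl him (fun h0 => by rw [h0] at hpp'; simp at hpp')
    (fun h0 => by rw [h0] at hne; simp at hne), stripParity, sideParity_real_neg hl hpp hpp', hne.2,
    zero_add, hc1 z hz] at h1
  rw [← h1]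
  exact ⟨hc1, hc2⟩

/-- If a point is on the wrong side of the arc with respect to the strip between the rays, its
region in the complement of the arc and the rays adheres to the arc. -/
lemma exists_adheres_arc {z : ℂ}
    (hz : z ∈ upperPlane \ (edgeTrace E ∪ rayFrom l p ∪ rayFrom l q))
    (h : crossCount l E z ≠ stripParity l p q z) :
    ∃ s : ℝ, (s = 1 ∨ s = -1) ∧ ∃ e ∈ E, ∃ x ∈ openSegment ℝ e.1 e.2,
      Adheres (upperPlane \ (edgeTrace E ∪ rayFrom l p ∪ rayFrom l q)) z x
        (s * (Complex.I * (e.2 - e.1))) := by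
  have hzH : 0 < z.im := hz.1
  simp only [Set.mem_sdiff, Set.mem_union, not_or] at hz
  obtain ⟨-, ⟨hzE, hzp⟩, hzq⟩ := hz
  rw [mem_rayFrom_iff hl hE.start_real hzH] at hzp
  rw [mem_rayFrom_iff hl hE.end_real hzH] at hzq
  -- project `z` to the real line along `l`
  set r : ℂ := z - (z.im / l.im : ℝ) * l with hr
  have hrim : r.im = 0 := by
    simp only [hr, Complex.sub_im, Complex.im_ofReal_mul]; field_simp; ring
  have hcross : ∀ t : ℝ, ∀ x : ℂ, planeCross l (z + t * l - x) = planeCross l (z - x) := by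
    intro t x; simp [planeCross]; ring
  have hseg : ∀ w ∈ segment ℝ z r, ∃ t : ℝ, w = z + t * l := by
    intro w hw
    rw [segment_eq_image'] at hw
    obtain ⟨t, -, rfl⟩ := hw
    refine ⟨-(t * (z.im / l.im)), ?_⟩
    simp only [hr, Complex.real_smul]; push_cast; ring
  have hstrip : ∀ w ∈ segment ℝ z r, planeCross l (w - p) = planeCross l (z - p) ∧
      planeCross l (w - q) = planeCross l (z - q) := by
    intro w hw
    obtain ⟨t, rfl⟩ := hseg w hw
    exact ⟨hcross t p, hcross t q⟩
  have hrs := hstrip r (right_mem_segment ℝ z r)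
  have hS : stripParity l p q r = stripParity l p q z := by
    simp only [stripParity, sideParity, hrs]
  have hnonneg : segment ℝ z r ⊆ {w : ℂ | 0 ≤ w.im} :=
    (convex_halfSpace_im_ge 0).segment_subset hzH.le hrim.ge
  have hrp : r ≠ p := fun h0 => by rw [h0, sub_self] at hrs; exact hzp (by rw [← hrs.1]; simp
      [planeCross])
  have hrq : r ≠ q := fun h0 => by rw [h0, sub_self] at hrs; exact hzq (by rw [← hrs.2]; simp
      [planeCross])
  obtain ⟨w, hw, hwE⟩ : ∃ w ∈ segment ℝ z r, w ∈ edgeTrace E := by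
    by_contra! hc
    have hj : JoinedIn ({z | 0 ≤ z.im} \ edgeTrace E) z r :=
      JoinedIn.of_segment_subset fun w hw => ⟨hnonneg hw, hc w hw⟩
    exact h (by rw [hE.crossCount_eq_of_joinedIn hl hj, hE.crossCount_real_eq hl hrim hrp hrq, hS])
  have hwim : 0 < w.im := by
    refine lt_of_le_of_ne (hnonneg hw) fun h0 => ?_
    have hs := hstrip w hw
    rcases hE.real_mem w hwE h0.symm with rfl | rfl
    · exact hzp (by rw [← hs.1]; simp [planeCross])
    · exact hzq (by rw [← hs.2]; simp [planeCross])
  set V : Set ℂ := upperPlane ∩ {y | planeCross l (y - p) ≠ 0 ∧ planeCross l (y - q) ≠ 0} with hV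
  have hVo : IsOpen V := by
    have c1 : Continuous fun y : ℂ => planeCross l (y - p) := by unfold planeCross; fun_prop
    have c2 : Continuous fun y : ℂ => planeCross l (y - q) := by unfold planeCross; fun_prop
    exact isOpen_upperPlane.inter ((isOpen_ne_fun c1 continuous_const).inter
      (isOpen_ne_fun c2 continuous_const))
  have hzw : JoinedIn V z w := by
    refine JoinedIn.of_segment_subset fun y hy => ⟨convex_upperPlane.segment_subset hzH hwim hy, ?_⟩
    have hs := hstrip y ((convex_segment z r).segment_subset (left_mem_segment ℝ z r) hw hy)
    rw [Set.mem_ofPred_eq, hs.1, hs.2]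
    exact ⟨hzp, hzq⟩
  obtain ⟨s, hs, e, he, x, hx, ha⟩ := hE.exists_adheres_of_joinedIn hVo Set.inter_subset_left hzw
    hzE hwE
  refine ⟨s, hs, e, he, x, hx, ha.mono ?_⟩
  rintro y ⟨⟨hy1, hy2, hy3⟩, hy4⟩
  refine ⟨hy1, ?_⟩
  simp only [Set.mem_union, not_or]
  exact ⟨⟨hy4, fun h => hy2 ((mem_rayFrom_iff hl hE.start_real hy1).mp h)⟩,
    fun h => hy3 ((mem_rayFrom_iff hl hE.end_real hy1).mp h)⟩

/-- In the same situation, the region adheres to one of the rays. -/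
lemma exists_adheres_ray {z : ℂ}
    (hz : z ∈ upperPlane \ (edgeTrace E ∪ rayFrom l p ∪ rayFrom l q))
    (h : crossCount l E z ≠ stripParity l p q z) :
    ∃ s : ℝ, (s = 1 ∨ s = -1) ∧ ∃ x, (x ∈ rayFrom l p ∨ x ∈ rayFrom l q) ∧
      Adheres (upperPlane \ (edgeTrace E ∪ rayFrom l p ∪ rayFrom l q)) z x
        (s * (Complex.I * l)) := by
  have hzH : 0 < z.im := hz.1
  have hz' := hz
  simp only [Set.mem_sdiff, Set.mem_union, not_or] at hz'
  obtain ⟨-, ⟨hzE, hzp⟩, hzq⟩ := hz'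
  set D := upperPlane \ (edgeTrace E ∪ rayFrom l p ∪ rayFrom l q) with hD
  set K : Set ℂ := {y | planeCross l (y - p) = 0} ∪ {y | planeCross l (y - q) = 0} with hK
  have c1 : Continuous fun y : ℂ => planeCross l (y - p) := by unfold planeCross; fun_prop
  have c2 : Continuous fun y : ℂ => planeCross l (y - q) := by unfold planeCross; fun_prop
  have hKc : IsClosed K := (isClosed_eq c1 continuous_const).union (isClosed_eq c2 continuous_const)
  have hFK : ∀ y, y ∈ (upperPlane \ edgeTrace E) \ K ↔ y ∈ D := by
    intro y
    simp only [hD, hK, Set.mem_sdiff, Set.mem_union, Set.mem_ofPred_eq]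
    constructor
    · rintro ⟨⟨h1, h2⟩, h3⟩
      rw [← mem_rayFrom_iff hl hE.start_real h1, ← mem_rayFrom_iff hl hE.end_real h1] at h3
      tauto
    · rintro ⟨h1, h2⟩
      rw [mem_rayFrom_iff hl hE.start_real h1, mem_rayFrom_iff hl hE.end_real h1] at h2
      tauto
  -- the side of the arc containing `z` reaches the real line, where the parities agree
  obtain ⟨s, hs, hside⟩ := hE.exists_onSide hE.nonempty ⟨hzH, hzE⟩
  have hre : (p - q).re ≠ 0 := fun h0 => hE.start_ne_end
    (Complex.ext (by simpa [sub_eq_zero] using h0) (hE.start_real.trans hE.end_real.symm))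
  obtain ⟨ρ, hρ0, hρ, hnear⟩ := hE.exists_real_near_start hl hs (abs_pos.mpr hre)
  obtain ⟨hc, hex⟩ := hnear z hside
  have hr0 : (p - (s : ℂ) * ρ).im = 0 := by simp [hE.start_real]
  have hrp : p - (s : ℂ) * ρ ≠ p := by
    intro h0
    have h1 := congrArg Complex.re h0
    simp at h1
    rcases hs with rfl | rfl <;> rcases h1 with h1 | h1 <;> linarith
  have hrq : p - (s : ℂ) * ρ ≠ q := by
    intro h0
    have h1 := congrArg Complex.re h0
    have : (p - q).re = s * ρ := by simp at h1 ⊢; linarith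
    rw [this, abs_mul, abs_of_pos hρ0] at hρ
    rcases hs with rfl | rfl <;> simp at hρ
  obtain ⟨y, hy, hzy⟩ := hex _ (stripParity_eventuallyEq
    (planeCross_ne_zero hl hr0 hE.start_real hrp) (planeCross_ne_zero hl hr0 hE.end_real hrq))
  have hSy : stripParity l p q y ≠ stripParity l p q z := by
    rw [hy, ← hE.crossCount_real_eq hl hr0 hrp hrq, ← hc]; exact h
  have hlocS : ∀ x ∈ (upperPlane \ edgeTrace E) \ K, ∀ᶠ y in 𝓝 x,
      stripParity l p q y = stripParity l p q x := by
    rintro x ⟨-, hx⟩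
    simp only [hK, Set.mem_union, Set.mem_ofPred_eq, not_or] at hx
    exact stripParity_eventuallyEq hx.1 hx.2
  -- so the path to the real line crosses a ray
  obtain ⟨w, hwK, hzw⟩ : ∃ w ∈ K, JoinedIn (upperPlane \ edgeTrace E) z w := by
    obtain ⟨γ, hγ⟩ := hzy
    by_contra! hc'
    refine hSy (eq_of_joinedIn hlocS ⟨γ, fun t => ⟨hγ t, fun hm => hc' _ hm ?_⟩⟩).symm
    have hpc : JoinedIn (Set.Icc (0 : ℝ) t) 0 t := JoinedIn.of_segment_subset
      ((convex_Icc _ _).segment_subset (Set.left_mem_Icc.mpr t.2.1) (Set.right_mem_Icc.mpr t.2.1))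
    have := hpc.map γ.continuous_extend
    rw [γ.extend_zero, γ.extend_apply t.2] at this
    refine this.mono ?_
    rintro _ ⟨u, hu, rfl⟩
    rw [γ.extend_apply ⟨hu.1, hu.2.trans t.2.2⟩]
    exact hγ _
  have hzK : z ∉ K := ((hFK z).mpr hz).2
  obtain ⟨x, ⟨hxK, hxH, hxE⟩, hhit⟩ := exists_first_hit hzw hKc hzK hwK
  have hxray : x ∈ rayFrom l p ∨ x ∈ rayFrom l q := by
    rw [mem_rayFrom_iff hl hE.start_real hxH, mem_rayFrom_iff hl hE.end_real hxH]
    exact hxK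
  -- near `x` the line of the ray separates two half-discs
  have hopen : IsOpen (upperPlane \ edgeTrace E) :=
    isOpen_upperPlane.sdiff (isCompact_edgeTrace E).isClosed
  have hpq0 : planeCross l (p - q) ≠ 0 :=
    planeCross_ne_zero hl hE.start_real hE.end_real hE.start_ne_end
  have hdiff : ∀ y : ℂ, planeCross l (y - q) = planeCross l (y - p) + planeCross l (p - q) := by
    intro y; simp [planeCross]; ring
  have hcx : ∀ y : ℂ, planeCross l (y - p) = planeCross l (y - x) + planeCross l (x - p) := by
    intro y; simp [planeCross]; ring
  have hcx' : ∀ y : ℂ, planeCross l (y - q) = planeCross l (y - x) + planeCross l (x - q) := by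
    intro y; simp [planeCross]; ring
  -- close to `x` only the line through `x` matters
  have hnearK : ∀ᶠ y in 𝓝 x, planeCross l (y - x) ≠ 0 → y ∉ K := by
    rcases hxK with h0 | h0
    · have h0' : planeCross l (x - p) = 0 := h0
      have : planeCross l (x - q) ≠ 0 := by rw [hdiff, h0', zero_add]; exact hpq0
      filter_upwards [c2.continuousAt.eventually_ne this] with y hy hyx
      rintro (h1 | h1)
      · have h1' : planeCross l (y - p) = 0 := h1
        rw [hcx, h0', add_zero] at h1'; exact hyx h1'
      · exact hy h1
    · have h0' : planeCross l (x - q) = 0 := h0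
      have : planeCross l (x - p) ≠ 0 := fun h1 => by
        rw [hdiff, h1, zero_add] at h0'; exact hpq0 h0'
      filter_upwards [c1.continuousAt.eventually_ne this] with y hy hyx
      rintro (h1 | h1)
      · exact hy h1
      · have h1' : planeCross l (y - q) = 0 := h1
        rw [hcx', h0', add_zero] at h1'; exact hyx h1'
  obtain ⟨ε, hε, hb⟩ := Metric.eventually_nhds_iff_ball.mp
    (hnearK.and (hopen.mem_nhds ⟨hxH, hxE⟩))
  obtain ⟨y, hyb, hzy'⟩ := hhit _ (Metric.ball_mem_nhds x hε)
  have hyx : planeCross l (y - x) ≠ 0 := by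
    intro h0
    refine hzy'.target_mem.2 ?_
    rcases hxK with h1 | h1
    · have h1' : planeCross l (x - p) = 0 := h1
      exact Or.inl (by rw [Set.mem_ofPred_eq, hcx, h0, h1', zero_add])
    · have h1' : planeCross l (x - q) = 0 := h1
      exact Or.inr (by rw [Set.mem_ofPred_eq, hcx', h0, h1', zero_add])
  obtain ⟨s', hs', hsc⟩ : ∃ s' : ℝ, (s' = 1 ∨ s' = -1) ∧ 0 < s' * planeCross l (y - x) := by
    rcases lt_or_gt_of_ne hyx with h | h
    · exact ⟨-1, Or.inr rfl, by linarith⟩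
    · exact ⟨1, Or.inl rfl, by linarith⟩
  have hs2 : s' * s' = 1 := by rcases hs' with rfl | rfl <;> norm_num
  refine ⟨s', hs', x, hxray, Adheres.trans (hzy'.mono fun u hu => (hFK u).mp hu) ?_⟩
  have hsmall : ∀ᶠ τ : ℝ in 𝓝[>] 0, x + (τ : ℂ) * (s' * (Complex.I * l)) ∈ Metric.ball x ε := by
    have : Continuous fun τ : ℝ => x + (τ : ℂ) * (s' * (Complex.I * l)) := by fun_prop
    have := (this.tendsto 0).mono_left (nhdsWithin_le_nhds (s := Set.Ioi 0))
    simp only [Complex.ofReal_zero, zero_mul, add_zero] at this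
    exact this.eventually (Metric.ball_mem_nhds x hε)
  filter_upwards [hsmall, self_mem_nhdsWithin] with τ h1 h2
  refine JoinedIn.of_segment_subset fun u hu => ?_
  have hu1 := (convex_ball x ε).segment_subset hyb h1 hu
  have hconv : Convex ℝ {u : ℂ | 0 < s' * planeCross l (u - x)} := by
    intro a ha b hb' m n hm hn hmn
    simp only [Set.mem_ofPred_eq] at ha hb' ⊢
    have : s' * planeCross l (m • a + n • b - x) =
        m * (s' * planeCross l (a - x)) + n * (s' * planeCross l (b - x)) := by
      obtain rfl : n = 1 - m := by linarith
      simp only [planeCross, Complex.real_smul, Complex.sub_re, Complex.sub_im,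
        Complex.add_re, Complex.add_im, Complex.mul_re, Complex.mul_im, Complex.ofReal_re,
        Complex.ofReal_im]
      ring
    rw [this]
    rcases hm.eq_or_lt with h | h
    · have : n = 1 := by linarith
      rw [← h, this]; linarith
    · have := mul_pos h ha
      have := mul_nonneg hn hb'.le
      linarith
  have hu2 : 0 < s' * planeCross l (u - x) := by
    refine hconv.segment_subset (x := y) hsc ?_ hu
    simp only [Set.mem_ofPred_eq, planeCross, Complex.sub_re, Complex.sub_im,
      Complex.add_re, Complex.add_im, Complex.mul_re, Complex.mul_im, Complex.ofReal_re,
      Complex.ofReal_im, Complex.I_re, Complex.I_im]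
    have : 0 < τ * (l.re ^ 2 + l.im ^ 2) := mul_pos h2 (by positivity)
    nlinarith
  refine (hFK u).mp ⟨(hb u hu1).2, (hb u hu1).1 fun h0 => ?_⟩
  rw [h0, mul_zero] at hu2
  exact lt_irrefl _ hu2

end IsCuttingArc

end SimpleCurve

/-! ### Directed paths and cycles of a drawn graph -/

namespace PlabicGraph

variable {n : ℕ} {J : Type*} {G : PlabicGraph n J}

lemma walkArc_iff {u v : Fin n ⊕ J} (w : G.graph.Walk u v) (a b : Fin n ⊕ J) :
    G.WalkArc w a b ↔ ∃ k < w.length, a = w.getVert k ∧ b = w.getVert (k + 1) := by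
  constructor
  · rintro ⟨h, hm⟩
    obtain ⟨k, hk, e⟩ := List.getElem_of_mem hm
    rw [SimpleGraph.Walk.darts_getElem_eq_getVert] at e
    rw [SimpleGraph.Walk.length_darts] at hk
    have := congrArg SimpleGraph.Dart.toProd e
    simp only [Prod.mk.injEq] at this
    exact ⟨k, hk, this.1.symm, this.2.symm⟩
  · rintro ⟨k, hk, rfl, rfl⟩
    refine ⟨w.adj_getVert_succ hk, ?_⟩
    have hk' : k < w.darts.length := by rwa [SimpleGraph.Walk.length_darts]
    rw [← SimpleGraph.Walk.darts_getElem_eq_getVert k hk']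
    exact List.getElem_mem hk'

lemma WalkArc.adj {u v : Fin n ⊕ J} {w : G.graph.Walk u v} {a b : Fin n ⊕ J}
    (h : G.WalkArc w a b) : G.graph.Adj a b := h.1

lemma boundary_neighbour_unique {i : Fin n} {a b : Fin n ⊕ J} (ha : G.graph.Adj (Sum.inl i) a)
    (hb : G.graph.Adj (Sum.inl i) b) : a = b := by
  obtain ⟨c, hc⟩ := Set.ncard_eq_one.mp (G.boundary_degree i)
  have h1 : a ∈ ({c} : Set (Fin n ⊕ J)) := hc ▸ ha
  have h2 : b ∈ ({c} : Set (Fin n ⊕ J)) := hc ▸ hb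
  rw [h1, h2]

namespace IsPerfectOrientation

variable {O : Fin n ⊕ J → Fin n ⊕ J → Prop} (hO : G.IsPerfectOrientation O)
include hO

lemma adj {a b : Fin n ⊕ J} (h : O a b) : G.graph.Adj a b := (hO.adj_iff a b).mpr (Or.inl h)

/-- A boundary vertex is not both a source and a sink. -/
lemma not_boundary_through {i : Fin n} {a b : Fin n ⊕ J} (h : O a (Sum.inl i)) :
    ¬ O (Sum.inl i) b := fun h' => by
  have := boundary_neighbour_unique (hO.adj h).symm (hO.adj h')
  subst this
  exact hO.asymm _ _ h h'

end IsPerfectOrientation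

/-- A directed walk that does not meet itself, except that it may be closed. -/
structure IsSimpleDirected (O : Fin n ⊕ J → Fin n ⊕ J → Prop) {u v : Fin n ⊕ J}
    (w : G.graph.Walk u v) : Prop where
  directed : ∀ a b, G.WalkArc w a b → O a b
  fst_injOn : Set.InjOn w.getVert {k | k < w.length}
  snd_injOn : Set.InjOn (fun k => w.getVert (k + 1)) {k | k < w.length}
  exists_prev : ∀ x b, G.WalkArc w (Sum.inr x) b → ∃ a, G.WalkArc w a (Sum.inr x)
  exists_next : ∀ x a, G.WalkArc w a (Sum.inr x) → ∃ b, G.WalkArc w (Sum.inr x) b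

lemma exists_prev_of_ne {u v : Fin n ⊕ J} {w : G.graph.Walk u v} {a b : Fin n ⊕ J}
    (h : G.WalkArc w a b) (ha : a ≠ u) : ∃ c, G.WalkArc w c a := by
  obtain ⟨k, hk, rfl, rfl⟩ := (walkArc_iff w a b).mp h
  rcases k with _ | k
  · simp at ha
  · exact ⟨_, (walkArc_iff w _ _).mpr ⟨k, by omega, rfl, rfl⟩⟩

lemma exists_next_of_ne {u v : Fin n ⊕ J} {w : G.graph.Walk u v} {a b : Fin n ⊕ J}
    (h : G.WalkArc w a b) (hb : b ≠ v) : ∃ c, G.WalkArc w b c := by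
  obtain ⟨k, hk, rfl, rfl⟩ := (walkArc_iff w a b).mp h
  refine ⟨_, (walkArc_iff w _ _).mpr ⟨k + 1, ?_, rfl, rfl⟩⟩
  refine lt_of_le_of_ne hk fun h => hb ?_
  rw [show k + 1 = w.length from h, SimpleGraph.Walk.getVert_length]

lemma exists_prev_of_isCycle {u : Fin n ⊕ J} {w : G.graph.Walk u u} (hw : w.IsCycle)
    {a b : Fin n ⊕ J} (h : G.WalkArc w a b) : ∃ c, G.WalkArc w c a := by
  by_cases hx : a = u
  · have hl := hw.three_le_length
    refine ⟨w.getVert (w.length - 1), (walkArc_iff w _ _).mpr ⟨w.length - 1, by omega, rfl, ?_⟩⟩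
    rw [show w.length - 1 + 1 = w.length by omega, SimpleGraph.Walk.getVert_length, hx]
  · exact exists_prev_of_ne h hx

lemma exists_next_of_isCycle {u : Fin n ⊕ J} {w : G.graph.Walk u u} (hw : w.IsCycle)
    {a b : Fin n ⊕ J} (h : G.WalkArc w a b) : ∃ c, G.WalkArc w b c := by
  by_cases hx : b = u
  · have hl := hw.three_le_length
    exact ⟨w.getVert 1, (walkArc_iff w _ _).mpr ⟨0, by omega, by simp [hx], rfl⟩⟩
  · exact exists_next_of_ne h hx

lemma IsSimpleDirected.of_isPath {O : Fin n ⊕ J → Fin n ⊕ J → Prop} {i j : Fin n}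
    {w : G.graph.Walk (Sum.inl i) (Sum.inl j)} (hw : w.IsPath)
    (hO : ∀ a b, G.WalkArc w a b → O a b) : IsSimpleDirected O w where
  directed := hO
  fst_injOn := hw.getVert_injOn.mono fun k (hk : k < w.length) => hk.le
  snd_injOn := fun k hk m hm h => by
    have := hw.getVert_injOn (show k + 1 ≤ w.length from hk) (show m + 1 ≤ w.length from hm) h
    omega
  exists_prev := fun x b h => exists_prev_of_ne h (by simp)
  exists_next := fun x a h => exists_next_of_ne h (by simp)

lemma IsSimpleDirected.of_isCycle {O : Fin n ⊕ J → Fin n ⊕ J → Prop} {u : Fin n ⊕ J}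
    {w : G.graph.Walk u u} (hw : w.IsCycle)
    (hO : ∀ a b, G.WalkArc w a b → O a b) : IsSimpleDirected O w where
  directed := hO
  fst_injOn := hw.getVert_injOn'.mono fun k (hk : k < w.length) => Nat.le_sub_one_of_lt hk
  snd_injOn := fun k hk m hm h => by
    have hk' : k < w.length := hk
    have hm' : m < w.length := hm
    have := hw.getVert_injOn (show 1 ≤ k + 1 ∧ k + 1 ≤ w.length by omega)
      (show 1 ≤ m + 1 ∧ m + 1 ≤ w.length by omega) h
    omega
  exists_prev := fun _ _ h => exists_prev_of_isCycle hw h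
  exists_next := fun _ _ h => exists_next_of_isCycle hw h

namespace IsSimpleDirected

variable {O : Fin n ⊕ J → Fin n ⊕ J → Prop} {u v : Fin n ⊕ J} {w : G.graph.Walk u v}
  (hw : IsSimpleDirected O w)
include hw

lemma fst_unique {a b c : Fin n ⊕ J} (h : G.WalkArc w a b) (h' : G.WalkArc w a c) : b = c := by
  obtain ⟨k, hk, rfl, rfl⟩ := (walkArc_iff w _ _).mp h
  obtain ⟨m, hm, e, rfl⟩ := (walkArc_iff w _ _).mp h'
  rw [hw.fst_injOn hk hm e]

lemma snd_unique {a b c : Fin n ⊕ J} (h : G.WalkArc w a c) (h' : G.WalkArc w b c) : a = b := by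
  obtain ⟨k, hk, rfl, rfl⟩ := (walkArc_iff w _ _).mp h
  obtain ⟨m, hm, rfl, e⟩ := (walkArc_iff w _ _).mp h'
  rw [hw.snd_injOn hk hm e]

end IsSimpleDirected

namespace GaugedGraph

variable (N : G.GaugedGraph)

/-- The oriented segments of a walk. -/
noncomputable def walkEdges {u v : Fin n ⊕ J} (w : G.graph.Walk u v) : Finset (ℂ × ℂ) :=
  (Finset.range w.length).image fun k => (N.pos (w.getVert k), N.pos (w.getVert (k + 1)))

variable {N}

lemma mem_walkEdges {u v : Fin n ⊕ J} {w : G.graph.Walk u v} {e : ℂ × ℂ} :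
    e ∈ N.walkEdges w ↔ ∃ a b, G.WalkArc w a b ∧ (N.pos a, N.pos b) = e := by
  simp only [walkEdges, Finset.mem_image, Finset.mem_range, walkArc_iff]
  constructor
  · rintro ⟨k, hk, rfl⟩
    exact ⟨_, _, ⟨k, hk, rfl, rfl⟩, rfl⟩
  · rintro ⟨a, b, ⟨k, hk, rfl, rfl⟩, rfl⟩
    exact ⟨k, hk, rfl⟩

lemma walkEdges_of_walkArc {u v : Fin n ⊕ J} {w : G.graph.Walk u v} {a b : Fin n ⊕ J}
    (h : G.WalkArc w a b) : (N.pos a, N.pos b) ∈ N.walkEdges w := mem_walkEdges.mpr ⟨a, b, h, rfl⟩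

lemma trace_eq_edgeTrace {u v : Fin n ⊕ J} (w : G.graph.Walk u v) :
    N.trace w = edgeTrace (N.walkEdges w) := by
  ext z
  simp only [trace, edgeTrace, mem_walkEdges, Set.mem_ofPred_eq]
  constructor
  · rintro ⟨a, b, h, hz⟩
    exact ⟨_, ⟨a, b, h, rfl⟩, hz⟩
  · rintro ⟨_, ⟨a, b, h, rfl⟩, hz⟩
    exact ⟨a, b, h, hz⟩

lemma im_nonneg (a : Fin n ⊕ J) : 0 ≤ (N.pos a).im := by
  rcases a with i | x
  · exact (N.drawing.boundary_real i).ge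
  · exact (N.drawing.internal_pos x).le

lemma im_pos_iff (a : Fin n ⊕ J) : 0 < (N.pos a).im ↔ ∃ x, a = Sum.inr x := by
  rcases a with i | x
  · simp [N.drawing.boundary_real i]
  · simp [N.drawing.internal_pos x]

lemma openSegment_upper {a b : Fin n ⊕ J} (h : G.graph.Adj a b) :
    openSegment ℝ (N.pos a) (N.pos b) ⊆ upperPlane := by
  rintro z ⟨s, t, hs, ht, -, rfl⟩
  change 0 < (s • N.pos a + t • N.pos b).im
  rw [Complex.add_im, Complex.smul_im, Complex.smul_im, smul_eq_mul, smul_eq_mul]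
  have ha := im_nonneg (N := N) a
  have hb := im_nonneg (N := N) b
  have : 0 < (N.pos a).im ∨ 0 < (N.pos b).im := by
    rcases a with i | x
    · rcases b with j | y
      · exact absurd h (G.boundary_not_adj i j)
      · exact Or.inr (N.drawing.internal_pos y)
    · exact Or.inl (N.drawing.internal_pos x)
  rcases this with h | h
  · nlinarith [mul_pos hs h, mul_nonneg ht.le hb]
  · nlinarith [mul_pos ht h, mul_nonneg hs.le ha]

/-- The segments of a simple directed walk form a simple curve, because the drawing has no
crossings. -/
lemma isSimpleCurve {u v : Fin n ⊕ J} {w : G.graph.Walk u v} (hw : IsSimpleDirected N.arc w) :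
    IsSimpleCurveInUpper (N.walkEdges w) where
  ne := by
    intro e he
    obtain ⟨a, b, h, rfl⟩ := mem_walkEdges.mp he
    exact fun hp => h.adj.ne (N.drawing.injective hp)
  disjoint := by
    intro e he e' he' hne
    obtain ⟨a, b, h, rfl⟩ := mem_walkEdges.mp he
    obtain ⟨c, d, h', rfl⟩ := mem_walkEdges.mp he'
    refine N.drawing.edges_disjoint a b c d h.adj h'.adj fun hs => ?_
    rcases Sym2.eq_iff.mp hs with ⟨rfl, rfl⟩ | ⟨rfl, rfl⟩
    · exact hne rfl
    · exact N.perfect.asymm _ _ (hw.directed _ _ h) (hw.directed _ _ h')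
  fst_notMem := by
    intro e he e' he'
    obtain ⟨a, b, h, rfl⟩ := mem_walkEdges.mp he
    obtain ⟨c, d, h', rfl⟩ := mem_walkEdges.mp he'
    exact N.drawing.vertex_not_on_edge a b c h.adj
  snd_notMem := by
    intro e he e' he'
    obtain ⟨a, b, h, rfl⟩ := mem_walkEdges.mp he
    obtain ⟨c, d, h', rfl⟩ := mem_walkEdges.mp he'
    exact N.drawing.vertex_not_on_edge a b d h.adj
  fst_inj := by
    intro e he e' he' hee
    obtain ⟨a, b, h, rfl⟩ := mem_walkEdges.mp he
    obtain ⟨c, d, h', rfl⟩ := mem_walkEdges.mp he'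
    obtain rfl := N.drawing.injective hee
    rw [hw.fst_unique h h']
  snd_inj := by
    intro e he e' he' hee
    obtain ⟨a, b, h, rfl⟩ := mem_walkEdges.mp he
    obtain ⟨c, d, h', rfl⟩ := mem_walkEdges.mp he'
    obtain rfl := N.drawing.injective hee
    rw [hw.snd_unique h h']
  connected := by
    intro P hP e he e' he' hPe
    have hstep : ∀ k, k + 1 < w.length →
        (P (N.pos (w.getVert k), N.pos (w.getVert (k + 1))) ↔
          P (N.pos (w.getVert (k + 1)), N.pos (w.getVert (k + 1 + 1)))) := fun k hk =>
      hP _ (Finset.mem_image_of_mem _ (Finset.mem_range.mpr (by omega))) _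
        (Finset.mem_image.mpr ⟨k + 1, Finset.mem_range.mpr hk, rfl⟩) rfl
    have hall : ∀ k, k < w.length → (P (N.pos (w.getVert 0), N.pos (w.getVert (0 + 1))) ↔
        P (N.pos (w.getVert k), N.pos (w.getVert (k + 1)))) := by
      intro k
      induction k with
      | zero => exact fun _ => Iff.rfl
      | succ k ih => exact fun hk => (ih (by omega)).trans (hstep k hk)
    obtain ⟨k, hk, rfl⟩ := Finset.mem_image.mp he
    obtain ⟨m, hm, rfl⟩ := Finset.mem_image.mp he'
    exact (hall m (Finset.mem_range.mp hm)).mp ((hall k (Finset.mem_range.mp hk)).mpr hPe)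
  upper := by
    intro e he
    obtain ⟨a, b, h, rfl⟩ := mem_walkEdges.mp he
    exact openSegment_upper h.adj
  not_real := by
    intro e he e' he' hee h0
    obtain ⟨a, b, h, rfl⟩ := mem_walkEdges.mp he
    obtain ⟨c, d, h', rfl⟩ := mem_walkEdges.mp he'
    obtain rfl := N.drawing.injective hee
    rcases b with i | x
    · exact N.perfect.not_boundary_through (hw.directed _ _ h) (hw.directed _ _ h')
    · exact (N.drawing.internal_pos x).ne' h0
  fst_im := by
    intro e he
    obtain ⟨a, b, h, rfl⟩ := mem_walkEdges.mp he
    exact im_nonneg a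
  snd_im := by
    intro e he
    obtain ⟨a, b, h, rfl⟩ := mem_walkEdges.mp he
    exact im_nonneg b
  exists_prev := by
    intro e he h0
    obtain ⟨a, b, h, rfl⟩ := mem_walkEdges.mp he
    obtain ⟨x, rfl⟩ := (im_pos_iff a).mp h0
    obtain ⟨c, hc⟩ := hw.exists_prev x b h
    exact ⟨_, walkEdges_of_walkArc hc, rfl⟩
  exists_next := by
    intro e he h0
    obtain ⟨a, b, h, rfl⟩ := mem_walkEdges.mp he
    obtain ⟨x, rfl⟩ := (im_pos_iff b).mp h0
    obtain ⟨c, hc⟩ := hw.exists_next x a h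
    exact ⟨_, walkEdges_of_walkArc hc, rfl⟩

/-- The boundary of a walk modulo 2 consists of its ends. -/
lemma sum_walkEdges {u v : Fin n ⊕ J} {w : G.graph.Walk u v} (hw : IsSimpleDirected N.arc w)
    (g : ℂ → ZMod 2) : ∑ e ∈ N.walkEdges w, (g e.1 + g e.2) = g (N.pos u) + g (N.pos v) := by
  rw [walkEdges, Finset.sum_image]
  · have key : ∀ m, ∑ k ∈ Finset.range m,
        (g (N.pos (w.getVert k)) + g (N.pos (w.getVert (k + 1)))) =
        g (N.pos (w.getVert 0)) + g (N.pos (w.getVert m)) := by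
      intro m
      induction m with
      | zero => rw [CharTwo.add_self_eq_zero, Finset.sum_range_zero]
      | succ m ih =>
        rw [Finset.sum_range_succ, ih]
        generalize g (N.pos (w.getVert 0)) = a
        generalize g (N.pos (w.getVert m)) = b
        generalize g (N.pos (w.getVert (m + 1))) = c
        revert a b c; decide
    rw [key, SimpleGraph.Walk.getVert_zero, SimpleGraph.Walk.getVert_length]
  · intro k hk m hm h
    simp only [Prod.mk.injEq] at h
    exact hw.fst_injOn (by simpa using hk) (by simpa using hm) (N.drawing.injective h.1)

lemma isEdgeBoundary_cycle {u : Fin n ⊕ J} {w : G.graph.Walk u u}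
    (hw : IsSimpleDirected N.arc w) : IsEdgeBoundary (N.walkEdges w) ∅ := fun g => by
  rw [sum_walkEdges hw, CharTwo.add_self_eq_zero, Finset.sum_empty]

/-- A reversible path is an arc from `b_i` to `b_j` through the open upper half-plane: its inner
vertices are internal, as no boundary vertex is both a source and a sink. -/
lemma isCuttingArc {i j : Fin n} {w : G.graph.Walk (Sum.inl i) (Sum.inl j)}
    (hw : N.IsReversiblePath i j w) :
    IsCuttingArc (N.walkEdges w) (N.pos (Sum.inl i)) (N.pos (Sum.inl j)) := by
  have hs : IsSimpleDirected N.arc w := IsSimpleDirected.of_isPath hw.2.2.1 hw.2.2.2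
  obtain ⟨⟨a, ha⟩, ⟨b, hb⟩, hp, hd⟩ := hw
  have hij : i ≠ j := by
    rintro rfl
    exact N.perfect.not_boundary_through hb ha
  have hpos : N.pos (Sum.inl i) ≠ N.pos (Sum.inl j) := fun h =>
    hij (Sum.inl_injective (N.drawing.injective h))
  have hlen : 0 < w.length := by
    rw [Nat.pos_iff_ne_zero]
    exact fun h => hij (Sum.inl_injective (SimpleGraph.Walk.eq_of_length_eq_zero h))
  have hfirst : G.WalkArc w (Sum.inl i) (w.getVert 1) :=
    (walkArc_iff w _ _).mpr ⟨0, hlen, by simp, rfl⟩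
  have hlast : G.WalkArc w (w.getVert (w.length - 1)) (Sum.inl j) :=
    (walkArc_iff w _ _).mpr ⟨w.length - 1, by omega, rfl, by
      rw [show w.length - 1 + 1 = w.length by omega, SimpleGraph.Walk.getVert_length]⟩
  refine { isSimpleCurve hs with
    start_real := N.drawing.boundary_real i
    end_real := N.drawing.boundary_real j
    start_ne_end := hpos
    real_mem := ?_
    exists_first := ⟨_, walkEdges_of_walkArc hfirst, rfl⟩
    snd_ne_start := ?_
    end_mem := (IsSimpleCurveInUpper.ends_mem_edgeTrace (walkEdges_of_walkArc hlast)).2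
    boundary := fun g => by rw [sum_walkEdges hs, Finset.sum_pair hpos] }
  · rintro x ⟨e, he, hx⟩ hx0
    obtain ⟨c, d, h, rfl⟩ := mem_walkEdges.mp he
    rw [← insert_endpoints_openSegment] at hx
    rcases hx with rfl | rfl | hx
    · left
      rcases c with k | y
      · by_contra hne
        obtain ⟨c, hc⟩ := exists_prev_of_ne h (fun h' => hne (by rw [h']))
        exact N.perfect.not_boundary_through (hd _ _ hc) (hd _ _ h)
      · exact absurd hx0 (N.drawing.internal_pos y).ne'
    · right
      rcases d with k | y
      · by_contra hne
        obtain ⟨c, hc⟩ := exists_next_of_ne h (fun h' => hne (by rw [h']))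
        exact N.perfect.not_boundary_through (hd _ _ h) (hd _ _ hc)
      · exact absurd hx0 (N.drawing.internal_pos y).ne'
    · exact absurd hx0 (ne_of_gt (openSegment_upper h.adj hx))
  · intro e he
    obtain ⟨c, d, h, rfl⟩ := mem_walkEdges.mp he
    intro hd'
    obtain rfl := N.drawing.injective hd'
    exact N.perfect.not_boundary_through (hd _ _ h) ha

end GaugedGraph

end PlabicGraph

/-! ### The marked regions of a reversed path or cycle -/

/-- The value `0` on the left (`s = 1`) and `1` on the right (`s = -1`). -/
noncomputable def sideShift (s : ℝ) : ZMod 2 := if s = 1 then 0 else 1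

lemma sideShift_one : sideShift 1 = 0 := if_pos rfl

lemma sideShift_neg_one : sideShift (-1) = 1 := if_neg (by norm_num)

lemma IsCuttingArc.crossCount_of_onSide {E : Finset (ℂ × ℂ)} {p q l : ℂ} (hE : IsCuttingArc E p q)
    (hl : 0 < l.im) {s : ℝ} (hs : s = 1 ∨ s = -1) {z : ℂ} (hz : OnSide E s z) :
    crossCount l E z = sideParity l (p - q) + sideShift s := by
  rcases hs with rfl | rfl
  · rw [sideShift_one, add_zero]; exact (hE.crossCount_onSide hl).1 z hz
  · rw [sideShift_neg_one]; exact (hE.crossCount_onSide hl).2 z hz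

lemma tendsto_germ (x d : ℂ) : Filter.Tendsto (fun τ : ℝ => x + (τ : ℂ) * d) (𝓝[>] 0) (𝓝 x) := by
  have : Continuous fun τ : ℝ => x + (τ : ℂ) * d := by fun_prop
  convert (this.tendsto 0).mono_left nhdsWithin_le_nhds using 2
  simp

lemma planeCross_self_germ (l : ℂ) (t s : ℝ) :
    planeCross l ((t : ℂ) * (s * (Complex.I * l))) = s * t * (l.re ^ 2 + l.im ^ 2) := by
  simp only [planeCross, Complex.mul_re, Complex.mul_im, Complex.ofReal_re,
    Complex.ofReal_im, Complex.I_re, Complex.I_im]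
  ring

namespace PlabicGraph

variable {n : ℕ} {J : Type*} {G : PlabicGraph n J}

namespace GaugedGraph

variable {N : G.GaugedGraph}

section Path

variable {i j : Fin n} {w : G.graph.Walk (Sum.inl i) (Sum.inl j)}

lemma pathDomain_eq : N.pathDomain i j w = upperPlane \ (edgeTrace (N.walkEdges w) ∪
    rayFrom N.ray (N.pos (Sum.inl i)) ∪ rayFrom N.ray (N.pos (Sum.inl j))) := by
  rw [pathDomain, trace_eq_edgeTrace]; rfl

lemma mem_pathDomain_iff {z : ℂ} : z ∈ N.pathDomain i j w ↔ 0 < z.im ∧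
    z ∉ edgeTrace (N.walkEdges w) ∧ planeCross N.ray (z - N.pos (Sum.inl i)) ≠ 0 ∧
    planeCross N.ray (z - N.pos (Sum.inl j)) ≠ 0 := by
  rw [pathDomain_eq]
  simp only [Set.mem_sdiff, Set.mem_union, not_or]
  constructor
  · rintro ⟨h1, ⟨h2, h3⟩, h4⟩
    rw [mem_rayFrom_iff N.gauge.inward (N.drawing.boundary_real i) h1] at h3
    rw [mem_rayFrom_iff N.gauge.inward (N.drawing.boundary_real j) h1] at h4
    exact ⟨h1, h2, h3, h4⟩
  · rintro ⟨h1, h2, h3, h4⟩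
    rw [Ne, ← mem_rayFrom_iff N.gauge.inward (N.drawing.boundary_real i) h1] at h3
    rw [Ne, ← mem_rayFrom_iff N.gauge.inward (N.drawing.boundary_real j) h1] at h4
    exact ⟨h1, ⟨h2, h3⟩, h4⟩

lemma isOpen_pathDomain : IsOpen (N.pathDomain i j w) := by
  have c : ∀ p : ℂ, Continuous fun z : ℂ => planeCross N.ray (z - p) := fun p => by
    unfold planeCross; fun_prop
  have : N.pathDomain i j w = upperPlane ∩ ((edgeTrace (N.walkEdges w))ᶜ ∩
      ({z | planeCross N.ray (z - N.pos (Sum.inl i)) ≠ 0} ∩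
        {z | planeCross N.ray (z - N.pos (Sum.inl j)) ≠ 0})) := by
    ext z
    rw [mem_pathDomain_iff]; rfl
  rw [this]
  exact isOpen_upperPlane.inter ((isCompact_edgeTrace _).isClosed.isOpen_compl.inter
    ((isOpen_ne_fun (c _) continuous_const).inter (isOpen_ne_fun (c _) continuous_const)))

lemma stripParity_eq_of_joinedIn {z z' : ℂ} (h : JoinedIn (N.pathDomain i j w) z z') :
    stripParity N.ray (N.pos (Sum.inl i)) (N.pos (Sum.inl j)) z =
      stripParity N.ray (N.pos (Sum.inl i)) (N.pos (Sum.inl j)) z' := by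
  refine eq_of_joinedIn (fun x hx => ?_) h
  obtain ⟨-, -, h1, h2⟩ := mem_pathDomain_iff.mp hx
  exact stripParity_eventuallyEq h1 h2

lemma pathDomain_subset : N.pathDomain i j w ⊆ {z : ℂ | 0 ≤ z.im} \ edgeTrace (N.walkEdges w) :=
  fun z hz => by
    obtain ⟨h1, h2, -, -⟩ := mem_pathDomain_iff.mp hz
    exact ⟨h1.le, h2⟩

lemma crossCount_eq_of_joinedIn_pathDomain (hw : N.IsReversiblePath i j w) {z z' : ℂ}
    (h : JoinedIn (N.pathDomain i j w) z z') :
    crossCount N.ray (N.walkEdges w) z = crossCount N.ray (N.walkEdges w) z' :=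
  (isCuttingArc hw).crossCount_eq_of_joinedIn N.gauge.inward (h.mono pathDomain_subset)

/-- A region adhering to the left or right side of a boundary arc has the same crossing and strip
parities as that arc. -/
lemma crossCount_of_adheres_real (hw : N.IsReversiblePath i j w) {z x d : ℂ} (hx : x.im = 0)
    (hxi : x ≠ N.pos (Sum.inl i)) (hxj : x ≠ N.pos (Sum.inl j))
    (h : Adheres (N.pathDomain i j w) z x d) :
    0 < d.im ∧ crossCount N.ray (N.walkEdges w) z =
      stripParity N.ray (N.pos (Sum.inl i)) (N.pos (Sum.inl j)) x := by
  have hA := isCuttingArc hw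
  have hl := N.gauge.inward
  have hxE : x ∉ edgeTrace (N.walkEdges w) := fun hm =>
    (hA.real_mem x hm hx).elim hxi hxj
  have ho : IsOpen (edgeTrace (N.walkEdges w))ᶜ := (isCompact_edgeTrace _).isClosed.isOpen_compl
  obtain ⟨ε, hε, hb⟩ := Metric.isOpen_iff.mp ho x hxE
  obtain ⟨τ, ⟨h1, h2⟩, h3⟩ := ((h.and ((tendsto_germ x d).eventually
    (Metric.ball_mem_nhds x hε))).and self_mem_nhdsWithin).exists
  have h3' : 0 < τ := h3
  have hyD := mem_pathDomain_iff.mp h1.target_mem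
  have hd : 0 < d.im := by
    have := hyD.1
    rw [Complex.add_im, Complex.im_ofReal_mul, hx, zero_add] at this
    exact (pos_iff_pos_of_mul_pos this).mp h3'
  refine ⟨hd, ?_⟩
  rw [crossCount_eq_of_joinedIn_pathDomain hw h1, ← hA.crossCount_real_eq hl hx hxi hxj]
  refine hA.crossCount_eq_of_joinedIn hl (JoinedIn.of_segment_subset fun u hu => ⟨?_, ?_⟩)
  · exact (convex_halfSpace_im_ge 0).segment_subset hyD.1.le hx.ge hu
  · exact hb ((convex_ball x ε).segment_subset h2 (Metric.mem_ball_self hε) hu)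

/-- A region adhering to the ray at the starting point of the path has on its left (right) the left
(right) value of the strip parity. -/
lemma stripParity_of_adheres_ray_start (hw : N.IsReversiblePath i j w) {z x : ℂ}
    (hx : x ∈ N.gaugeRay i) {s : ℝ} (hs : s = 1 ∨ s = -1)
    (h : Adheres (N.pathDomain i j w) z x (s * (Complex.I * N.ray))) :
    stripParity N.ray (N.pos (Sum.inl i)) (N.pos (Sum.inl j)) z =
      sideParity N.ray (N.pos (Sum.inl i) - N.pos (Sum.inl j)) + sideShift s := by
  have hl2 : 0 < N.ray.re ^ 2 + N.ray.im ^ 2 := by have := N.gauge.inward; positivity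
  have hpp := IsCuttingArc.planeCross_ne_zero N.gauge.inward (N.drawing.boundary_real i)
    (N.drawing.boundary_real j) (isCuttingArc hw).start_ne_end
  set p := N.pos (Sum.inl i) with hp
  set p' := N.pos (Sum.inl j) with hp'
  set l := N.ray with hlr
  obtain ⟨t, -, rfl⟩ := hx
  have hq : sideParity l (p + t * l - p') = sideParity l (p - p') := by
    have : planeCross l (p + t * l - p') = planeCross l (p - p') := by simp [planeCross]; ring
    unfold sideParity; rw [this]
  have hqn : planeCross l (p + t * l - p') ≠ 0 := by
    have : planeCross l (p + t * l - p') = planeCross l (p - p') := by simp [planeCross]; ring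
    rwa [this]
  have c : Filter.Tendsto (fun τ : ℝ => p + t * l + (τ : ℂ) * (s * (Complex.I * l)) - p') (𝓝[>] 0)
      (𝓝 (p + t * l - p')) := (tendsto_germ _ _).sub_const _
  obtain ⟨τ, ⟨h1, h2⟩, h3⟩ := ((h.and (c.eventually (sideParity_eventuallyEq hqn))).and
    self_mem_nhdsWithin).exists
  have h3' : 0 < τ := h3
  rw [stripParity_eq_of_joinedIn h1, stripParity, h2, hq, add_comm]
  congr 1
  have : planeCross l (p + t * l + (τ : ℂ) * (s * (Complex.I * l)) - p) =
      s * τ * (l.re ^ 2 + l.im ^ 2) := by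
    rw [← planeCross_self_germ]; simp [planeCross]; ring
  have hpos : 0 < τ * (l.re ^ 2 + l.im ^ 2) := mul_pos h3' hl2
  rcases hs with rfl | rfl
  · rw [sideShift_one, sideParity_of_pos (by rw [this]; linarith)]
  · rw [sideShift_neg_one, sideParity_of_neg (by rw [this]; linarith)]

/-- The same for the ray at the end of the path, which is oriented downwards. -/
lemma stripParity_of_adheres_ray_end (hw : N.IsReversiblePath i j w) {z x : ℂ}
    (hx : x ∈ N.gaugeRay j) {s : ℝ} (hs : s = 1 ∨ s = -1)
    (h : Adheres (N.pathDomain i j w) z x (s * (Complex.I * -N.ray))) :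
    stripParity N.ray (N.pos (Sum.inl i)) (N.pos (Sum.inl j)) z =
      sideParity N.ray (N.pos (Sum.inl i) - N.pos (Sum.inl j)) + sideShift s := by
  have hl2 : 0 < N.ray.re ^ 2 + N.ray.im ^ 2 := by have := N.gauge.inward; positivity
  have hpp := IsCuttingArc.planeCross_ne_zero N.gauge.inward (N.drawing.boundary_real i)
    (N.drawing.boundary_real j) (isCuttingArc hw).start_ne_end
  set p := N.pos (Sum.inl i) with hp
  set p' := N.pos (Sum.inl j) with hp'
  set l := N.ray with hlr
  obtain ⟨t, -, rfl⟩ := hx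
  have hq : sideParity l (p' + t * l - p) = sideParity l (p - p') + 1 := by
    have : planeCross l (p' + t * l - p) = planeCross l (-(p - p')) := by
      simp [planeCross]; ring
    rw [← sideParity_neg hpp]
    unfold sideParity; rw [this]
  have hqn : planeCross l (p' + t * l - p) ≠ 0 := by
    have : planeCross l (p' + t * l - p) = - planeCross l (p - p') := by simp [planeCross]; ring
    rw [this]; exact neg_ne_zero.mpr hpp
  have c : Filter.Tendsto (fun τ : ℝ => p' + t * l + (τ : ℂ) * (s * (Complex.I * -l)) - p) (𝓝[>] 0)
      (𝓝 (p' + t * l - p)) := (tendsto_germ _ _).sub_const _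
  obtain ⟨τ, ⟨h1, h2⟩, h3⟩ := ((h.and (c.eventually (sideParity_eventuallyEq hqn))).and
    self_mem_nhdsWithin).exists
  have h3' : 0 < τ := h3
  rw [stripParity_eq_of_joinedIn h1, stripParity, h2, hq, add_assoc]
  congr 1
  have : planeCross l (p' + t * l + (τ : ℂ) * (s * (Complex.I * -l)) - p') =
      - (s * τ * (l.re ^ 2 + l.im ^ 2)) := by
    rw [← planeCross_self_germ]; simp [planeCross]; ring
  have hpos : 0 < τ * (l.re ^ 2 + l.im ^ 2) := mul_pos h3' hl2
  rcases hs with rfl | rfl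
  · rw [sideShift_one, sideParity_of_neg (by rw [this]; linarith)]; decide
  · rw [sideShift_neg_one, sideParity_of_pos (by rw [this]; linarith), add_zero]

/-- A region lying on the left (right) of one of the curves that bound the regions has the left
(right) value of the crossing count of the path, or of the strip parity. -/
lemma value_of_adheres_curve (hw : N.IsReversiblePath i j w) {z : ℂ} {q : ℂ × ℂ}
    (hq : q ∈ N.pathCurves i j w) {s : ℝ} (hs : s = 1 ∨ s = -1)
    (h : Adheres (N.pathDomain i j w) z q.1 (s * (Complex.I * q.2))) :
    crossCount N.ray (N.walkEdges w) z =
        sideParity N.ray (N.pos (Sum.inl i) - N.pos (Sum.inl j)) + sideShift s ∨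
      stripParity N.ray (N.pos (Sum.inl i)) (N.pos (Sum.inl j)) z =
        sideParity N.ray (N.pos (Sum.inl i) - N.pos (Sum.inl j)) + sideShift s := by
  have hA := isCuttingArc hw
  have hl := N.gauge.inward
  have hpi := N.drawing.boundary_real i
  have hpj := N.drawing.boundary_real j
  obtain ⟨x, d⟩ := q
  set p := N.pos (Sum.inl i) with hp
  set p' := N.pos (Sum.inl j) with hp'
  set l := N.ray with hlr
  have hre : (p - p').re ≠ 0 := fun h0 => hA.start_ne_end
    (Complex.ext (by simpa [sub_eq_zero] using h0) (hpi.trans hpj.symm))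
  have hppi : (p - p').im = 0 := by rw [Complex.sub_im, hpi, hpj, sub_zero]
  rcases hq with ((((⟨a, b, hab, hx, hd⟩ | ⟨hx, hd⟩) | ⟨hx, hd⟩) | ⟨hx, hd⟩) | ⟨hx, hx', hd⟩)
  · left
    simp only at hx hd h
    subst hd
    obtain ⟨τ, h1, -, h2⟩ := (h.and (hA.eventually_onSide hs (walkEdges_of_walkArc hab) hx)).exists
    rw [crossCount_eq_of_joinedIn_pathDomain hw h1]
    exact hA.crossCount_of_onSide hl hs h2
  · right
    simp only at hx hd h
    subst hd
    exact stripParity_of_adheres_ray_start hw hx hs h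
  · right
    simp only at hx hd h
    subst hd
    exact stripParity_of_adheres_ray_end hw hx hs h
  · left
    simp only at hx hd h
    obtain ⟨a, b, ha, hb, hab, rfl⟩ := hx
    have hxi0 : (a • p' + b • p).im = 0 := by simp [hpi, hpj]
    have e1 : ((a • p' + b • p) - p).re = -(a * (p - p').re) := by
      obtain rfl : b = 1 - a := by linarith
      simp; ring
    have e2 : ((a • p' + b • p) - p').re = b * (p - p').re := by
      obtain rfl : a = 1 - b := by linarith
      simp; ring
    have i1 : ((a • p' + b • p) - p).im = 0 := by rw [Complex.sub_im, hxi0, hpi, sub_zero]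
    have i2 : ((a • p' + b • p) - p').im = 0 := by rw [Complex.sub_im, hxi0, hpj, sub_zero]
    have n1 : a • p' + b • p ≠ p := fun h0 => by
      rw [h0, sub_self] at e1
      exact mul_ne_zero ha.ne' hre (by simpa using e1.symm)
    have n2 : a • p' + b • p ≠ p' := fun h0 => by
      rw [h0, sub_self] at e2
      exact mul_ne_zero hb.ne' hre (by simpa using e2.symm)
    obtain ⟨hdim, hcc⟩ := crossCount_of_adheres_real hw hxi0 n1 n2 h
    rw [hcc, stripParity]
    have hdim' : 0 < s * (p - p').re := by
      rw [hd] at hdim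
      simpa [vec, hp, hp'] using hdim
    rcases hs with rfl | rfl
    · have h0 : 0 < (p - p').re := by linarith
      rw [sideShift_one, add_zero, sideParity_real_pos hl hppi h0,
        sideParity_real_neg hl i1 (by rw [e1]; nlinarith),
        sideParity_real_pos hl i2 (by rw [e2]; positivity), zero_add]
    · have h0 : (p - p').re < 0 := by linarith
      rw [sideShift_neg_one, sideParity_real_neg hl hppi h0,
        sideParity_real_pos hl i1 (by rw [e1]; nlinarith),
        sideParity_real_neg hl i2 (by rw [e2]; nlinarith), zero_add, add_zero]
  · left
    simp only at hx hx' hd h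
    have n1 : x ≠ p := fun h0 => hx' (h0 ▸ right_mem_segment ℝ _ _)
    have n2 : x ≠ p' := fun h0 => hx' (h0 ▸ left_mem_segment ℝ _ _)
    obtain ⟨hdim, hcc⟩ := crossCount_of_adheres_real hw hx n1 n2 h
    have hdim' : s * (p - p').re < 0 := by
      rw [hd] at hdim
      have h2 : 0 < s * (p' - p).re := by simpa [vec, hp, hp'] using hdim
      have h3 : (p' - p).re = -(p - p').re := by simp
      rw [h3] at h2; linarith
    -- outside of the segment both ends are on the same side
    have hsame : 0 < (x - p).re * (x - p').re := by
      by_contra hc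
      refine hx' ?_
      have hc' : (x - p).re * (x - p').re ≤ 0 := not_lt.mp hc
      have e : (p - p').re = (x - p').re - (x - p).re := by simp
      have key : 0 ≤ (x - p').re / (p - p').re ∧ 0 ≤ -(x - p).re / (p - p').re := by
        rcases lt_or_gt_of_ne hre with h0 | h0
        · have a1 : (x - p').re ≤ 0 := by by_contra! hh; nlinarith
          have a2 : 0 ≤ (x - p).re := by by_contra! hh; nlinarith
          exact ⟨div_nonneg_of_nonpos a1 h0.le, div_nonneg_of_nonpos (by linarith) h0.le⟩
        · have a1 : 0 ≤ (x - p').re := by by_contra! hh; nlinarith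
          have a2 : (x - p).re ≤ 0 := by by_contra! hh; nlinarith
          exact ⟨div_nonneg a1 h0.le, div_nonneg (by linarith) h0.le⟩
      refine ⟨-(x - p).re / (p - p').re, (x - p').re / (p - p').re, key.2, key.1, ?_, ?_⟩
      · rw [← add_div, e]
        rw [div_eq_one_iff_eq (by rw [← e]; exact hre)]; ring
      · apply Complex.ext
        · simp only [Complex.add_re, Complex.smul_re, smul_eq_mul]
          field_simp
          simp only [Complex.sub_re]
          ring
        · simp only [Complex.add_im, Complex.smul_im, smul_eq_mul]
          rw [← hp, ← hp', hpi, hpj, hx]; simp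
    have i1 : (x - p).im = 0 := by rw [Complex.sub_im, hx, hpi, sub_zero]
    have i2 : (x - p').im = 0 := by rw [Complex.sub_im, hx, hpj, sub_zero]
    have hS : stripParity l p p' x = 0 := by
      rw [stripParity]
      rcases lt_or_ge 0 (x - p).re with h0 | h0
      · rw [sideParity_real_pos hl i1 h0,
          sideParity_real_pos hl i2 ((pos_iff_pos_of_mul_pos hsame).mp h0)]; decide
      · have h0' : (x - p).re < 0 := lt_of_le_of_ne h0 fun hh => by
          rw [hh, zero_mul] at hsame
          exact lt_irrefl _ hsame
        rw [sideParity_real_neg hl i1 h0',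
          sideParity_real_neg hl i2 ((neg_iff_neg_of_mul_pos hsame).mp h0')]; decide
    rw [hcc, hS]
    rcases hs with rfl | rfl
    · rw [sideShift_one, sideParity_real_neg hl hppi (by linarith)]; decide
    · rw [sideShift_neg_one, sideParity_real_pos hl hppi (by linarith)]; decide

/-- A point is marked `-` if it lies on different sides of the path and of the pair of rays. -/
lemma mem_pathMinus_iff (hw : N.IsReversiblePath i j w) {z : ℂ} :
    z ∈ N.pathMinus i j w ↔ z ∈ N.pathDomain i j w ∧ crossCount N.ray (N.walkEdges w) z ≠
      stripParity N.ray (N.pos (Sum.inl i)) (N.pos (Sum.inl j)) z := by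
  have hA := isCuttingArc hw
  have hl := N.gauge.inward
  have hconv : ∀ (hz : z ∈ N.pathDomain i j w) (x d : ℂ) (s : ℝ),
      Adheres (N.pathDomain i j w) z x (s * (Complex.I * d)) ↔
      ∀ᶠ t : ℝ in 𝓝[>] 0, x + t * (s * (Complex.I * d)) ∈
        connectedComponentIn (N.pathDomain i j w) z := by
    intro hz x d s
    simp only [Adheres, mem_connectedComponentIn_iff_joinedIn isOpen_pathDomain hz]
  have hplus : ∀ x d t : ℂ, x + t * (((1 : ℝ) : ℂ) * (Complex.I * d)) = x + t * (Complex.I * d) :=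
      by
    intro x d t; simp
  have hminus : ∀ x d t : ℂ, x + t * (((-1 : ℝ) : ℂ) * (Complex.I * d)) =
      x - t * (Complex.I * d) := by
    intro x d t; simp; ring
  simp only [pathMinus, Set.mem_ofPred_eq]
  refine and_congr_right fun hz => ?_
  rw [BoundaryOriented, not_not]
  -- If the two parities agree, each curve bounding the region is on the same side of it.
  -- Otherwise the region adheres to the path and to one of the rays, on different sides.
  constructor
  · rintro ⟨⟨q, hq, h1⟩, ⟨q', hq', h2⟩⟩ heq
    have v1 := value_of_adheres_curve hw hq (Or.inl rfl) (by
      rw [hconv hz]; simpa only [hplus] using h1)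
    have v2 := value_of_adheres_curve hw hq' (Or.inr rfl) (by
      rw [hconv hz]; simpa only [hminus] using h2)
    rw [heq, or_self, sideShift_one, add_zero] at v1
    rw [heq, or_self, sideShift_neg_one, v1] at v2
    simp at v2
  · intro hne
    have hzD := hz
    rw [pathDomain_eq] at hzD
    obtain ⟨s, hs, e, he, x, hx, ha⟩ := hA.exists_adheres_arc hl hzD hne
    obtain ⟨s', hs', y, hy, hb⟩ := hA.exists_adheres_ray hl hzD hne
    rw [← pathDomain_eq] at ha hb
    obtain ⟨a, b, hab, rfl⟩ := mem_walkEdges.mp he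
    have hcurve : (x, N.pos b - N.pos a) ∈ N.pathCurves i j w :=
      Or.inl (Or.inl (Or.inl (Or.inl ⟨a, b, hab, hx, rfl⟩)))
    -- the arc is touched on the side given by the crossing count
    have v1 : crossCount N.ray (N.walkEdges w) z =
        sideParity N.ray (N.pos (Sum.inl i) - N.pos (Sum.inl j)) + sideShift s := by
      obtain ⟨τ, h1, -, h2⟩ := (ha.and (hA.eventually_onSide hs he hx)).exists
      rw [crossCount_eq_of_joinedIn_pathDomain hw h1]
      exact hA.crossCount_of_onSide hl hs h2
    -- and a ray on the other side
    obtain ⟨d, s'', hs'', hcurve', hb', v2⟩ : ∃ d : ℂ, ∃ s'' : ℝ, (s'' = 1 ∨ s'' = -1) ∧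
        (y, d) ∈ N.pathCurves i j w ∧
        Adheres (N.pathDomain i j w) z y (s'' * (Complex.I * d)) ∧
        s'' ≠ s := by
      obtain ⟨d, s'', hs'', hcurve', hb', hval⟩ : ∃ d : ℂ, ∃ s'' : ℝ, (s'' = 1 ∨ s'' = -1) ∧
          (y, d) ∈ N.pathCurves i j w ∧
          Adheres (N.pathDomain i j w) z y (s'' * (Complex.I * d)) ∧
          stripParity N.ray (N.pos (Sum.inl i)) (N.pos (Sum.inl j)) z =
            sideParity N.ray (N.pos (Sum.inl i) - N.pos (Sum.inl j)) + sideShift s'' := by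
        rcases hy with hy | hy
        · exact ⟨N.ray, s', hs', Or.inl (Or.inl (Or.inl (Or.inr ⟨hy, rfl⟩))), hb,
            stripParity_of_adheres_ray_start hw hy hs' hb⟩
        · have hn : -s' = 1 ∨ -s' = -1 := by rcases hs' with rfl | rfl <;> simp
          have hb' : Adheres (N.pathDomain i j w) z y ((-s' : ℝ) * (Complex.I * -N.ray)) := by
            convert hb using 1
            push_cast; ring
          exact ⟨-N.ray, -s', hn, Or.inl (Or.inl (Or.inr ⟨hy, rfl⟩)), hb',
            stripParity_of_adheres_ray_end hw hy hn hb'⟩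
      refine ⟨d, s'', hs'', hcurve', hb', ?_⟩
      rintro rfl
      exact hne (v1.trans hval.symm)
    have hleft : ∀ {x d : ℂ}, Adheres (N.pathDomain i j w) z x ((1 : ℝ) * (Complex.I * d)) →
        ∀ᶠ t : ℝ in 𝓝[>] 0, x + t * (Complex.I * d) ∈
          connectedComponentIn (N.pathDomain i j w) z := fun {x d} h => by
      simpa only [hplus] using (hconv hz x d 1).mp h
    have hright : ∀ {x d : ℂ}, Adheres (N.pathDomain i j w) z x ((-1 : ℝ) * (Complex.I * d)) →
        ∀ᶠ t : ℝ in 𝓝[>] 0, x - t * (Complex.I * d) ∈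
          connectedComponentIn (N.pathDomain i j w) z := fun {x d} h => by
      simpa only [hminus] using (hconv hz x d (-1)).mp h
    rcases hs with rfl | rfl
    · have : s'' = -1 := hs''.resolve_left v2
      subst this
      exact ⟨⟨_, hcurve, hleft ha⟩, ⟨_, hcurve', hright hb'⟩⟩
    · have : s'' = 1 := hs''.resolve_right v2
      subst this
      exact ⟨⟨_, hcurve', hleft hb'⟩, ⟨_, hcurve, hright ha⟩⟩

end Path

end GaugedGraph

end PlabicGraph

/-! ### The signature modulo 2 as a sum over half-edges -/

/-- Consecutive edges of a drawing do not overlap, hence are not antiparallel. -/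
lemma zero_notMem_segment_of_drawing {a b c : ℂ} (hab : a ≠ b) (hbc : b ≠ c) (hac : a ≠ c)
    (h1 : a ∉ openSegment ℝ b c) (h2 : c ∉ openSegment ℝ b a) :
    (0 : ℂ) ∉ segment ℝ (b - a) (c - b) := by
  rintro ⟨s, t, hs, ht, hst, h⟩
  have hs' : 0 < s := by
    refine lt_of_le_of_ne hs fun h0 => ?_
    subst h0
    obtain rfl : t = 1 := by linarith
    rw [zero_smul, zero_add, one_smul] at h
    exact hbc (sub_eq_zero.mp h).symm
  have ht' : 0 < t := by
    refine lt_of_le_of_ne ht fun h0 => ?_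
    subst h0
    obtain rfl : s = 1 := by linarith
    rw [zero_smul, add_zero, one_smul] at h
    exact hab (sub_eq_zero.mp h).symm
  have key : s • (a - b) = t • (c - b) := by
    rw [smul_sub, smul_sub] at *
    linear_combination (exp := 1) -h
  rcases lt_trichotomy s t with hlt | rfl | hlt
  · refine h2 ?_
    rw [openSegment_eq_image']
    refine ⟨s / t, ⟨by positivity, (div_lt_one ht').mpr hlt⟩, ?_⟩
    beta_reduce
    rw [div_eq_inv_mul, mul_smul, key, smul_smul, inv_mul_cancel₀ ht'.ne', one_smul]; ring
  · exact hac (by simpa using smul_right_injective ℂ hs'.ne' key)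
  · refine h1 ?_
    rw [openSegment_eq_image']
    refine ⟨t / s, ⟨by positivity, (div_lt_one hs').mpr hlt⟩, ?_⟩
    beta_reduce
    rw [div_eq_inv_mul, mul_smul, ← key, smul_smul, inv_mul_cancel₀ hs'.ne', one_smul]; ring

lemma sideParity_zero (l : ℂ) : sideParity l 0 = 0 := by simp [sideParity, planeCross]

namespace PlabicGraph

variable {n : ℕ} {J : Type*} {G : PlabicGraph n J}

lemma IsDrawing.zero_notMem_segment {p : Fin n ⊕ J → ℂ} (hp : G.IsDrawing p) {u v w : Fin n ⊕ J}
    (huv : G.graph.Adj u v) (hvw : G.graph.Adj v w) (huw : u ≠ w) :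
    (0 : ℂ) ∉ segment ℝ (p v - p u) (p w - p v) :=
  zero_notMem_segment_of_drawing (fun h => huv.ne (hp.injective h))
    (fun h => hvw.ne (hp.injective h)) (fun h => huw (hp.injective h))
    (hp.vertex_not_on_edge v w u hvw) (hp.vertex_not_on_edge v u w huv.symm)

namespace GaugedGraph

variable (N : G.GaugedGraph)

lemma arc_adj {u v : Fin n ⊕ J} (h : N.arc u v) : G.graph.Adj u v := N.perfect.adj h

lemma ray_ne_zero : N.ray ≠ 0 := ne_zero_of_im_pos N.gauge.inward

lemma vec_ne_zero {u v : Fin n ⊕ J} (h : G.graph.Adj u v) : N.vec u v ≠ 0 :=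
  sub_ne_zero.mpr fun h' => h.ne (N.drawing.injective h').symm

lemma vec_swap (u v : Fin n ⊕ J) : N.vec v u = - N.vec u v := by simp [vec]

lemma vec_not_parallel {u v : Fin n ⊕ J} (h : G.graph.Adj u v) : planeCross N.ray (N.vec u v) ≠ 0 :=
  N.gauge.not_parallel u v h

lemma vec_zero_notMem {u v w : Fin n ⊕ J} (huv : G.graph.Adj u v) (hvw : G.graph.Adj v w)
    (huw : u ≠ w) : (0 : ℂ) ∉ segment ℝ (N.vec u v) (N.vec v w) :=
  N.drawing.zero_notMem_segment huv hvw huw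

lemma wind_cast {u v w : Fin n ⊕ J} (huv : G.graph.Adj u v) (hvw : G.graph.Adj v w)
    (huw : u ≠ w) : (N.wind u v w : ZMod 2) = crossParity N.ray (N.vec u v) (N.vec v w) :=
  windingNumber_cast N.ray_ne_zero (N.vec_not_parallel huv) (N.vec_not_parallel hvw)
    (N.vec_zero_notMem huv hvw huw)

lemma incoming_spec {x : J} (hx : G.colour x = VertexColour.white) :
    N.arc (N.incoming x) (Sum.inr x) := by
  obtain ⟨u, hu, -⟩ := N.perfect.white x hx
  exact Classical.epsilon_spec_aux _ (fun u => N.arc u (Sum.inr x)) ⟨u, hu⟩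

lemma incoming_eq {x : J} (hx : G.colour x = VertexColour.white) {u : Fin n ⊕ J}
    (h : N.arc u (Sum.inr x)) : N.incoming x = u :=
  (N.perfect.white x hx).unique (N.incoming_spec hx) h

lemma outgoing_spec {x : J} (hx : G.colour x = VertexColour.black) :
    N.arc (Sum.inr x) (N.outgoing x) := by
  obtain ⟨u, hu, -⟩ := N.perfect.black x hx
  exact Classical.epsilon_spec_aux _ (fun u => N.arc (Sum.inr x) u) ⟨u, hu⟩

lemma outgoing_eq {x : J} (hx : G.colour x = VertexColour.black) {u : Fin n ⊕ J}
    (h : N.arc (Sum.inr x) u) : N.outgoing x = u :=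
  (N.perfect.black x hx).unique (N.outgoing_spec hx) h

open Classical in
/-- The number modulo 2 of the gauge rays from the sources that have the vertex `v` on their
right. -/
noncomputable def sideSum (v : Fin n ⊕ J) : ZMod 2 :=
  ∑ k, if N.IsSource k then sideParity N.ray (N.vec (Sum.inl k) v) else 0

open Classical in
/-- The contribution of the end `v` of the edge `vu` to the signature of this edge: the terms at
a white or black vertex are those of the definition of the signature. At a boundary source the
term `sideParity` makes up for the gauge ray that starts at this source and does not cross the
edge. -/
noncomputable def halfEdge : Fin n ⊕ J → Fin n ⊕ J → ZMod 2
  | Sum.inl k, u => if N.arc (Sum.inl k) u then 1 + sideParity N.ray (N.vec (Sum.inl k) u) else 0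
  | Sum.inr x, u =>
      match G.colour x with
      | VertexColour.white =>
          if N.arc (Sum.inr x) u then 1 + (N.wind (N.incoming x) (Sum.inr x) u : ZMod 2) else 0
      | VertexColour.black =>
          if N.arc (Sum.inr x) u then 0 else (N.wind u (Sum.inr x) (N.outgoing x) : ZMod 2)

lemma pos_not_on_ray {k : Fin n} {v : Fin n ⊕ J} (h : v ≠ Sum.inl k) :
    planeCross N.ray (N.vec (Sum.inl k) v) ≠ 0 := by
  rcases v with m | x
  · exact IsCuttingArc.planeCross_ne_zero N.gauge.inward (N.drawing.boundary_real m)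
      (N.drawing.boundary_real k) fun h' => h (N.drawing.injective h')
  · intro h0
    rw [vec, ← mem_rayFrom_iff N.gauge.inward (N.drawing.boundary_real k)
      (N.drawing.internal_pos x)] at h0
    obtain ⟨t, ht, e⟩ := h0
    exact N.gauge.ray_avoids k x t ht.le e

open Classical in
/-- A gauge ray crosses an edge if the ends of the edge are on different sides of it. -/
lemma gaugeRay_inter_iff {k : Fin n} {u v : Fin n ⊕ J} (h : G.graph.Adj u v)
    (hv : v ≠ Sum.inl k) :
    (if (N.gaugeRay k ∩ segment ℝ (N.pos u) (N.pos v)).Nonempty then 1 else 0 : ZMod 2) =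
      sideParity N.ray (N.vec (Sum.inl k) u) + sideParity N.ray (N.vec (Sum.inl k) v) +
        if u = Sum.inl k then sideParity N.ray (N.vec u v) else 0 := by
  have hlin : ∀ a b : ℝ, a + b = 1 → planeCross N.ray (a • N.pos u + b • N.pos v
      - N.pos (Sum.inl k)) = a * planeCross N.ray (N.vec (Sum.inl k) u) +
        b * planeCross N.ray (N.vec (Sum.inl k) v) := by
    intro a b hab
    obtain rfl : a = 1 - b := by linarith
    simp [planeCross, vec]; ring
  have hray : ∀ z ∈ N.gaugeRay k, planeCross N.ray (z - N.pos (Sum.inl k)) = 0 := by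
    rintro _ ⟨t, -, rfl⟩
    simp [planeCross]; ring
  have hB := N.pos_not_on_ray hv
  by_cases hu : u = Sum.inl k
  · subst hu
    rw [if_pos rfl, if_neg, vec, sub_self, sideParity_zero, zero_add, CharTwo.add_self_eq_zero]
    rintro ⟨z, hz, a, b, ha, hb, hab, rfl⟩
    have h1 := hlin a b hab
    rw [hray _ hz, vec, sub_self, show planeCross N.ray 0 = 0 by simp [planeCross], mul_zero,
      zero_add] at h1
    have hb0 : b = 0 := (mul_eq_zero.mp h1.symm).resolve_right hB
    subst hb0
    obtain ⟨t, ht, e⟩ := hz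
    have ha1 : a = 1 := by linarith
    simp [ha1] at e
    exact e.elim ht.ne' N.ray_ne_zero
  · have hA := N.pos_not_on_ray hu
    rw [if_neg hu, add_zero, sideParity, sideParity]
    by_cases hs : 0 < planeCross N.ray (N.vec (Sum.inl k) u) * planeCross N.ray (N.vec (Sum.inl k)
        v)
    · rw [if_neg]
      · by_cases h1 : planeCross N.ray (N.vec (Sum.inl k) u) < 0
        · rw [if_pos h1, if_pos ((neg_iff_neg_of_mul_pos hs).mp h1)]; decide
        · rw [if_neg h1, if_neg (mt (neg_iff_neg_of_mul_pos hs).mpr h1)]; decide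
      · rintro ⟨z, hz, a, b, ha, hb, hab, rfl⟩
        have h1 := hlin a b hab
        rw [hray _ hz] at h1
        have h2 : a * planeCross N.ray (N.vec (Sum.inl k) u) ^ 2 +
            b * (planeCross N.ray (N.vec (Sum.inl k) u) *
              planeCross N.ray (N.vec (Sum.inl k) v)) = 0 := by
          linear_combination (-planeCross N.ray (N.vec (Sum.inl k) u)) * h1
        have h3 : 0 < planeCross N.ray (N.vec (Sum.inl k) u) ^ 2 := by positivity
        rcases ha.lt_or_eq with h4 | h4
        · nlinarith [mul_pos h4 h3, mul_nonneg hb hs.le]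
        · obtain rfl : b = 1 := by linarith
          rw [← h4] at h2; linarith
    · have hs' : planeCross N.ray (N.vec (Sum.inl k) u) * planeCross N.ray (N.vec (Sum.inl k) v) <
          0 :=
        lt_of_le_of_ne (not_lt.mp hs) (mul_ne_zero hA hB)
      rw [if_pos]
      · rcases lt_or_gt_of_ne hA with h1 | h1
        · rw [if_pos h1, if_neg (by nlinarith)]; decide
        · rw [if_neg h1.not_gt, if_pos (by nlinarith)]; decide
      · -- the point where the affine function vanishes
        set A := planeCross N.ray (N.vec (Sum.inl k) u)
        set B := planeCross N.ray (N.vec (Sum.inl k) v)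
        obtain ⟨a, b, ha, hb, hab, h0⟩ : ∃ a b : ℝ, 0 < a ∧ 0 < b ∧ a + b = 1 ∧
            a * A + b * B = 0 := by
          rcases lt_or_gt_of_ne hA with h1 | h1
          · have h2 : 0 < B := by nlinarith
            refine ⟨B / (B - A), -A / (B - A), div_pos h2 (by linarith),
              div_pos (by linarith) (by linarith), ?_, ?_⟩
            · rw [← add_div]; exact div_self (by linarith)
            · ring
          · have h2 : B < 0 := by nlinarith
            refine ⟨-B / (A - B), A / (A - B), div_pos (by linarith) (by linarith),
              div_pos h1 (by linarith), ?_, ?_⟩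
            · rw [← add_div, neg_add_eq_sub]; exact div_self (by linarith)
            · ring
        have hz : a • N.pos u + b • N.pos v ∈ openSegment ℝ (N.pos u) (N.pos v) :=
          ⟨a, b, ha, hb, hab, rfl⟩
        refine ⟨_, ?_, openSegment_subset_segment _ _ _ hz⟩
        refine (mem_rayFrom_iff N.gauge.inward (N.drawing.boundary_real k)
          (openSegment_upper h hz)).mpr ?_
        rw [hlin a b hab, h0]

lemma orientSign_cast {f g : ℂ} (h : planeCross f g ≠ 0) : ((orientSign f g : ℤ) : ZMod 2) = 1 := by
  rcases lt_or_gt_of_ne h with h | h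
  · rw [orientSign_eq_neg_one h]; decide
  · rw [orientSign_eq_one h]; decide

/-- The gauge rays crossing an edge are counted by `sideSum` at its ends, except for the ray
starting at an end of the edge, which is not to be counted. -/
lemma intersectionNumber_cast {u v : Fin n ⊕ J} (h : N.arc u v) :
    (N.intersectionNumber u v : ZMod 2) = N.sideSum u + N.sideSum v +
      match u with
      | Sum.inl k => sideParity N.ray (N.vec (Sum.inl k) v)
      | Sum.inr _ => 0 := by
  classical
  rw [intersectionNumber, Int.cast_mul, orientSign_cast (N.vec_not_parallel (N.arc_adj h)), mul_one,
    Set.ncard_eq_toFinset_card', Int.cast_natCast, Finset.cast_card, Set.toFinset_ofPred,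
    Finset.sum_filter, sideSum, sideSum, ← Finset.sum_add_distrib]
  have hsrc : ∀ k, N.IsSource k → v ≠ Sum.inl k := by
    rintro k ⟨b, hb⟩ rfl
    exact N.perfect.not_boundary_through h hb
  have hlast : (match u with
      | Sum.inl k => sideParity N.ray (N.vec (Sum.inl k) v)
      | Sum.inr _ => 0) =
      ∑ k, if N.IsSource k then (if u = Sum.inl k then sideParity N.ray (N.vec u v) else 0) else 0
          := by
    rcases u with m | x
    · rw [Finset.sum_eq_single m]
      · rw [if_pos ⟨v, h⟩, if_pos rfl]
      · intro k _ hk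
        rw [if_neg (c := Sum.inl m = Sum.inl k) (fun h' => hk (Sum.inl_injective h').symm),
            ite_self]
      · simp
    · simp
  rw [hlast, ← Finset.sum_add_distrib]
  refine Finset.sum_congr rfl fun k _ => ?_
  by_cases hk : N.IsSource k
  · simp only [hk, true_and, if_true]
    exact N.gaugeRay_inter_iff (N.arc_adj h) (hsrc k hk)
  · simp [hk]

lemma signature_comm (u v : Fin n ⊕ J) (h : G.graph.Adj u v) :
    N.signature u v = N.signature v u := by
  unfold signature
  rcases (N.perfect.adj_iff u v).mp h with h | h
  · rw [if_pos h, if_neg (N.perfect.asymm _ _ h)]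
  · rw [if_pos h, if_neg (N.perfect.asymm _ _ h)]

lemma signature_eq_of_arc {u v : Fin n ⊕ J} (h : N.arc u v) :
    N.signature u v = N.sideSum u + N.sideSum v + N.halfEdge u v + N.halfEdge v u := by
  have hn := N.perfect.asymm _ _ h
  have hi := N.intersectionNumber_cast h
  rw [signature, if_pos h]
  rcases u with i | a <;> rcases v with j | b
  · exact absurd (N.arc_adj h) (G.boundary_not_adj i j)
  · simp only at hi
    cases hb : G.colour b <;> simp only [arcSignature, halfEdge, hb, if_pos h, if_neg hn]
    · push_cast; rw [hi]; ring
    · push_cast; rw [hi]; ring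
  · simp only at hi
    cases ha : G.colour a <;> simp only [arcSignature, halfEdge, ha, if_pos h, if_neg hn]
    · push_cast; rw [hi]; ring
    · rw [hi]; ring
  · simp only at hi
    cases ha : G.colour a <;> cases hb : G.colour b <;>
      simp only [arcSignature, halfEdge, ha, hb, if_pos h,
          if_neg hn] <;> push_cast <;> rw [hi] <;> ring

/-- The signature of an edge is the sum of the contributions of its two ends. -/
lemma signature_eq {u v : Fin n ⊕ J} (h : G.graph.Adj u v) :
    N.signature u v = N.sideSum u + N.sideSum v + N.halfEdge u v + N.halfEdge v u := by
  rcases (N.perfect.adj_iff u v).mp h with h' | h'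
  · exact N.signature_eq_of_arc h'
  · rw [N.signature_comm u v h, N.signature_eq_of_arc h']; ring

end GaugedGraph

end PlabicGraph

/-! ### Change of the ray direction and motion of a vertex -/

lemma HasAngle.symm {l f : ℂ} {θ : ℝ} (h : HasAngle l f θ) : HasAngle f l (-θ) := by
  obtain ⟨r, hr, rfl⟩ := h
  refine ⟨r⁻¹, inv_pos.mpr hr, ?_⟩
  have hr' : (r : ℂ) ≠ 0 := by exact_mod_cast hr.ne'
  have : Complex.exp ((-θ : ℝ) * Complex.I) * Complex.exp (θ * Complex.I) = 1 := by
    rw [← Complex.exp_add]; simp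
  push_cast at this ⊢
  rw [neg_mul] at this ⊢
  field_simp
  linear_combination (-l) * this

/-- The ray direction `l` sees an upward vector on the side given by the angle. -/
lemma sideParity_eq_turnParity {l x : ℂ} {φ : ℝ} (hl : l ≠ 0) (h : HasAngle l x φ)
    (hφ : |φ| < Real.pi) : sideParity l x = turnParity φ := by
  obtain ⟨h1, h2⟩ := abs_lt.mp hφ
  have hpi := Real.pi_pos
  obtain ⟨c, hc, e⟩ := planeCross_hasAngle hl (hasAngle_self l) h
  rw [sub_zero] at e
  rcases lt_or_ge φ 0 with h0 | h0
  · rw [turnParity_eq_one (by linarith) h0, sideParity, if_pos]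
    rw [e]
    exact mul_neg_of_pos_of_neg hc (Real.sin_neg_of_neg_of_neg_pi_lt h0 h1)
  · rw [turnParity_eq_zero h0 (by linarith), sideParity, if_neg]
    rw [e]
    exact not_lt.mpr (mul_nonneg hc.le (Real.sin_nonneg_of_nonneg_of_le_pi h0 h2.le))

lemma InAngle.symm {l l' f : ℂ} (h : InAngle l l' f) : InAngle l' l f := by
  obtain ⟨a, b, ha, hb, e⟩ := h
  exact ⟨b, a, hb, ha, by rw [e, add_comm]⟩

lemma inAngle_comm {l l' f : ℂ} : InAngle l l' f ↔ InAngle l' l f := ⟨InAngle.symm, InAngle.symm⟩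

lemma inAngle_iff {l l' f : ℂ} (h : 0 < planeCross l l') :
    InAngle l l' f ↔ 0 < planeCross l f ∧ 0 < planeCross f l' := by
  constructor
  · rintro ⟨a, b, ha, hb, rfl⟩
    have e1 : planeCross l (a * l + b * l') = b * planeCross l l' := by simp [planeCross]; ring
    have e2 : planeCross (a * l + b * l') l' = a * planeCross l l' := by simp [planeCross]; ring
    exact ⟨e1 ▸ mul_pos hb h, e2 ▸ mul_pos ha h⟩
  · rintro ⟨h1, h2⟩
    refine ⟨planeCross f l' / planeCross l l', planeCross l f / planeCross l l', div_pos h2 h,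
      div_pos h1 h, ?_⟩
    apply Complex.ext <;>
    · simp only [Complex.add_re, Complex.add_im, Complex.re_ofReal_mul, Complex.im_ofReal_mul]
      field_simp
      simp only [planeCross]
      ring

lemma not_inAngle_of_parallel {l l' f : ℂ} (h : planeCross l l' = 0) (hf : planeCross l f ≠ 0) :
    ¬ InAngle l l' f := by
  rintro ⟨a, b, -, -, rfl⟩
  refine hf ?_
  have : planeCross l (a * l + b * l') = b * planeCross l l' := by simp [planeCross]; ring
  rw [this, h, mul_zero]

open Classical in
/-- The case of `turnParity_sub` in which the direction is rotated counterclockwise. -/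
lemma turnParity_sub_of_nonneg {l l' f : ℂ} {θ φ : ℝ} (hl : l ≠ 0) (hθ : HasAngle l l' θ)
    (h0 : 0 ≤ θ) (h1 : θ < Real.pi) (hφ : HasAngle l f φ) (hf : planeCross l f ≠ 0)
    (hf' : planeCross l' f ≠ 0) :
    turnParity (φ - θ) = turnParity φ + if InAngle l l' f then 1 else 0 := by
  have hpi := Real.pi_pos
  obtain ⟨φ₀, hφ₀, g0, g1⟩ := exists_angle_mem_Ico hl (hφ.ne_zero hl)
  obtain ⟨k, rfl⟩ := hφ₀.exists_eq_add hl hφ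
  rw [show φ₀ + 2 * Real.pi * k - θ = φ₀ - θ + 2 * Real.pi * k by ring, turnParity_add_int,
    turnParity_add_int, turnParity_eq_zero g0 g1]
  rcases h0.eq_or_lt with rfl | h0
  · rw [sub_zero, turnParity_eq_zero g0 g1, if_neg, add_zero]
    refine not_inAngle_of_parallel (planeCross_eq_zero_of_angle hl (hasAngle_self l) hθ ?_) hf
    simp
  have hc : 0 < planeCross l l' := planeCross_pos_of_angle hl (hasAngle_self l) hθ (by linarith)
    (by linarith)
  rw [inAngle_iff hc]
  rcases lt_trichotomy φ₀ θ with h | rfl | h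
  · have g0' : 0 < φ₀ := by
      refine lt_of_le_of_ne g0 ?_
      rintro rfl
      exact hf (planeCross_eq_zero_of_angle hl (hasAngle_self l) hφ₀ (by simp))
    rw [turnParity_eq_one (by linarith) (by linarith), if_pos]
    · ring
    · exact ⟨planeCross_pos_of_angle hl (hasAngle_self l) hφ₀ (by linarith) (by linarith),
        planeCross_pos_of_angle hl hφ₀ hθ (by linarith) (by linarith)⟩
  · exact absurd (planeCross_eq_zero_of_angle hl hθ hφ₀ (by simp)) hf'
  · rw [turnParity_eq_zero (by linarith) (by linarith), if_neg]
    · ring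
    · rintro ⟨a1, a2⟩
      rcases lt_or_ge φ₀ Real.pi with h' | h'
      · exact a2.not_gt (planeCross_neg_of_angle hl hφ₀ hθ (by linarith) (by linarith))
      · obtain ⟨c, hc, e⟩ := planeCross_hasAngle hl (hasAngle_self l) hφ₀
        rw [sub_zero] at e
        have : Real.sin φ₀ ≤ 0 := by
          rw [← Real.sin_sub_two_pi]
          exact Real.sin_nonpos_of_nonpos_of_neg_pi_le (by linarith) (by linarith)
        rw [e] at a1
        nlinarith

open Classical in
/-- Rotating the reference direction changes the turn parity of the angle of the vectors passed. -/
lemma turnParity_sub {l l' f : ℂ} {θ φ : ℝ} (hl : l ≠ 0) (hθ : HasAngle l l' θ)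
    (h1 : |θ| < Real.pi) (hφ : HasAngle l f φ) (hf : planeCross l f ≠ 0)
    (hf' : planeCross l' f ≠ 0) :
    turnParity (φ - θ) = turnParity φ + if InAngle l l' f then 1 else 0 := by
  obtain ⟨h2, h3⟩ := abs_lt.mp h1
  rcases le_or_gt 0 θ with h0 | h0
  · exact turnParity_sub_of_nonneg hl hθ h0 h3 hφ hf hf'
  · have hl' := hθ.ne_zero hl
    have h := turnParity_sub_of_nonneg hl' hθ.symm (by linarith) (by linarith)
      (hθ.symm.trans hφ) hf' hf
    rw [show -θ + φ - -θ = φ by ring, show -θ + φ = φ - θ by ring] at h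
    rw [h, inAngle_comm, add_assoc, CharTwo.add_self_eq_zero, add_zero]

lemma exists_angle_of_upper {l l' : ℂ} (hl : 0 < l.im) (hl' : 0 < l'.im) :
    ∃ θ, HasAngle l l' θ ∧ |θ| < Real.pi := by
  obtain ⟨φ, h1, h2⟩ := exists_angle_near (hasAngle_self l)
    (zero_notMem_segment_of_im (ne_zero_of_im_pos hl) hl.le hl')
  exact ⟨φ, h1, by simpa using h2⟩

open Classical in
/-- Under a rotation of the direction, the crossing parity changes by the number of vectors
passed. -/
lemma crossParity_rotation {l l' f g : ℂ} (hl : 0 < l.im) (hl' : 0 < l'.im)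
    (hf : planeCross l f ≠ 0) (hf' : planeCross l' f ≠ 0) (hg : planeCross l g ≠ 0)
    (hg' : planeCross l' g ≠ 0) (h : (0 : ℂ) ∉ segment ℝ f g) :
    crossParity l' f g = crossParity l f g + (if InAngle l l' f then 1 else 0) +
      if InAngle l l' g then 1 else 0 := by
  have h0 := ne_zero_of_im_pos hl
  obtain ⟨θ, hθ, hθ1⟩ := exists_angle_of_upper hl hl'
  obtain ⟨φ, hφ, -, -⟩ := exists_angle_mem_Ico h0 (ne_zero_of_zero_notMem_segment h).1
  obtain ⟨ψ, hψ, hψφ⟩ := exists_angle_near hφ h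
  have t : ∀ {x : ℂ} {a : ℝ}, HasAngle l x a → HasAngle l' x (a - θ) := fun {x a} ha => by
    have := hθ.symm.trans ha
    rwa [neg_add_eq_sub] at this
  rw [crossParity_eq h0 hφ hψ hψφ, crossParity_eq (ne_zero_of_im_pos hl') (t hφ) (t hψ)
    (by rwa [sub_sub_sub_cancel_right]), turnParity_sub h0 hθ hθ1 hφ hf hf',
    turnParity_sub h0 hθ hθ1 hψ hg hg']
  ring

open Classical in
/-- Under a rotation of the direction inside the upper half-plane, the side of an upward vector
changes exactly if the vector is passed. -/
lemma sideParity_rotation {l l' x : ℂ} (hl : 0 < l.im) (hl' : 0 < l'.im) (hx : 0 ≤ x.im)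
    (hf : planeCross l x ≠ 0) (hf' : planeCross l' x ≠ 0) :
    sideParity l' x = sideParity l x + if InAngle l l' x then 1 else 0 := by
  have h0 := ne_zero_of_im_pos hl
  have h0' := ne_zero_of_im_pos hl'
  have hx0 : x ≠ 0 := by
    rintro rfl; exact hf (by simp [planeCross])
  have ha : ∀ {y : ℂ}, 0 < y.im → 0 < y.arg ∧ y.arg < Real.pi := angle_mem_of_im_pos
  have hg : ∀ {y : ℂ}, y ≠ 0 → HasAngle 1 y y.arg := fun {y} hy => by
    simpa using HasAngle.arg_div (l := 1) one_ne_zero hy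
  have hsub : ∀ {y : ℂ}, y ≠ 0 → HasAngle y x (x.arg - y.arg) := fun {y} hy => by
    have := (hg hy).symm.trans (hg hx0)
    rwa [neg_add_eq_sub] at this
  have hxa : 0 ≤ x.arg ∧ x.arg ≤ Real.pi := ⟨Complex.arg_nonneg_iff.mpr hx, Complex.arg_le_pi x⟩
  have hθ : HasAngle l l' (l'.arg - l.arg) := by
    have := (hg h0).symm.trans (hg h0')
    rwa [neg_add_eq_sub] at this
  have b1 := ha hl
  have b2 := ha hl'
  rw [sideParity_eq_turnParity h0 (hsub h0) (abs_lt.mpr ⟨by linarith, by linarith⟩),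
    sideParity_eq_turnParity h0' (hsub h0') (abs_lt.mpr ⟨by linarith, by linarith⟩),
    ← turnParity_sub h0 hθ (abs_lt.mpr ⟨by linarith, by linarith⟩) (hsub h0) hf hf']
  congr 1; ring

namespace PlabicGraph

variable {n : ℕ} {J : Type*} {G : PlabicGraph n J}

namespace GaugedGraph

/-- The value of a function of edges at the distinguished edge of an internal vertex: the incoming
edge of a white vertex, the outgoing edge of a black one. -/
noncomputable def atDistinguished (N : G.GaugedGraph) (g : Fin n ⊕ J → Fin n ⊕ J → ZMod 2) (x : J) :
    ZMod 2 :=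
  match G.colour x with
  | VertexColour.white => g (N.incoming x) (Sum.inr x)
  | VertexColour.black => g (Sum.inr x) (N.outgoing x)

open Classical in
/-- If in a change of the ray and of the positions `g` counts the passages of the vectors between
vertices through the ray direction, then the signature changes by the gauge function counting the
passages of a vertex through the gauge rays and those of its distinguished edge. -/
lemma gaugeTransforms_of_passages {N N' : G.GaugedGraph} (harc : N'.arc = N.arc)
    (g : Fin n ⊕ J → Fin n ⊕ J → ZMod 2)
    (hwind : ∀ u v w, N.arc u v → N.arc v w →
      (N'.wind u v w : ZMod 2) = N.wind u v w + g u v + g v w)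
    (hside : ∀ k v, v ≠ Sum.inl k → sideParity N'.ray (N'.vec (Sum.inl k) v) =
      sideParity N.ray (N.vec (Sum.inl k) v) + g (Sum.inl k) v)
    (hreal : ∀ u k, u ≠ Sum.inl k → g u (Sum.inl k) = 0) :
    G.GaugeTransforms (fun x => (∑ k, if N.IsSource k then g (Sum.inl k) (Sum.inr x) else 0) +
      N.atDistinguished g x) N.signature N'.signature := by
  have hsrc : N'.IsSource = N.IsSource := by
    funext k; simp only [IsSource, harc]
  have hinc : N'.incoming = N.incoming := by funext x; simp only [incoming, harc]
  have hout : N'.outgoing = N.outgoing := by funext x; simp only [outgoing, harc]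
  have hs1 : ∀ x, N'.sideSum (Sum.inr x) = N.sideSum (Sum.inr x) +
      ∑ k, if N.IsSource k then g (Sum.inl k) (Sum.inr x) else 0 := by
    intro x
    rw [sideSum, sideSum, ← Finset.sum_add_distrib, hsrc]
    refine Finset.sum_congr rfl fun k _ => ?_
    by_cases hk : N.IsSource k
    · simp only [hk, if_true]; exact hside k _ (by simp)
    · simp [hk]
  have hs2 : ∀ m, N'.sideSum (Sum.inl m) = N.sideSum (Sum.inl m) := by
    intro m
    rw [sideSum, sideSum, hsrc]
    refine Finset.sum_congr rfl fun k _ => ?_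
    by_cases hkm : (Sum.inl m : Fin n ⊕ J) = Sum.inl k
    · rw [← hkm, vec, vec, sub_self, sub_self, sideParity_zero, sideParity_zero]
    · rw [hside k _ hkm, hreal _ _ (Ne.symm hkm), add_zero]
  have key : ∀ u v, N.arc u v → N'.signature u v = N.signature u v +
      extendGauge (fun x => (∑ k, if N.IsSource k then g (Sum.inl k) (Sum.inr x) else 0) +
        N.atDistinguished g x) u + extendGauge (fun x =>
        (∑ k, if N.IsSource k then g (Sum.inl k) (Sum.inr x) else 0) +
        N.atDistinguished g x) v := by
    intro u v h
    have h' : N'.arc u v := harc ▸ h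
    have hn := N.perfect.asymm _ _ h
    -- The edge `u → v` contributes `g u v` to the change at both of its ends, so these
    -- contributions cancel. At the end where the edge is the distinguished one there is no
    -- winding term, and `g u v` reappears as the value of the gauge function.
    have htail : N'.halfEdge u v = N.halfEdge u v + g u v +
        Sum.elim (fun _ => 0) (N.atDistinguished g) u := by
      rcases u with i | x
      · simp only [halfEdge, harc, if_pos h, Sum.elim_inl, add_zero]
        rw [hside i v (N.arc_adj h).ne.symm]; ring
      · cases hx : G.colour x
        · simp only [halfEdge, harc, if_pos h, Sum.elim_inr, hx, hinc, atDistinguished]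
          rw [hwind _ _ _ (N.incoming_spec hx) h]; ring
        · simp only [halfEdge, harc, if_pos h, Sum.elim_inr, hx, atDistinguished,
              N.outgoing_eq hx h]
          rw [zero_add, CharTwo.add_self_eq_zero]
    have hhead : N'.halfEdge v u = N.halfEdge v u + g u v +
        Sum.elim (fun _ => 0) (N.atDistinguished g) v := by
      rcases v with j | x
      · simp only [halfEdge, harc, if_neg hn, Sum.elim_inl, add_zero]
        rw [hreal _ _ (N.arc_adj h).ne, add_zero]
      · cases hx : G.colour x
        · simp only [halfEdge, harc, if_neg hn, Sum.elim_inr, hx, atDistinguished,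
              N.incoming_eq hx h]
          rw [zero_add, CharTwo.add_self_eq_zero]
        · simp only [halfEdge, harc, if_neg hn, Sum.elim_inr, hx, hout, atDistinguished]
          rw [hwind _ _ _ h (N.outgoing_spec hx)]
    have hsum : ∀ a, N'.sideSum a + Sum.elim (fun _ => 0) (N.atDistinguished g) a = N.sideSum a +
        extendGauge (fun x => (∑ k, if N.IsSource k then g (Sum.inl k) (Sum.inr x) else 0) +
          N.atDistinguished g x) a := by
      rintro (m | x)
      · simp [extendGauge, hs2]
      · simp only [extendGauge, Sum.elim_inr, hs1]; ring
    rw [N'.signature_eq (N.arc_adj h), N.signature_eq (N.arc_adj h), htail, hhead]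
    linear_combination hsum u + hsum v + CharTwo.add_self_eq_zero (g u v)
  intro u v huv
  rcases (N.perfect.adj_iff u v).mp huv with h | h
  · exact key u v h
  · rw [N'.signature_comm u v huv, N.signature_comm u v huv, key v u h]; ring

lemma arc_trans_ne {N : G.GaugedGraph} {u v w : Fin n ⊕ J} (h : N.arc u v) (h' : N.arc v w) :
    u ≠ w := by
  rintro rfl; exact N.perfect.asymm _ _ h h'

open Classical in
/-- A change of the ray direction: the passages are those of the vectors in the angle between the
two directions. -/
lemma gaugeTransforms_rotation (N : G.GaugedGraph) (l' : ℂ) (h : G.IsGaugeDirection N.pos l') :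
    G.GaugeTransforms (N.rotationGauge l') N.signature (N.withRay l' h).signature := by
  have hl := N.gauge.inward
  have hl' := h.inward
  convert gaugeTransforms_of_passages (N := N) (N' := N.withRay l' h) rfl
    (fun u v => if InAngle N.ray l' (N.vec u v) then 1 else 0) ?_ ?_ ?_ using 1
  · funext x
    rw [rotationGauge]
    congr 1
    · rw [Set.ncard_eq_toFinset_card', Finset.cast_card, Set.toFinset_ofPred, Finset.sum_filter]
      refine Finset.sum_congr rfl fun k _ => ?_
      by_cases hk : N.IsSource k <;> simp [hk]
  · intro u v w h1 h2
    rw [wind_cast _ (N.arc_adj h1) (N.arc_adj h2) (arc_trans_ne h1 h2),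
      wind_cast _ (N.arc_adj h1) (N.arc_adj h2) (arc_trans_ne h1 h2)]
    exact crossParity_rotation hl hl' (N.vec_not_parallel (N.arc_adj h1))
      ((N.withRay l' h).vec_not_parallel (N.arc_adj h1)) (N.vec_not_parallel (N.arc_adj h2))
      ((N.withRay l' h).vec_not_parallel (N.arc_adj h2))
      (N.vec_zero_notMem (N.arc_adj h1) (N.arc_adj h2) (arc_trans_ne h1 h2))
  · intro k v hv
    refine sideParity_rotation hl hl' ?_ (N.pos_not_on_ray hv) ((N.withRay l' h).pos_not_on_ray hv)
    change 0 ≤ (N.pos v - N.pos (Sum.inl k)).im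
    rw [Complex.sub_im, N.drawing.boundary_real k, sub_zero]
    exact im_nonneg v
  · intro u k _
    refine if_neg ?_
    rintro ⟨a, b, ha, hb, e⟩
    have := congrArg Complex.im e
    rw [vec, Complex.sub_im, N.drawing.boundary_real k, Complex.add_im, Complex.im_ofReal_mul,
      Complex.im_ofReal_mul] at this
    have h3 := im_nonneg (N := N) u
    have := mul_pos ha hl
    have := mul_pos hb hl'
    linarith

end GaugedGraph

lemma moveVertex_self (p : Fin n ⊕ J → ℂ) (u : J) (z : ℂ) : moveVertex p u z (Sum.inr u) = z := by
  simp [moveVertex]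

lemma moveVertex_of_ne (p : Fin n ⊕ J → ℂ) {u : J} (z : ℂ) {v : Fin n ⊕ J} (h : v ≠ Sum.inr u) :
    moveVertex p u z v = p v := by
  simp [moveVertex, h]

lemma moveVertex_pos (p : Fin n ⊕ J → ℂ) (u : J) : moveVertex p u (p (Sum.inr u)) = p := by
  simp [moveVertex]

lemma continuous_moveVertex (p : Fin n ⊕ J → ℂ) (u : J) : Continuous (moveVertex p u) := by
  classical
  refine continuous_pi fun v => ?_
  by_cases h : v = Sum.inr u
  · subst h; simp only [moveVertex_self]; exact continuous_id
  · simp only [moveVertex_of_ne p _ h]; exact continuous_const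

namespace GaugedGraph

lemma motionPar_of_ne (N : G.GaugedGraph) {u : J} (c : unitInterval → ℂ) {a b : Fin n ⊕ J}
    (hab : a ≠ b) (ha : a ≠ Sum.inr u) (hb : b ≠ Sum.inr u) : N.motionPar u c a b = 0 := by
  simp only [motionPar, moveVertex_of_ne _ _ ha, moveVertex_of_ne _ _ hb]
  exact passages_const N.ray_ne_zero
    (sub_ne_zero.mpr fun h => hab (N.drawing.injective h).symm)

/-- A motion of an internal vertex: the passages are counted by `motionPar`, and only the vectors
from or to the moving vertex contribute. -/
lemma gaugeTransforms_motion (N : G.GaugedGraph) (u : J) (z : ℂ) (c : Path (N.pos (Sum.inr u)) z)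
    (hc : ∀ t, G.IsDrawing (moveVertex N.pos u (c t)))
    (hz : G.IsDrawing (moveVertex N.pos u z))
    (hl : G.IsGaugeDirection (moveVertex N.pos u z) N.ray) :
    G.GaugeTransforms (N.motionGauge u c) N.signature (N.withPos _ hz hl).signature := by
  classical
  have hcont : ∀ a b, Continuous fun t => moveVertex N.pos u (c t) b - moveVertex N.pos u (c t) a :=
    fun a b => by
      have h := (continuous_moveVertex N.pos u).comp c.continuous
      exact ((continuous_apply b).comp h).sub ((continuous_apply a).comp h)
  have h0 : ∀ a, moveVertex N.pos u (c 0) a = N.pos a := fun a => by rw [c.source, moveVertex_pos]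
  have h1 : ∀ a, moveVertex N.pos u (c 1) a = (N.withPos _ hz hl).pos a := fun a => by
    rw [c.target]; rfl
  have hne : ∀ {a b}, a ≠ b → ∀ t, moveVertex N.pos u (c t) b - moveVertex N.pos u (c t) a ≠ 0 :=
    fun hab t => sub_ne_zero.mpr fun h => hab ((hc t).injective h).symm
  have him : ∀ t a, 0 ≤ (moveVertex N.pos u (c t) a).im := by
    rintro t (k | x)
    · exact ((hc t).boundary_real k).ge
    · exact ((hc t).internal_pos x).le
  convert gaugeTransforms_of_passages (N := N) (N' := N.withPos _ hz hl) rfl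
    (N.motionPar u c) ?_ ?_ ?_ using 1
  · funext x
    -- For a vertex `x ≠ u`, `motionPar` vanishes on the distinguished edge of `x` unless this
    -- edge joins `x` and `u`.
    by_cases hx : x = u
    · subst hx
      rw [motionGauge, if_pos rfl]
      have hk : ∀ y k, moveVertex N.pos x y (Sum.inl k) = N.pos (Sum.inl k) := fun y k =>
        moveVertex_of_ne _ _ (by simp)
      simp only [atDistinguished, motionCr, motionPar, hk]
    · have hxu : (Sum.inr x : Fin n ⊕ J) ≠ Sum.inr u := fun h => hx (Sum.inr_injective h)
      rw [motionGauge, if_neg hx, Finset.sum_eq_zero, zero_add]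
      · cases hcol : G.colour x
        · have hi := N.incoming_spec hcol
          simp only [atDistinguished, hcol]
          by_cases h : N.arc (Sum.inr u) (Sum.inr x)
          · rw [if_pos h, N.incoming_eq hcol h]
          · rw [if_neg h, ite_self, motionPar_of_ne N c (N.arc_adj hi).ne _ hxu]
            intro h'
            exact h (h' ▸ hi)
        · have hi := N.outgoing_spec hcol
          simp only [atDistinguished, hcol]
          by_cases h : N.arc (Sum.inr x) (Sum.inr u)
          · rw [if_neg (N.perfect.asymm _ _ h), if_pos h, N.outgoing_eq hcol h]
          · rw [if_neg h, ite_self, motionPar_of_ne N c (N.arc_adj hi).ne hxu]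
            intro h'
            exact h (h' ▸ hi)
      · intro k _
        rw [motionPar_of_ne N c (by simp) (by simp) hxu, ite_self]
  · intro a b d hab hbd
    rw [wind_cast _ (N.arc_adj hab) (N.arc_adj hbd) (arc_trans_ne hab hbd),
      wind_cast _ (N.arc_adj hab) (N.arc_adj hbd) (arc_trans_ne hab hbd)]
    have := crossParity_motion N.ray_ne_zero (hcont a b) (hcont b d) fun t =>
      (hc t).zero_notMem_segment (N.arc_adj hab) (N.arc_adj hbd) (arc_trans_ne hab hbd)
    simp only [h0, h1] at this
    exact this
  · intro k v hv
    have := passages_upper N.gauge.inward (hcont (Sum.inl k) v) (hne hv.symm) fun t => by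
      rw [Complex.sub_im, (hc t).boundary_real k, sub_zero]; exact him t v
    simp only [h0, h1] at this
    exact this
  · intro a k hak
    refine passages_lower N.gauge.inward (hcont a (Sum.inl k)) (hne hak) fun t => ?_
    rw [Complex.sub_im, (hc t).boundary_real k, zero_sub]
    exact neg_nonpos.mpr (him t a)

end GaugedGraph

end PlabicGraph

/-! ### Winding numbers at a vertex of a path -/

/-- The parities of the angles of `-f` and of `f` differ by the side of `f`. -/
lemma turnParity_add_pi {l f : ℂ} {θ : ℝ} (hl : l ≠ 0) (h : HasAngle l f θ)
    (hf : planeCross l f ≠ 0) : turnParity (θ + Real.pi) = turnParity θ + sideParity l f := by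
  have hpi := Real.pi_pos
  obtain ⟨θ₀, h₀, g0, g1⟩ := exists_angle_mem_Ico hl (h.ne_zero hl)
  obtain ⟨k, rfl⟩ := h₀.exists_eq_add hl h
  rw [show θ₀ + 2 * Real.pi * k + Real.pi = θ₀ + Real.pi + 2 * Real.pi * k by ring,
    turnParity_add_int, turnParity_add_int, turnParity_eq_zero g0 g1]
  obtain ⟨c, hc, e⟩ := planeCross_hasAngle hl (hasAngle_self l) h₀
  rw [sub_zero] at e
  rcases lt_trichotomy θ₀ Real.pi with h1 | rfl | h1
  · rw [turnParity_eq_zero (by linarith) (by linarith), sideParity, if_neg]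
    · ring
    · rw [e]
      exact not_lt.mpr (mul_nonneg hc.le (Real.sin_nonneg_of_nonneg_of_le_pi g0 h1.le))
  · rw [Real.sin_pi, mul_zero] at e
    exact absurd e hf
  · rw [turnParity_eq_of_mem 1 (by push_cast; linarith) (by push_cast; linarith), sideParity,
        if_pos]
    · push_cast; ring
    · rw [e, ← Real.sin_sub_two_pi]
      exact mul_neg_of_pos_of_neg hc (Real.sin_neg_of_neg_of_neg_pi_lt (by linarith) (by linarith))

lemma turnParity_sub_pi {l f : ℂ} {θ : ℝ} (hl : l ≠ 0) (h : HasAngle l (-f) θ)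
    (hf : planeCross l f ≠ 0) : turnParity (θ - Real.pi) = turnParity θ + sideParity l f := by
  have h' := h.neg'
  rw [neg_neg] at h'
  have := turnParity_add_pi hl h' hf
  rw [sub_add_cancel] at this
  rw [this, add_assoc, CharTwo.add_self_eq_zero, add_zero]

/-- An angle of `x` following a given angle of `y`. -/
lemma exists_angle_between {l x y : ℂ} {α : ℝ} (h : (0 : ℂ) ∉ segment ℝ (-x) y)
    (hα : HasAngle l y α) : ∃ β, HasAngle l x β ∧ α < β ∧ β < α + 2 * Real.pi := by
  obtain ⟨hx, hy⟩ := ne_zero_of_zero_notMem_segment h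
  obtain ⟨θ, hθ, g0, g1⟩ := exists_angle_mem_Ico hy (neg_ne_zero.mp hx)
  refine ⟨α + θ, hα.trans hθ, ?_, by linarith⟩
  refine lt_add_of_pos_right _ (lt_of_le_of_ne g0 ?_)
  rintro rfl
  exact h (zero_mem_segment_of_angle hθ.neg (hasAngle_self y) (by simp))

section Vertex

variable {l e₁ e₂ f : ℂ} {α β φ s : ℝ}

/-- The winding numbers at a vertex of a path, before and after the reversal, along the path. -/
lemma crossParity_reverse (hl : l ≠ 0) (hα : HasAngle l e₂ α) (hβ : HasAngle l (-e₁) β)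
    (h1 : α < β) (h2 : β < α + 2 * Real.pi) (hp1 : planeCross l e₁ ≠ 0)
    (hp2 : planeCross l e₂ ≠ 0) :
    crossParity l (-e₂) (-e₁) + crossParity l e₁ e₂ = sideParity l e₁ + sideParity l e₂ := by
  have hpi := Real.pi_pos
  have hβ' : HasAngle l e₁ (β - Real.pi) := by simpa using hβ.neg'
  rw [crossParity_eq hl hα.neg hβ (abs_lt.mpr ⟨by linarith, by linarith⟩),
    crossParity_eq hl hβ' hα (abs_lt.mpr ⟨by linarith, by linarith⟩),
    turnParity_add_pi hl hα hp2, turnParity_sub_pi hl hβ hp1]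
  linear_combination CharTwo.add_self_eq_zero (turnParity α) +
    CharTwo.add_self_eq_zero (turnParity β)

/-- The winding numbers of the incoming edges with a third edge `f` leaving the vertex: `e₁` is
the incoming edge of the path before the reversal, `-e₂` the one after it, and `s` tells the side
of the path on which `f` lies. -/
lemma crossParity_third_out (hl : l ≠ 0) (hα : HasAngle l e₂ α) (hβ : HasAngle l (-e₁) β)
    (h1 : α < β) (h2 : β < α + 2 * Real.pi) (hφ : HasAngle l f φ)
    (h : (s = 1 ∧ α < φ ∧ φ < β) ∨ (s = -1 ∧ β < φ ∧ φ < α + 2 * Real.pi))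
    (hp2 : planeCross l e₂ ≠ 0) :
    crossParity l e₁ f + crossParity l (-e₂) f =
      crossParity l e₁ e₂ + sideParity l e₂ + sideShift s := by
  have hpi := Real.pi_pos
  have hβ' : HasAngle l e₁ (β - Real.pi) := by simpa using hβ.neg'
  have hβ'' : HasAngle l e₁ (β + Real.pi) := by simpa using hβ.neg
  have hb : turnParity (β + Real.pi) = turnParity (β - Real.pi) + 1 := by
    rw [← turnParity_add_two_pi]; congr 1; ring
  rw [crossParity_eq hl hβ' hα (abs_lt.mpr ⟨by linarith, by linarith⟩)]
  rcases h with ⟨rfl, h3, h4⟩ | ⟨rfl, h3, h4⟩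
  · rw [crossParity_eq hl hβ' hφ (abs_lt.mpr ⟨by linarith, by linarith⟩),
      crossParity_eq hl hα.neg hφ (abs_lt.mpr ⟨by linarith, by linarith⟩),
      turnParity_add_pi hl hα hp2, sideShift_one]
    linear_combination CharTwo.add_self_eq_zero (turnParity φ)
  · rw [crossParity_eq hl hβ'' hφ (abs_lt.mpr ⟨by linarith, by linarith⟩),
      crossParity_eq hl hα.neg hφ (abs_lt.mpr ⟨by linarith, by linarith⟩),
      turnParity_add_pi hl hα hp2, sideShift_neg_one, hb]
    linear_combination CharTwo.add_self_eq_zero (turnParity φ)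

/-- The winding numbers of a third edge `-f` entering the vertex with the outgoing edges of the
path, `e₂` before the reversal and `-e₁` after it. -/
lemma crossParity_third_in (hl : l ≠ 0) (hα : HasAngle l e₂ α) (hβ : HasAngle l (-e₁) β)
    (h1 : α < β) (h2 : β < α + 2 * Real.pi) (hφ : HasAngle l f φ)
    (h : (s = 1 ∧ α < φ ∧ φ < β) ∨ (s = -1 ∧ β < φ ∧ φ < α + 2 * Real.pi))
    (hp1 : planeCross l e₁ ≠ 0) :
    crossParity l (-f) e₂ + crossParity l (-f) (-e₁) =
      crossParity l e₁ e₂ + sideParity l e₁ + 1 + sideShift s := by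
  have hpi := Real.pi_pos
  have hβ' : HasAngle l e₁ (β - Real.pi) := by simpa using hβ.neg'
  have hb : turnParity (φ + Real.pi) = turnParity (φ - Real.pi) + 1 := by
    rw [← turnParity_add_two_pi]; congr 1; ring
  have hφα : α < φ ∧ φ < α + 2 * Real.pi := by
    rcases h with ⟨-, h3, h4⟩ | ⟨-, h3, h4⟩
    · exact ⟨h3, h4.trans h2⟩
    · exact ⟨h1.trans h3, h4⟩
  obtain ⟨h5, h6⟩ := hφα
  rw [crossParity_eq hl hβ' hα (abs_lt.mpr ⟨by linarith, by linarith⟩),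
    crossParity_eq hl hφ.neg' hα (abs_lt.mpr ⟨by linarith, by linarith⟩),
    turnParity_sub_pi hl hβ hp1]
  have t := CharTwo.add_self_eq_zero (turnParity (φ - Real.pi))
  have t' := CharTwo.add_self_eq_zero (sideParity l e₁)
  rcases h with ⟨rfl, h3, h4⟩ | ⟨rfl, h3, h4⟩
  · rw [crossParity_eq hl hφ.neg hβ (abs_lt.mpr ⟨by linarith, by linarith⟩), hb, sideShift_one]
    linear_combination t - t'
  · rw [crossParity_eq hl hφ.neg' hβ (abs_lt.mpr ⟨by linarith, by linarith⟩), sideShift_neg_one]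
    linear_combination t - t' - CharTwo.two_eq_zero (R := ZMod 2)

end Vertex

/-! ### Orientations reversed along a path or a cycle -/

namespace PlabicGraph

variable {n : ℕ} {J : Type*} {G : PlabicGraph n J}

lemma mem_support_iff_walkArc {u v : Fin n ⊕ J} {w : G.graph.Walk u v} (hw : 0 < w.length)
    {a : Fin n ⊕ J} : a ∈ w.support ↔ ∃ b, G.WalkArc w a b ∨ G.WalkArc w b a := by
  rw [SimpleGraph.Walk.mem_support_iff_exists_getVert]
  constructor
  · rintro ⟨k, rfl, hk⟩
    rcases hk.lt_or_eq with h | h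
    · exact ⟨_, Or.inl ((walkArc_iff w _ _).mpr ⟨k, h, rfl, rfl⟩)⟩
    · exact ⟨w.getVert (k - 1), Or.inr ((walkArc_iff w _ _).mpr
        ⟨k - 1, by omega, rfl, by rw [show k - 1 + 1 = k by omega]⟩)⟩
  · rintro ⟨b, h | h⟩
    · obtain ⟨k, hk, rfl, -⟩ := (walkArc_iff w _ _).mp h
      exact ⟨k, rfl, hk.le⟩
    · obtain ⟨k, hk, -, rfl⟩ := (walkArc_iff w _ _).mp h
      exact ⟨k + 1, rfl, hk⟩

lemma reverseAlong_iff {O : Fin n ⊕ J → Fin n ⊕ J → Prop} {u v : Fin n ⊕ J}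
    {w : G.graph.Walk u v} {a b : Fin n ⊕ J} (h : ¬ G.WalkArc w a b) (h' : ¬ G.WalkArc w b a) :
    G.reverseAlong O w a b ↔ O a b := by
  simp [reverseAlong, h, h']

namespace IsSimpleDirected

variable {O : Fin n ⊕ J → Fin n ⊕ J → Prop} {u v : Fin n ⊕ J} {w : G.graph.Walk u v}
  (hw : IsSimpleDirected O w) (hO : G.IsPerfectOrientation O)
include hw hO

lemma not_walkArc_swap {a b : Fin n ⊕ J} (h : G.WalkArc w a b) : ¬ G.WalkArc w b a := fun h' =>
  hO.asymm _ _ (hw.directed _ _ h) (hw.directed _ _ h')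

/-- At a white vertex of the path, the path uses the unique incoming edge, and the reversal
replaces it by the formerly outgoing edge of the path; black vertices are dual. -/
lemma isPerfectOrientation_reverseAlong : G.IsPerfectOrientation (G.reverseAlong O w) where
  adj_iff := fun a b => by
    rw [hO.adj_iff]
    constructor
    · rintro (h | h)
      · by_cases h' : G.WalkArc w a b
        · exact Or.inr (Or.inr h')
        · exact Or.inl (Or.inl ⟨h, h'⟩)
      · by_cases h' : G.WalkArc w b a
        · exact Or.inl (Or.inr h')
        · exact Or.inr (Or.inl ⟨h, h'⟩)
    · rintro ((h | h) | (h | h))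
      · exact Or.inl h.1
      · exact Or.inr (hw.directed _ _ h)
      · exact Or.inr h.1
      · exact Or.inl (hw.directed _ _ h)
  asymm := fun a b h h' => by
    rcases h with ⟨h1, h2⟩ | h1 <;> rcases h' with ⟨h3, h4⟩ | h3
    · exact hO.asymm _ _ h1 h3
    · exact h2 h3
    · exact h4 h1
    · exact hw.not_walkArc_swap hO h1 h3
  white := fun x hx => by
    by_cases hb : ∃ b, G.WalkArc w (Sum.inr x) b
    · obtain ⟨b, hb⟩ := hb
      obtain ⟨a, ha⟩ := hw.exists_prev x b hb
      refine ⟨b, Or.inr hb, ?_⟩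
      rintro c (⟨h1, h2⟩ | h)
      · exact absurd ((hO.white x hx).unique h1 (hw.directed _ _ ha) ▸ ha) h2
      · exact hw.fst_unique h hb
    · have ha : ∀ a, ¬ G.WalkArc w a (Sum.inr x) := fun a h => hb (hw.exists_next x a h)
      obtain ⟨a, h1, h2⟩ := hO.white x hx
      exact ⟨a, Or.inl ⟨h1, ha a⟩, fun c hc =>
        h2 c ((reverseAlong_iff (ha c) fun h => hb ⟨c, h⟩).mp hc)⟩
  black := fun x hx => by
    by_cases ha : ∃ a, G.WalkArc w a (Sum.inr x)
    · obtain ⟨a, ha⟩ := ha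
      obtain ⟨b, hb⟩ := hw.exists_next x a ha
      refine ⟨a, Or.inr ha, ?_⟩
      rintro c (⟨h1, h2⟩ | h)
      · exact absurd ((hO.black x hx).unique h1 (hw.directed _ _ hb) ▸ hb) h2
      · exact hw.snd_unique h ha
    · have hb : ∀ b, ¬ G.WalkArc w (Sum.inr x) b := fun b h => ha (hw.exists_prev x b h)
      obtain ⟨b, h1, h2⟩ := hO.black x hx
      exact ⟨b, Or.inl ⟨h1, hb b⟩, fun c hc =>
        h2 c ((reverseAlong_iff (hb c) fun h => ha ⟨c, h⟩).mp hc)⟩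

end IsSimpleDirected

namespace GaugedGraph

variable {N : G.GaugedGraph}

lemma gammaTwo_eq {a b : Fin n ⊕ J} (h : G.graph.Adj a b) :
    N.gammaTwo a b = 1 + sideParity N.ray (N.vec a b) := by
  have hne := N.vec_not_parallel h
  rw [gammaTwo, sideParity]
  rcases lt_or_gt_of_ne hne with h | h
  · rw [if_pos h, orientSign_eq_one (by rw [planeCross_swap]; linarith)]; decide
  · rw [if_neg h.not_gt, orientSign_eq_neg_one (by rw [planeCross_swap]; linarith)]; decide

lemma sideParity_vec_swap {a b : Fin n ⊕ J} (h : G.graph.Adj a b) :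
    sideParity N.ray (N.vec b a) = sideParity N.ray (N.vec a b) + 1 := by
  rw [vec_swap, sideParity_neg (N.vec_not_parallel h)]

/-- What a path or cycle and the region `M` marked by `-` have to satisfy in order that the
reversal acts by its gauge function: `S` is the change of `sideSum`, as a function of the point,
and `c` is the crossing count on the left of the path. A point is marked `-` if its crossing
count differs from `S`. The fields `real`, `start` and `finish` are the conditions at the
boundary vertices, where the gauge function vanishes. -/
structure IsReversalData (N : G.GaugedGraph) {u v : Fin n ⊕ J} (w : G.graph.Walk u v) (M : Set ℂ)
    (S : ℂ → ZMod 2) (c : ZMod 2) : Prop where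
  simple : IsSimpleDirected N.arc w
  length_pos : 0 < w.length
  mem_iff : ∀ x, Sum.inr x ∉ w.support → (N.pos (Sum.inr x) ∈ M ↔
    crossCount N.ray (N.walkEdges w) (N.pos (Sum.inr x)) ≠ S (N.pos (Sum.inr x)))
  gammaOne_eq : ∀ a x, G.WalkArc w a (Sum.inr x) →
    N.gammaOne M a (Sum.inr x) = c + S (N.pos (Sum.inr x))
  onSide : ∀ s : ℝ, (s = 1 ∨ s = -1) → ∀ z, OnSide (N.walkEdges w) s z →
    crossCount N.ray (N.walkEdges w) z = c + sideShift s
  joinedIn : ∀ z z', JoinedIn ({z | 0 ≤ z.im} \ edgeTrace (N.walkEdges w)) z z' →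
    crossCount N.ray (N.walkEdges w) z = crossCount N.ray (N.walkEdges w) z'
  real : ∀ k, Sum.inl k ∉ w.support →
    crossCount N.ray (N.walkEdges w) (N.pos (Sum.inl k)) = S (N.pos (Sum.inl k))
  start : ∀ k b, G.WalkArc w (Sum.inl k) b → S (N.pos (Sum.inl k)) = c
  finish : ∀ k a, G.WalkArc w a (Sum.inl k) → S (N.pos (Sum.inl k)) = c + 1
  sideSum : ∀ (hO : G.IsPerfectOrientation (G.reverseAlong N.arc w)) a,
    (N.withArc _ hO).sideSum a = N.sideSum a + S (N.pos a)

lemma previous_eq {u v : Fin n ⊕ J} {w : G.graph.Walk u v} (hw : IsSimpleDirected N.arc w) {x : J}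
    {a : Fin n ⊕ J} (h : G.WalkArc w a (Sum.inr x)) : previous w x = a :=
  hw.snd_unique (Classical.epsilon_spec_aux _ (fun a => G.WalkArc w a (Sum.inr x)) ⟨a, h⟩) h

lemma following_eq {u v : Fin n ⊕ J} {w : G.graph.Walk u v} (hw : IsSimpleDirected N.arc w) {x : J}
    {a : Fin n ⊕ J} (h : G.WalkArc w (Sum.inr x) a) : following w x = a :=
  hw.fst_unique (Classical.epsilon_spec_aux _ (fun a => G.WalkArc w (Sum.inr x) a) ⟨a, h⟩) h

lemma pos_notMem_trace {u v : Fin n ⊕ J} {w : G.graph.Walk u v} (hlen : 0 < w.length)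
    {a : Fin n ⊕ J} (ha : a ∉ w.support) : N.pos a ∉ edgeTrace (N.walkEdges w) := by
  rintro ⟨e, he, hz⟩
  obtain ⟨c, d, h, rfl⟩ := mem_walkEdges.mp he
  rw [← insert_endpoints_openSegment] at hz
  rcases hz with hz | hz | hz
  · exact ha (N.drawing.injective hz ▸ (mem_support_iff_walkArc hlen).mpr ⟨d, Or.inl h⟩)
  · exact ha (N.drawing.injective hz ▸ (mem_support_iff_walkArc hlen).mpr ⟨c, Or.inr h⟩)
  · exact N.drawing.vertex_not_on_edge c d a h.adj hz

lemma openSegment_disjoint_trace {u v : Fin n ⊕ J} {w : G.graph.Walk u v} {a b : Fin n ⊕ J}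
    (h : G.graph.Adj a b) (h1 : ¬ G.WalkArc w a b) (h2 : ¬ G.WalkArc w b a) {z : ℂ}
    (hz : z ∈ openSegment ℝ (N.pos a) (N.pos b)) : z ∉ edgeTrace (N.walkEdges w) := by
  rintro ⟨e, he, hz'⟩
  obtain ⟨c, d, hcd, rfl⟩ := mem_walkEdges.mp he
  rw [← insert_endpoints_openSegment] at hz'
  rcases hz' with hz' | hz' | hz'
  · exact N.drawing.vertex_not_on_edge a b c h (by rw [hz'] at hz; exact hz)
  · exact N.drawing.vertex_not_on_edge a b d h (by rw [hz'] at hz; exact hz)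
  · refine Set.disjoint_left.mp (N.drawing.edges_disjoint a b c d h hcd.adj fun hs => ?_) hz hz'
    rcases Sym2.eq_iff.mp hs with ⟨rfl, rfl⟩ | ⟨rfl, rfl⟩
    · exact h1 hcd
    · exact h2 hcd

/-- The midpoint of an edge. -/
noncomputable def middle (N : G.GaugedGraph) (a b : Fin n ⊕ J) : ℂ := midpoint ℝ (N.pos a) (N.pos b)

lemma middle_comm (a b : Fin n ⊕ J) : N.middle a b = N.middle b a := midpoint_comm _ _

lemma middle_mem {a b : Fin n ⊕ J} : N.middle a b ∈ openSegment ℝ (N.pos a) (N.pos b) :=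
  ⟨1 / 2, 1 / 2, by norm_num, by norm_num, by norm_num, by
    rw [middle, midpoint_eq_smul_add, smul_add]; norm_num⟩

namespace IsReversalData

variable {u v : Fin n ⊕ J} {w : G.graph.Walk u v} {M : Set ℂ} {S : ℂ → ZMod 2} {c : ZMod 2}
  (D : IsReversalData N w M S c)
include D

lemma crossCount_openSegment {a b : Fin n ⊕ J} (h : G.graph.Adj a b) (h1 : ¬ G.WalkArc w a b)
    (h2 : ¬ G.WalkArc w b a) {z : ℂ} (hz : z ∈ openSegment ℝ (N.pos a) (N.pos b)) :
    crossCount N.ray (N.walkEdges w) z = crossCount N.ray (N.walkEdges w) (N.middle a b) := by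
  refine D.joinedIn _ _ (JoinedIn.of_segment_subset fun y hy => ?_)
  have hy' := (convex_openSegment _ _).segment_subset hz middle_mem hy
  exact ⟨show 0 ≤ y.im from le_of_lt (openSegment_upper h hy' : 0 < y.im),
    openSegment_disjoint_trace h h1 h2 hy'⟩

/-- Off the path, the crossing count of a vertex is that of its edges. -/
lemma crossCount_pos {a b : Fin n ⊕ J} (h : G.graph.Adj a b) (ha : a ∉ w.support) :
    crossCount N.ray (N.walkEdges w) (N.pos a) =
      crossCount N.ray (N.walkEdges w) (N.middle a b) := by
  have h1 : ¬ G.WalkArc w a b := fun h => ha ((mem_support_iff_walkArc D.length_pos).mpr ⟨b,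
      Or.inl h⟩)
  have h2 : ¬ G.WalkArc w b a := fun h => ha ((mem_support_iff_walkArc D.length_pos).mpr ⟨b,
      Or.inr h⟩)
  refine D.joinedIn _ _ (JoinedIn.of_segment_subset fun y hy => ?_)
  rw [segment_eq_image'] at hy
  obtain ⟨t, ⟨h0, h3⟩, rfl⟩ := hy
  rcases h0.eq_or_lt with rfl | h0
  · beta_reduce
    rw [zero_smul, add_zero]
    exact ⟨im_nonneg a, pos_notMem_trace D.length_pos ha⟩
  · have hy' : N.pos a + t • (N.middle a b - N.pos a) ∈ openSegment ℝ (N.pos a) (N.pos b) := by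
      rw [openSegment_eq_image']
      refine ⟨t / 2, ⟨by linarith, by linarith⟩, ?_⟩
      have hm : N.middle a b - N.pos a = (1 / 2 : ℝ) • (N.pos b - N.pos a) := by
        rw [middle, midpoint_sub_left]; norm_num
      beta_reduce
      rw [hm, smul_smul]; congr 2; ring
    beta_reduce
    generalize N.pos a + t • (N.middle a b - N.pos a) = y at hy' ⊢
    exact ⟨show 0 ≤ y.im from le_of_lt (openSegment_upper h hy' : 0 < y.im),
      openSegment_disjoint_trace h h1 h2 hy'⟩

/-- At a vertex of the path, the winding numbers of the path with a third edge change on reversal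
according to the side of the third edge. -/
lemma crossParity_vertex {a b t : Fin n ⊕ J} {x : J} (ha : G.WalkArc w a (Sum.inr x))
    (hb : G.WalkArc w (Sum.inr x) b) (ht : G.graph.Adj (Sum.inr x) t) (hta : t ≠ a) (htb : t ≠ b) :
    crossParity N.ray (N.vec a (Sum.inr x)) (N.vec (Sum.inr x) t) +
        crossParity N.ray (N.vec b (Sum.inr x)) (N.vec (Sum.inr x) t) =
      crossParity N.ray (N.vec a (Sum.inr x)) (N.vec (Sum.inr x) b) +
        sideParity N.ray (N.vec (Sum.inr x) b) + c +
        crossCount N.ray (N.walkEdges w) (N.middle (Sum.inr x) t) ∧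
    crossParity N.ray (N.vec t (Sum.inr x)) (N.vec (Sum.inr x) b) +
        crossParity N.ray (N.vec t (Sum.inr x)) (N.vec (Sum.inr x) a) =
      crossParity N.ray (N.vec a (Sum.inr x)) (N.vec (Sum.inr x) b) +
        sideParity N.ray (N.vec a (Sum.inr x)) + 1 + c +
        crossCount N.ray (N.walkEdges w) (N.middle (Sum.inr x) t) := by
  have hE := isSimpleCurve D.simple
  have hl := N.ray_ne_zero
  have hab : a ≠ b := arc_trans_ne (D.simple.directed _ _ ha) (D.simple.directed _ _ hb)
  have n1 : ¬ G.WalkArc w (Sum.inr x) t := fun h => htb (D.simple.fst_unique h hb)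
  have n2 : ¬ G.WalkArc w t (Sum.inr x) := fun h => hta (D.simple.snd_unique h ha)
  have hva : N.vec (Sum.inr x) a = - N.vec a (Sum.inr x) := N.vec_swap _ _
  have hα : HasAngle 1 (N.vec (Sum.inr x) b) _ :=
    HasAngle.arg_div one_ne_zero (N.vec_ne_zero hb.adj)
  set α := (N.vec (Sum.inr x) b / 1).arg
  obtain ⟨β, hβ, h1, h2⟩ := exists_angle_between (x := N.vec (Sum.inr x) a)
    (by rw [← N.vec_swap]; exact N.vec_zero_notMem ha.adj hb.adj hab) hα
  obtain ⟨φ, hφ, h3, h4⟩ := exists_angle_between (x := N.vec (Sum.inr x) t)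
    (by rw [← N.vec_swap]; exact N.vec_zero_notMem ht.symm hb.adj htb) hα
  have hne : φ ≠ β := by
    rintro rfl
    refine N.vec_zero_notMem ha.adj ht (Ne.symm hta) ?_
    rw [N.vec_swap]
    exact zero_mem_segment_of_angle hβ.neg' hφ (by simp)
  obtain ⟨s, hs⟩ : ∃ s : ℝ, (s = 1 ∧ α < φ ∧ φ < β) ∨ (s = -1 ∧ β < φ ∧ φ < α + 2 * Real.pi) := by
    rcases lt_or_gt_of_ne hne with h | h
    · exact ⟨1, Or.inl ⟨rfl, h3, h⟩⟩
    · exact ⟨-1, Or.inr ⟨rfl, h, h4⟩⟩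
  have hs' : s = 1 ∨ s = -1 := hs.imp And.left And.left
  -- the side of the third edge is the crossing count at its midpoint
  have hX : crossCount N.ray (N.walkEdges w) (N.middle (Sum.inr x) t) = c + sideShift s := by
    have hev := hE.eventually_onSide_vertex (walkEdges_of_walkArc ha) (walkEdges_of_walkArc hb) rfl
      (N.drawing.internal_pos x) hα hβ h1 h2 hφ s hs
    have hlt : ∀ᶠ τ : ℝ in 𝓝[>] 0, τ < 1 := nhdsWithin_le_nhds (Iio_mem_nhds one_pos)
    obtain ⟨τ, ⟨g1, g2⟩, g3⟩ := ((hev.and hlt).and self_mem_nhdsWithin).exists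
    have g3' : 0 < τ := g3
    rw [← D.onSide s hs' _ g1]
    refine (D.crossCount_openSegment ht n1 n2 ?_).symm
    rw [openSegment_eq_image']
    exact ⟨τ, ⟨g3', g2⟩, by simp [vec]⟩
  -- pass to the angles from the ray direction
  have hlam : HasAngle 1 N.ray _ := HasAngle.arg_div one_ne_zero hl
  set lam := (N.ray / 1).arg
  have tr : ∀ {y : ℂ} {θ : ℝ}, HasAngle 1 y θ → HasAngle N.ray y (θ - lam) := fun {y θ} h => by
    have := hlam.symm.trans h
    rwa [neg_add_eq_sub] at this
  have hs2 : (s = 1 ∧ α - lam < φ - lam ∧ φ - lam < β - lam) ∨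
      (s = -1 ∧ β - lam < φ - lam ∧ φ - lam < α - lam + 2 * Real.pi) := by
    rcases hs with ⟨h, h', h''⟩ | ⟨h, h', h''⟩
    · exact Or.inl ⟨h, by linarith, by linarith⟩
    · exact Or.inr ⟨h, by linarith, by linarith⟩
  have hβ2 := tr hβ
  rw [hva] at hβ2
  have r1 := crossParity_third_out hl (tr hα) hβ2 (by linarith) (by linarith) (tr hφ) hs2
    (N.vec_not_parallel hb.adj)
  have r2 := crossParity_third_in hl (tr hα) hβ2 (by linarith) (by linarith) (tr hφ) hs2
    (N.vec_not_parallel ha.adj)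
  rw [← N.vec_swap] at r1
  rw [← N.vec_swap, ← N.vec_swap] at r2
  rw [hX]
  have hc := CharTwo.add_self_eq_zero c
  exact ⟨by linear_combination r1 - hc, by linear_combination r2 - hc⟩

/-- At a vertex of the path, the winding numbers along the path before and after the reversal
differ by the sides of the two edges. -/
lemma crossParity_along {a b : Fin n ⊕ J} {x : J} (ha : G.WalkArc w a (Sum.inr x))
    (hb : G.WalkArc w (Sum.inr x) b) :
    crossParity N.ray (N.vec b (Sum.inr x)) (N.vec (Sum.inr x) a) +
      crossParity N.ray (N.vec a (Sum.inr x)) (N.vec (Sum.inr x) b) =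
    sideParity N.ray (N.vec a (Sum.inr x)) + sideParity N.ray (N.vec (Sum.inr x) b) := by
  have hl := N.ray_ne_zero
  have hab : a ≠ b := arc_trans_ne (D.simple.directed _ _ ha) (D.simple.directed _ _ hb)
  have hα : HasAngle N.ray (N.vec (Sum.inr x) b) _ := HasAngle.arg_div hl (N.vec_ne_zero hb.adj)
  obtain ⟨β, hβ, h1, h2⟩ := exists_angle_between (x := N.vec (Sum.inr x) a)
    (by rw [← N.vec_swap]; exact N.vec_zero_notMem ha.adj hb.adj hab) hα
  rw [N.vec_swap a (Sum.inr x)] at hβ ⊢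
  rw [N.vec_swap (Sum.inr x) b]
  exact crossParity_reverse hl hα hβ h1 h2 (N.vec_not_parallel ha.adj) (N.vec_not_parallel hb.adj)

end IsReversalData

end GaugedGraph

end PlabicGraph

/-! ### The change of the signature under reversal -/

namespace PlabicGraph

variable {n : ℕ} {J : Type*} {G : PlabicGraph n J}

namespace GaugedGraph

variable {N : G.GaugedGraph}

lemma reversalGauge_of_notMem {u v : Fin n ⊕ J} {w : G.graph.Walk u v} {M : Set ℂ} {x : J}
    (h : Sum.inr x ∉ w.support) {a b : ZMod 2} (hM : N.pos (Sum.inr x) ∈ M ↔ a ≠ b) :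
    N.reversalGauge w M x = a + b := by
  rw [reversalGauge, if_neg h]
  simp only [hM]
  clear hM
  revert a b; decide

namespace IsReversalData

variable {u v : Fin n ⊕ J} {w : G.graph.Walk u v} {M : Set ℂ} {S : ℂ → ZMod 2} {c : ZMod 2}
  (D : IsReversalData N w M S c)
include D

lemma notMem_support {a b : Fin n ⊕ J} {k : Fin n} (hb : G.graph.Adj (Sum.inl k) b)
    (ha : a = Sum.inl k) (h1 : ¬ G.WalkArc w a b) (h2 : ¬ G.WalkArc w b a) : a ∉ w.support := by
  subst ha
  rw [mem_support_iff_walkArc D.length_pos]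
  rintro ⟨d, h | h⟩
  · exact h1 (boundary_neighbour_unique h.adj hb ▸ h)
  · exact h2 (boundary_neighbour_unique h.adj.symm hb ▸ h)

lemma reversalGauge_white {x : J} (hx : G.colour x = VertexColour.white) {a b : Fin n ⊕ J}
    (ha : G.WalkArc w a (Sum.inr x)) (hb : G.WalkArc w (Sum.inr x) b) :
    N.reversalGauge w M x = crossParity N.ray (N.vec a (Sum.inr x)) (N.vec (Sum.inr x) b) + c +
      S (N.pos (Sum.inr x)) + sideParity N.ray (N.vec (Sum.inr x) b) := by
  rw [reversalGauge, if_pos ((mem_support_iff_walkArc D.length_pos).mpr ⟨b, Or.inl hb⟩)]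
  simp only [hx, previous_eq D.simple ha, following_eq D.simple hb]
  rw [N.wind_cast ha.adj hb.adj (arc_trans_ne (D.simple.directed _ _ ha) (D.simple.directed _ _
      hb)),
    D.gammaOne_eq _ _ ha, gammaTwo_eq hb.adj]
  linear_combination CharTwo.two_eq_zero (R := ZMod 2)

lemma reversalGauge_black {x : J} (hx : G.colour x = VertexColour.black) {a b : Fin n ⊕ J}
    (ha : G.WalkArc w a (Sum.inr x)) (hb : G.WalkArc w (Sum.inr x) b) :
    N.reversalGauge w M x = crossParity N.ray (N.vec a (Sum.inr x)) (N.vec (Sum.inr x) b) + c +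
      S (N.pos (Sum.inr x)) + sideParity N.ray (N.vec a (Sum.inr x)) + 1 := by
  rw [reversalGauge, if_pos ((mem_support_iff_walkArc D.length_pos).mpr ⟨b, Or.inl hb⟩)]
  simp only [hx, previous_eq D.simple ha, following_eq D.simple hb]
  rw [N.wind_cast ha.adj hb.adj (arc_trans_ne (D.simple.directed _ _ ha) (D.simple.directed _ _
      hb)),
    D.gammaOne_eq _ _ ha, gammaTwo_eq ha.adj]
  ring

/-- The change of the contribution of a half-edge outside of the path: the gauge function and the
change of the side of the gauge rays at the vertex, and the crossing count on the edge. -/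
lemma halfEdge_off (hO : G.IsPerfectOrientation (G.reverseAlong N.arc w)) {a b : Fin n ⊕ J}
    (h : G.graph.Adj a b) (h1 : ¬ G.WalkArc w a b) (h2 : ¬ G.WalkArc w b a) :
    (N.withArc _ hO).halfEdge a b = N.halfEdge a b + extendGauge (N.reversalGauge w M) a +
      S (N.pos a) + crossCount N.ray (N.walkEdges w) (N.middle a b) := by
  set N' := N.withArc _ hO with hN'
  have harc : N'.arc a b ↔ N.arc a b := reverseAlong_iff h1 h2
  -- The cases are: a boundary vertex; a vertex of the path, at which `ab` is a third edge,
  -- outgoing if the vertex is white and incoming if it is black; an internal vertex off the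
  -- path.
  rcases a with k | x
  · have hk := D.notMem_support h rfl h1 h2
    have hh : N'.halfEdge (Sum.inl k) b = N.halfEdge (Sum.inl k) b := by
      simp only [halfEdge]; classical exact if_congr harc rfl rfl
    rw [hh, ← D.crossCount_pos h hk, D.real k hk, add_assoc, CharTwo.add_self_eq_zero]
    simp [extendGauge]
  · by_cases hx : Sum.inr x ∈ w.support
    · obtain ⟨d, hd, e, he⟩ : ∃ d, G.WalkArc w d (Sum.inr x) ∧ ∃ e, G.WalkArc w (Sum.inr x) e := by
        obtain ⟨d, hd | hd⟩ := (mem_support_iff_walkArc D.length_pos).mp hx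
        · obtain ⟨e, he⟩ := D.simple.exists_prev x d hd
          exact ⟨e, he, d, hd⟩
        · obtain ⟨e, he⟩ := D.simple.exists_next x d hd
          exact ⟨d, hd, e, he⟩
      have hbd : b ≠ d := fun h => h2 (h ▸ hd)
      have hbe : b ≠ e := fun h => h1 (h ▸ he)
      have hid := D.simple.directed _ _ hd
      have hie := D.simple.directed _ _ he
      obtain ⟨r1, r2⟩ := D.crossParity_vertex hd he h hbd hbe
      cases hcol : G.colour x
      · have hab : N.arc (Sum.inr x) b := ((N.perfect.adj_iff _ _).mp h).resolve_right fun h' =>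
          hbd ((N.perfect.white x hcol).unique h' hid)
        simp only [halfEdge, hcol, if_pos hab, if_pos (harc.mpr hab), extendGauge, Sum.elim_inr]
        rw [N.incoming_eq hcol hid, N'.incoming_eq hcol (Or.inr he), N.wind_cast hd.adj h hbd.symm,
          N'.wind_cast he.adj.symm h hbe.symm, D.reversalGauge_white hcol hd he]
        change 1 + crossParity N.ray (N.vec e (Sum.inr x)) (N.vec (Sum.inr x) b) = _
        have t := CharTwo.add_self_eq_zero (crossParity N.ray (N.vec d (Sum.inr x)) (N.vec (Sum.inr
            x) b))
        have t' := CharTwo.add_self_eq_zero (S (N.pos (Sum.inr x)))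
        linear_combination r1 - t - t'
      · have hba : N.arc b (Sum.inr x) := ((N.perfect.adj_iff _ _).mp h).resolve_left fun h' =>
          hbe ((N.perfect.black x hcol).unique h' hie)
        have hn := N.perfect.asymm _ _ hba
        simp only [halfEdge, hcol, if_neg hn, if_neg (mt harc.mp hn), extendGauge, Sum.elim_inr]
        rw [N.outgoing_eq hcol hie, N'.outgoing_eq hcol (Or.inr hd), N.wind_cast h.symm he.adj hbe,
          N'.wind_cast h.symm hd.adj.symm hbd, D.reversalGauge_black hcol hd he]
        change crossParity N.ray (N.vec b (Sum.inr x)) (N.vec (Sum.inr x) d) = _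
        have t := CharTwo.add_self_eq_zero (crossParity N.ray (N.vec b (Sum.inr x)) (N.vec (Sum.inr
            x) e))
        have t' := CharTwo.add_self_eq_zero (S (N.pos (Sum.inr x)))
        linear_combination r2 - t - t'
    · have harc' : ∀ d, N'.arc d (Sum.inr x) ↔ N.arc d (Sum.inr x) := fun d =>
        reverseAlong_iff (fun h => hx ((mem_support_iff_walkArc D.length_pos).mpr ⟨d, Or.inr h⟩))
          fun h => hx ((mem_support_iff_walkArc D.length_pos).mpr ⟨d, Or.inl h⟩)
      have harc'' : ∀ d, N'.arc (Sum.inr x) d ↔ N.arc (Sum.inr x) d := fun d =>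
        reverseAlong_iff (fun h => hx ((mem_support_iff_walkArc D.length_pos).mpr ⟨d, Or.inl h⟩))
          fun h => hx ((mem_support_iff_walkArc D.length_pos).mpr ⟨d, Or.inr h⟩)
      have hh : N'.halfEdge (Sum.inr x) b = N.halfEdge (Sum.inr x) b := by
        cases hcol : G.colour x
        · simp only [halfEdge, hcol, N'.incoming_eq hcol ((harc' _).mpr (N.incoming_spec hcol))]
          classical exact if_congr harc rfl rfl
        · simp only [halfEdge, hcol, N'.outgoing_eq hcol ((harc'' _).mpr (N.outgoing_spec hcol))]
          classical exact if_congr harc rfl rfl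
      rw [hh, ← D.crossCount_pos h hx]
      simp only [extendGauge, Sum.elim_inr]
      rw [reversalGauge_of_notMem hx (D.mem_iff x hx)]
      have t := CharTwo.add_self_eq_zero (S (N.pos (Sum.inr x)))
      have t' := CharTwo.add_self_eq_zero
        (crossCount N.ray (N.walkEdges w) (N.pos (Sum.inr x)))
      linear_combination - t - t'

/-- The change of the contribution of a half-edge of the path, at its tail. -/
lemma halfEdge_tail (hO : G.IsPerfectOrientation (G.reverseAlong N.arc w)) {a b : Fin n ⊕ J}
    (h : G.WalkArc w a b) :
    (N.withArc _ hO).halfEdge a b = N.halfEdge a b + extendGauge (N.reversalGauge w M) a +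
      S (N.pos a) + c + 1 + sideParity N.ray (N.vec a b) := by
  set N' := N.withArc _ hO with hN'
  have hab := D.simple.directed _ _ h
  have hba' : N'.arc b a := Or.inr h
  have hn' : ¬ N'.arc a b := N'.perfect.asymm _ _ hba'
  have t := CharTwo.add_self_eq_zero c
  rcases a with k | x
  · simp only [halfEdge, if_pos hab, if_neg hn', extendGauge, Sum.elim_inl]
    rw [D.start k b h]
    linear_combination -t - CharTwo.add_self_eq_zero (1 + sideParity N.ray (N.vec (Sum.inl k) b))
  · obtain ⟨d, hd⟩ := D.simple.exists_prev x b h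
    have hid := D.simple.directed _ _ hd
    have hdb : d ≠ b := arc_trans_ne hid hab
    have t' := CharTwo.add_self_eq_zero (S (N.pos (Sum.inr x)))
    cases hcol : G.colour x
    · simp only [halfEdge, hcol, if_pos hab, if_neg hn', extendGauge, Sum.elim_inr]
      rw [N.incoming_eq hcol hid, N.wind_cast hd.adj h.adj hdb, D.reversalGauge_white hcol hd h]
      linear_combination - t - t' - CharTwo.add_self_eq_zero
        (1 + crossParity N.ray (N.vec d (Sum.inr x)) (N.vec (Sum.inr x) b) +
          sideParity N.ray (N.vec (Sum.inr x) b))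
    · simp only [halfEdge, hcol, if_pos hab, if_neg hn', extendGauge, Sum.elim_inr]
      rw [N'.outgoing_eq hcol (Or.inr hd), N'.wind_cast h.adj.symm hd.adj.symm hdb.symm,
        D.reversalGauge_black hcol hd h]
      change crossParity N.ray (N.vec b (Sum.inr x)) (N.vec (Sum.inr x) d) = _
      have r := D.crossParity_along hd h
      linear_combination r - t - t' - CharTwo.two_eq_zero (R := ZMod 2) - CharTwo.add_self_eq_zero
        (crossParity N.ray (N.vec d (Sum.inr x)) (N.vec (Sum.inr x) b))

/-- The change of the contribution of a half-edge of the path, at its head. -/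
lemma halfEdge_head (hO : G.IsPerfectOrientation (G.reverseAlong N.arc w)) {a b : Fin n ⊕ J}
    (h : G.WalkArc w a b) :
    (N.withArc _ hO).halfEdge b a = N.halfEdge b a + extendGauge (N.reversalGauge w M) b +
      S (N.pos b) + c + 1 + sideParity N.ray (N.vec a b) := by
  set N' := N.withArc _ hO with hN'
  have hab := D.simple.directed _ _ h
  have hba' : N'.arc b a := Or.inr h
  have hn : ¬ N.arc b a := N.perfect.asymm _ _ hab
  have t := CharTwo.add_self_eq_zero c
  rcases b with k | x
  · simp only [halfEdge, if_pos hba', if_neg hn, extendGauge, Sum.elim_inl]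
    change 1 + sideParity N.ray (N.vec (Sum.inl k) a) = _
    rw [D.finish k a h, sideParity_vec_swap h.adj]
    linear_combination -t
  · obtain ⟨d, hd⟩ := D.simple.exists_next x a h
    have hid := D.simple.directed _ _ hd
    have had : a ≠ d := arc_trans_ne hab hid
    have t' := CharTwo.add_self_eq_zero (S (N.pos (Sum.inr x)))
    cases hcol : G.colour x
    · simp only [halfEdge, hcol, if_pos hba', if_neg hn, extendGauge, Sum.elim_inr]
      rw [N'.incoming_eq hcol (Or.inr hd), N'.wind_cast hd.adj.symm h.adj.symm had.symm,
        D.reversalGauge_white hcol h hd]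
      change 1 + crossParity N.ray (N.vec d (Sum.inr x)) (N.vec (Sum.inr x) a) = _
      have r := D.crossParity_along h hd
      linear_combination r - t - t' - CharTwo.add_self_eq_zero
        (crossParity N.ray (N.vec a (Sum.inr x)) (N.vec (Sum.inr x) d))
    · simp only [halfEdge, hcol, if_pos hba', if_neg hn, extendGauge, Sum.elim_inr]
      rw [N.outgoing_eq hcol hid, N.wind_cast h.adj hd.adj had, D.reversalGauge_black hcol h hd]
      linear_combination - t - t' - CharTwo.two_eq_zero (R := ZMod 2) - CharTwo.add_self_eq_zero
        (crossParity N.ray (N.vec a (Sum.inr x)) (N.vec (Sum.inr x) d) +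
          sideParity N.ray (N.vec a (Sum.inr x)))

/-- The reversal along a path or cycle acts by its gauge function: the terms that do not come
from the gauge function appear at both ends of each edge and cancel. -/
lemma gaugeTransforms (hO : G.IsPerfectOrientation (G.reverseAlong N.arc w)) :
    G.GaugeTransforms (N.reversalGauge w M) N.signature (N.withArc _ hO).signature := by
  have key : ∀ a b, G.WalkArc w a b → (N.withArc _ hO).signature a b = N.signature a b +
      extendGauge (N.reversalGauge w M) a + extendGauge (N.reversalGauge w M) b := by
    intro a b h
    rw [(N.withArc _ hO).signature_eq h.adj, N.signature_eq h.adj, D.halfEdge_tail hO h,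
      D.halfEdge_head hO h, D.sideSum hO a, D.sideSum hO b]
    linear_combination CharTwo.add_self_eq_zero
      (S (N.pos a) + S (N.pos b) + c + 1 + sideParity N.ray (N.vec a b))
  intro a b h
  by_cases h1 : G.WalkArc w a b
  · exact key a b h1
  by_cases h2 : G.WalkArc w b a
  · rw [(N.withArc _ hO).signature_comm a b h, N.signature_comm a b h, key b a h2]; ring
  rw [(N.withArc _ hO).signature_eq h, N.signature_eq h, D.halfEdge_off hO h h1 h2,
    D.halfEdge_off hO h.symm h2 h1, D.sideSum hO a, D.sideSum hO b, middle_comm b a]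
  linear_combination CharTwo.add_self_eq_zero
    (S (N.pos a) + S (N.pos b) + crossCount N.ray (N.walkEdges w) (N.middle a b))

end IsReversalData

/-- The index `γ₁` is determined by the points near the end of the edge on its left. -/
lemma gammaOne_of_eventually {M : Set ℂ} {a b : Fin n ⊕ J} {p q : ZMod 2}
    (h : ∀ᶠ δ : ℝ in 𝓝[>] 0, ∀ᶠ τ : ℝ in 𝓝[>] 0,
      (N.pos b - δ * N.vec a b + τ * (Complex.I * N.vec a b) ∈ M ↔ p ≠ q)) :
    N.gammaOne M a b = p + q := by
  rw [gammaOne]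
  by_cases hP : p = q
  · rw [if_neg, hP, CharTwo.add_self_eq_zero]
    intro h'
    obtain ⟨δ, h1, h2⟩ := (h.and h').exists
    obtain ⟨τ, h3, h4⟩ := (h1.and h2).exists
    exact h3.mp h4 hP
  · rw [if_pos (h.mono fun δ h1 => h1.mono fun τ h2 => h2.mpr hP)]
    clear h
    revert p q; decide

/-- Points on the left of an edge of the path near its end. -/
lemma eventually_onSide_end {u v : Fin n ⊕ J} {w : G.graph.Walk u v}
    (hw : IsSimpleDirected N.arc w) {a b : Fin n ⊕ J} (h : G.WalkArc w a b) :
    ∀ᶠ δ : ℝ in 𝓝[>] 0, ∀ᶠ τ : ℝ in 𝓝[>] 0,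
      N.pos b - δ * N.vec a b + τ * (Complex.I * N.vec a b) ∈
        upperPlane \ edgeTrace (N.walkEdges w) ∧
      OnSide (N.walkEdges w) 1 (N.pos b - δ * N.vec a b + τ * (Complex.I * N.vec a b)) := by
  have hlt : ∀ᶠ δ : ℝ in 𝓝[>] 0, δ < 1 := nhdsWithin_le_nhds (Iio_mem_nhds one_pos)
  filter_upwards [hlt, self_mem_nhdsWithin] with δ h1 h2
  have h2' : 0 < δ := h2
  have hx : N.pos b - δ * N.vec a b ∈ openSegment ℝ (N.pos a) (N.pos b) := by
    refine ⟨δ, 1 - δ, h2', by linarith, by ring, ?_⟩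
    simp only [vec, Complex.real_smul]; push_cast; ring
  have := (isSimpleCurve hw).eventually_onSide (Or.inl rfl) (walkEdges_of_walkArc h) hx
  simpa [vec] using this

/-- A property that holds near the end of an edge holds at the points on the left of the edge
near its end. -/
lemma eventually_near_end (a b : Fin n ⊕ J) {P : ℂ → Prop} (h : ∀ᶠ y in 𝓝 (N.pos b), P y) :
    ∀ᶠ δ : ℝ in 𝓝[>] 0, ∀ᶠ τ : ℝ in 𝓝[>] 0,
      P (N.pos b - δ * N.vec a b + τ * (Complex.I * N.vec a b)) := by
  have h1 : Filter.Tendsto (fun δ : ℝ => N.pos b - δ * N.vec a b) (𝓝[>] 0) (𝓝 (N.pos b)) := by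
    have := tendsto_germ (N.pos b) (-N.vec a b)
    simpa [sub_eq_add_neg] using this
  exact (h1.eventually h.eventually_nhds).mono fun δ hδ => (tendsto_germ _ _).eventually hδ

end GaugedGraph

end PlabicGraph

/-! ### Reversal along a path between boundary vertices and along a cycle -/

namespace PlabicGraph

variable {n : ℕ} {J : Type*} {G : PlabicGraph n J}

namespace GaugedGraph

variable {N : G.GaugedGraph}

section Path

variable {i j : Fin n} {w : G.graph.Walk (Sum.inl i) (Sum.inl j)}

/-- The sources after the reversal along a path: the starting point is replaced by the end. -/
lemma isSource_reverse_path (hw : N.IsReversiblePath i j w)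
    (hO : G.IsPerfectOrientation (G.reverseAlong N.arc w)) (k : Fin n) :
    (N.withArc _ hO).IsSource k ↔ (N.IsSource k ∧ k ≠ i) ∨ k = j := by
  obtain ⟨hi, ⟨b, hb⟩, hp, hd⟩ := hw
  have hij : i ≠ j := by
    rintro rfl
    obtain ⟨a, ha⟩ := hi
    exact N.perfect.not_boundary_through hb ha
  have hlen : 0 < w.length := by
    rw [Nat.pos_iff_ne_zero]
    exact fun h => hij (Sum.inl_injective (SimpleGraph.Walk.eq_of_length_eq_zero h))
  have hfirst : G.WalkArc w (Sum.inl i) (w.getVert 1) :=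
    (walkArc_iff w _ _).mpr ⟨0, hlen, by simp, rfl⟩
  have hlast : G.WalkArc w (w.getVert (w.length - 1)) (Sum.inl j) :=
    (walkArc_iff w _ _).mpr ⟨w.length - 1, by omega, rfl, by
      rw [show w.length - 1 + 1 = w.length by omega, SimpleGraph.Walk.getVert_length]⟩
  constructor
  · rintro ⟨a, ⟨h1, h2⟩ | h⟩
    · refine Or.inl ⟨⟨a, h1⟩, ?_⟩
      rintro rfl
      exact h2 (boundary_neighbour_unique hfirst.adj (N.arc_adj h1) ▸ hfirst)
    · right
      by_contra hne
      obtain ⟨c, hc⟩ := exists_next_of_ne h fun h' => hne (Sum.inl_injective h')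
      exact N.perfect.not_boundary_through (hd _ _ h) (hd _ _ hc)
  · rintro (⟨⟨a, ha⟩, hk⟩ | rfl)
    · refine ⟨a, Or.inl ⟨ha, fun h => ?_⟩⟩
      obtain ⟨c, hc⟩ := exists_prev_of_ne h fun h' => hk (Sum.inl_injective h')
      exact N.perfect.not_boundary_through (hd _ _ hc) (hd _ _ h)
    · exact ⟨_, Or.inr hlast⟩

/-- For a path, the ray at `b_i` is replaced by the ray at `b_j`, so that `S` is the strip
parity. -/
lemma isReversalData_path (hw : N.IsReversiblePath i j w) :
    IsReversalData N w (N.pathMinus i j w)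
      (stripParity N.ray (N.pos (Sum.inl i)) (N.pos (Sum.inl j)))
      (sideParity N.ray (N.pos (Sum.inl i) - N.pos (Sum.inl j))) := by
  have hA := isCuttingArc hw
  have hl := N.gauge.inward
  have hs : IsSimpleDirected N.arc w := IsSimpleDirected.of_isPath hw.2.2.1 hw.2.2.2
  have hpp := IsCuttingArc.planeCross_ne_zero hl (N.drawing.boundary_real i)
    (N.drawing.boundary_real j) hA.start_ne_end
  have hij : i ≠ j := fun h => hA.start_ne_end (by rw [h])
  have hlen : 0 < w.length := by
    rw [Nat.pos_iff_ne_zero]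
    exact fun h => hij (Sum.inl_injective (SimpleGraph.Walk.eq_of_length_eq_zero h))
  have hstart : stripParity N.ray (N.pos (Sum.inl i)) (N.pos (Sum.inl j)) (N.pos (Sum.inl i)) =
      sideParity N.ray (N.pos (Sum.inl i) - N.pos (Sum.inl j)) := by
    rw [stripParity, sub_self, sideParity_zero, zero_add]
  have hend : stripParity N.ray (N.pos (Sum.inl i)) (N.pos (Sum.inl j)) (N.pos (Sum.inl j)) =
      sideParity N.ray (N.pos (Sum.inl i) - N.pos (Sum.inl j)) + 1 := by
    rw [stripParity, sub_self, sideParity_zero, add_zero, ← sideParity_neg hpp, neg_sub]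
  exact
    { simple := hs
      length_pos := hlen
      mem_iff := fun x hx => by
        rw [mem_pathMinus_iff hw, and_iff_right]
        exact mem_pathDomain_iff.mpr ⟨N.drawing.internal_pos x, pos_notMem_trace hlen hx,
          N.pos_not_on_ray (by simp), N.pos_not_on_ray (by simp)⟩
      gammaOne_eq := fun a x h => by
        refine gammaOne_of_eventually ?_
        have c : ∀ k : Fin n, ∀ᶠ y in 𝓝 (N.pos (Sum.inr x)),
            planeCross N.ray (y - N.pos (Sum.inl k)) ≠ 0 := fun k => by
          have hc : Continuous fun y : ℂ => planeCross N.ray (y - N.pos (Sum.inl k)) := by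
            unfold planeCross; fun_prop
          exact (hc.tendsto (N.pos (Sum.inr x))).eventually
            (isOpen_ne.mem_nhds (N.pos_not_on_ray (by simp)))
        have hstrip := stripParity_eventuallyEq (l := N.ray)
          (N.pos_not_on_ray (k := i) (v := Sum.inr x) (by simp))
          (N.pos_not_on_ray (k := j) (v := Sum.inr x) (by simp))
        filter_upwards [eventually_onSide_end hs h,
          eventually_near_end a (Sum.inr x) ((c i).and ((c j).and hstrip))] with δ h1 h2
        filter_upwards [h1, h2] with τ h3 h4
        rw [mem_pathMinus_iff hw, and_iff_right, (hA.crossCount_onSide hl).1 _ h3.2, h4.2.2]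
        exact mem_pathDomain_iff.mpr ⟨h3.1.1, h3.1.2, h4.1, h4.2.1⟩
      onSide := fun s hs z hz => hA.crossCount_of_onSide hl hs hz
      joinedIn := fun z z' h => hA.crossCount_eq_of_joinedIn hl h
      real := fun k hk => by
        have h1 : k ≠ i := by rintro rfl; exact hk w.start_mem_support
        have h2 : k ≠ j := by rintro rfl; exact hk w.end_mem_support
        exact hA.crossCount_real_eq hl (N.drawing.boundary_real k)
          (fun h => h1 (Sum.inl_injective (N.drawing.injective h)))
          fun h => h2 (Sum.inl_injective (N.drawing.injective h))
      start := fun k b h => by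
        obtain rfl : k = i := by
          by_contra hne
          obtain ⟨c, hc⟩ := exists_prev_of_ne h fun h' => hne (Sum.inl_injective h')
          exact N.perfect.not_boundary_through (hs.directed _ _ hc) (hs.directed _ _ h)
        exact hstart
      finish := fun k b h => by
        obtain rfl : k = j := by
          by_contra hne
          obtain ⟨c, hc⟩ := exists_next_of_ne h fun h' => hne (Sum.inl_injective h')
          exact N.perfect.not_boundary_through (hs.directed _ _ h) (hs.directed _ _ hc)
        exact hend
      sideSum := fun hO a => by
        classical
        have hj : ¬ N.IsSource j := by
          rintro ⟨b, hb⟩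
          obtain ⟨-, ⟨a, ha⟩, -, -⟩ := hw
          exact N.perfect.not_boundary_through ha hb
        -- Of the two rays concerned, the one at `i` disappears from the sum and the one at `j`
        -- is new.
        have hsum : stripParity N.ray (N.pos (Sum.inl i)) (N.pos (Sum.inl j)) (N.pos a) =
            ∑ k, ((if k = i then sideParity N.ray (N.vec (Sum.inl k) a) else 0) +
              if k = j then sideParity N.ray (N.vec (Sum.inl k) a) else 0) := by
          rw [Finset.sum_add_distrib]
          simp [stripParity, vec]
        rw [hsum, GaugedGraph.sideSum, GaugedGraph.sideSum, ← Finset.sum_add_distrib]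
        refine Finset.sum_congr rfl fun k _ => ?_
        change (if (N.withArc _ hO).IsSource k then sideParity N.ray (N.vec (Sum.inl k) a) else 0)
            = _
        generalize sideParity N.ray (N.vec (Sum.inl k) a) = q
        by_cases h1 : k = i
        · subst h1
          rw [if_neg (by rw [isSource_reverse_path hw]; simp [hij]), if_pos hw.1, if_pos rfl,
            if_neg hij, add_zero, CharTwo.add_self_eq_zero]
        · by_cases h2 : k = j
          · subst h2
            rw [if_pos (by rw [isSource_reverse_path hw]; simp), if_neg hj, if_neg h1, if_pos rfl,
              zero_add, zero_add]
          · rw [if_neg h1, if_neg h2, add_zero, add_zero]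
            refine if_congr ?_ rfl rfl
            rw [isSource_reverse_path hw]
            simp [h1, h2] }

end Path

section Cycle

variable {u : Fin n ⊕ J} {w : G.graph.Walk u u}

lemma not_walkArc_cycle (hw : N.IsReversibleCycle w) {k : Fin n} {a : Fin n ⊕ J} :
    ¬ G.WalkArc w (Sum.inl k) a ∧ ¬ G.WalkArc w a (Sum.inl k) := by
  constructor <;> intro h
  · obtain ⟨c, hc⟩ := exists_prev_of_isCycle hw.1 h
    exact N.perfect.not_boundary_through (hw.2 _ _ hc) (hw.2 _ _ h)
  · obtain ⟨c, hc⟩ := exists_next_of_isCycle hw.1 h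
    exact N.perfect.not_boundary_through (hw.2 _ _ h) (hw.2 _ _ hc)

/-- For a cycle, the sources do not change, and the region inside has odd crossing count. -/
lemma isReversalData_cycle (hw : N.IsReversibleCycle w) :
    ∃ c, IsReversalData N w (N.cycleMinus w) (fun _ => 0) c := by
  have hl := N.gauge.inward
  have hs : IsSimpleDirected N.arc w := IsSimpleDirected.of_isCycle hw.1 hw.2
  have hE := isSimpleCurve hs
  have hB := isEdgeBoundary_cycle hs
  have hB0 : ∀ p ∈ (∅ : Finset ℂ), p.im = 0 ∧ p ∈ edgeTrace (N.walkEdges w) := by simp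
  have hlen : 0 < w.length := lt_of_lt_of_le (by norm_num) hw.1.three_le_length
  have hne : (N.walkEdges w).Nonempty :=
    ⟨_, walkEdges_of_walkArc ((walkArc_iff w _ _).mpr ⟨0, hlen, rfl, rfl⟩)⟩
  have hM : ∀ z, z ∈ upperPlane \ edgeTrace (N.walkEdges w) →
      (z ∈ N.cycleMinus w ↔ crossCount N.ray (N.walkEdges w) z ≠ 0) := by
    intro z hz
    rw [cycleMinus, Set.mem_ofPred_eq, trace_eq_edgeTrace]
    change z ∈ upperPlane \ edgeTrace (N.walkEdges w) ∧ Bornology.IsBounded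
      (connectedComponentIn (upperPlane \ edgeTrace (N.walkEdges w)) z) ↔ _
    rw [and_iff_right hz, hE.isBounded_component_iff hne hl hB hz]
    rcases zmodTwo_eq_zero_or_one (crossCount N.ray (N.walkEdges w) z) with h | h <;> simp [h]
  obtain ⟨c, hc1, hc2⟩ := hE.exists_crossCount_onSide hne hl hB hB0
  refine ⟨c, ?_⟩
  exact
    { simple := hs
      length_pos := hlen
      mem_iff := fun x hx => hM _ ⟨N.drawing.internal_pos x, pos_notMem_trace hlen hx⟩
      gammaOne_eq := fun a x h => by
        refine gammaOne_of_eventually ?_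
        filter_upwards [eventually_onSide_end hs h] with δ h1
        filter_upwards [h1] with τ h3
        rw [hM _ h3.1, hc1 _ h3.2]
      onSide := fun s hs z hz => by
        rcases hs with rfl | rfl
        · rw [sideShift_one, add_zero]; exact hc1 z hz
        · rw [sideShift_neg_one]; exact hc2 z hz
      joinedIn := fun z z' h => crossCount_joinedIn hl hB hB0 h
      real := fun k hk => by
        rw [crossCount_real hl hB (fun e he => ⟨hE.fst_im e he, hE.snd_im e he⟩)
          (N.drawing.boundary_real k) (pos_notMem_trace hlen hk), Finset.sum_empty]
      start := fun k b h => absurd h (not_walkArc_cycle hw).1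
      finish := fun k b h => absurd h (not_walkArc_cycle hw).2
      sideSum := fun hO a => by
        have hsrc : (N.withArc _ hO).IsSource = N.IsSource := by
          funext k
          refine propext (exists_congr fun b => ?_)
          exact reverseAlong_iff (not_walkArc_cycle hw).1 (not_walkArc_cycle hw).2
        rw [add_zero, GaugedGraph.sideSum, GaugedGraph.sideSum, hsrc]
        rfl }

end Cycle

lemma exists_gaugeTransforms_path {i j : Fin n} {w : G.graph.Walk (Sum.inl i) (Sum.inl j)}
    (hw : N.IsReversiblePath i j w) : ∃ h : G.IsPerfectOrientation (G.reverseAlong N.arc w),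
      G.GaugeTransforms (N.reversalGauge w (N.pathMinus i j w))
        N.signature (N.withArc _ h).signature :=
  have D := isReversalData_path hw
  ⟨D.simple.isPerfectOrientation_reverseAlong N.perfect, D.gaugeTransforms _⟩

lemma exists_gaugeTransforms_cycle {u : Fin n ⊕ J} {w : G.graph.Walk u u}
    (hw : N.IsReversibleCycle w) : ∃ h : G.IsPerfectOrientation (G.reverseAlong N.arc w),
      G.GaugeTransforms (N.reversalGauge w (N.cycleMinus w))
        N.signature (N.withArc _ h).signature := by
  obtain ⟨c, D⟩ := isReversalData_cycle hw
  exact ⟨D.simple.isPerfectOrientation_reverseAlong N.perfect, D.gaugeTransforms _⟩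

end GaugedGraph

end PlabicGraph

/-! ### Compositions of elementary transformations -/

namespace PlabicGraph

variable {n : ℕ} {J : Type*} {G : PlabicGraph n J}

lemma GaugeTransforms.refl (ε : Fin n ⊕ J → Fin n ⊕ J → ZMod 2) : G.GaugeTransforms 0 ε ε := by
  intro u v _
  have : ∀ a : Fin n ⊕ J, extendGauge (0 : J → ZMod 2) a = 0 := by rintro (i | x) <;> rfl
  rw [this, this, add_zero, add_zero]

lemma GaugeTransforms.trans {η η' : J → ZMod 2} {ε ε' ε'' : Fin n ⊕ J → Fin n ⊕ J → ZMod 2}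
    (h : G.GaugeTransforms η ε ε') (h' : G.GaugeTransforms η' ε' ε'') :
    G.GaugeTransforms (η + η') ε ε'' := by
  intro u v huv
  have : ∀ a : Fin n ⊕ J, extendGauge (η + η') a = extendGauge η a + extendGauge η' a := by
    rintro (i | x)
    · exact (add_zero 0).symm
    · rfl
  rw [h' u v huv, h u v huv, this, this]
  ring

namespace GaugedGraph

lemma Elementary.gaugeTransforms {N N' : G.GaugedGraph} {η : J → ZMod 2} (h : Elementary N N' η) :
    G.GaugeTransforms η N.signature N'.signature := by
  cases h with
  | path i j w hw hO => exact (isReversalData_path hw).gaugeTransforms hO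
  | cycle u w hw hO =>
    obtain ⟨c, D⟩ := isReversalData_cycle hw
    exact D.gaugeTransforms hO
  | rotation l' hl => exact gaugeTransforms_rotation N l' hl
  | motion u z c hc hz hl => exact gaugeTransforms_motion N u z c hc hz hl

lemma Composition.gaugeTransforms {N N' : G.GaugedGraph} {η : J → ZMod 2}
    (h : Composition N N' η) : G.GaugeTransforms η N.signature N'.signature := by
  induction h with
  | refl => exact GaugeTransforms.refl _
  | step N' N'' η η' _ he ih => exact ih.trans he.gaugeTransforms

lemma Composition.trans {N N' N'' : G.GaugedGraph} {η η' : J → ZMod 2} (h : Composition N N' η)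
    (h' : Composition N' N'' η') : Composition N N'' (η + η') := by
  induction h' with
  | refl => rwa [add_zero]
  | step N₁ N₂ η₁ η₂ _ he ih => rw [← add_assoc]; exact Composition.step _ _ _ _ _ ih he

/-- `N'` is obtained from `N` by elementary transformations. -/
def Connected (N N' : G.GaugedGraph) : Prop := ∃ η, Composition N N' η

lemma Connected.refl (N : G.GaugedGraph) : Connected N N := ⟨0, Composition.refl N⟩

lemma Connected.trans {N N' N'' : G.GaugedGraph} (h : Connected N N') (h' : Connected N' N'') :
    Connected N N'' :=
  ⟨_, h.choose_spec.trans h'.choose_spec⟩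

lemma Elementary.connected {N N' : G.GaugedGraph} {η : J → ZMod 2} (h : Elementary N N' η) :
    Connected N N' :=
  ⟨_, Composition.step _ _ _ _ _ (Composition.refl N) h⟩

end GaugedGraph

/-! ### Any two perfect orientations differ by reversals -/

/-- The arcs of `O` that are reversed in `O'`. -/
def Reversed (O O' : Fin n ⊕ J → Fin n ⊕ J → Prop) (a b : Fin n ⊕ J) : Prop := O a b ∧ O' b a

lemma Reversed.symm {O O' : Fin n ⊕ J → Fin n ⊕ J → Prop} {a b : Fin n ⊕ J}
    (h : Reversed O O' a b) : Reversed O' O b a := ⟨h.2, h.1⟩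

section Reversed

variable {O O' : Fin n ⊕ J → Fin n ⊕ J → Prop} (hO : G.IsPerfectOrientation O)
  (hO' : G.IsPerfectOrientation O')
include hO hO'

/-- If an edge entering an internal vertex is reversed, then so is an edge leaving it: a perfect
orientation has a unique incoming (outgoing) edge at a white (black) vertex. -/
lemma exists_reversed_out {a : Fin n ⊕ J} {x : J} (h : Reversed O O' a (Sum.inr x)) :
    ∃ b, Reversed O O' (Sum.inr x) b := by
  cases hx : G.colour x
  · obtain ⟨b, hb, -⟩ := hO'.white x hx
    refine ⟨b, ?_, hb⟩
    refine ((hO.adj_iff _ _).mp (hO'.adj hb).symm).resolve_right fun h' => ?_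
    rw [(hO.white x hx).unique h' h.1] at hb
    exact hO'.asymm _ _ hb h.2
  · obtain ⟨b, hb, -⟩ := hO.black x hx
    refine ⟨b, hb, ?_⟩
    refine ((hO'.adj_iff _ _).mp (hO.adj hb).symm).resolve_right fun h' => ?_
    rw [(hO'.black x hx).unique h' h.2] at hb
    exact hO.asymm _ _ hb h.1

lemma exists_reversed_in {b : Fin n ⊕ J} {x : J} (h : Reversed O O' (Sum.inr x) b) :
    ∃ a, Reversed O O' a (Sum.inr x) :=
  (exists_reversed_out hO' hO h.symm).imp fun _ h => h.symm

end Reversed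

open Classical in
/-- Two different perfect orientations differ along a path between boundary vertices or along a
cycle: consider a longest path of reversed edges. If one of its ends is an internal vertex, the
path has a continuation by a reversed edge at this end, which by maximality returns to the path
and closes a cycle. -/
lemma exists_reversed_path_or_cycle [Finite J] {O O' : Fin n ⊕ J → Fin n ⊕ J → Prop}
    (hO : G.IsPerfectOrientation O) (hO' : G.IsPerfectOrientation O') {a b : Fin n ⊕ J}
    (hab : Reversed O O' a b) :
    (∃ (i j : Fin n) (w : G.graph.Walk (Sum.inl i) (Sum.inl j)), w.IsPath ∧ 0 < w.length ∧
      ∀ c d, G.WalkArc w c d → Reversed O O' c d) ∨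
    ∃ (u : Fin n ⊕ J) (w : G.graph.Walk u u), w.IsCycle ∧
      ∀ c d, G.WalkArc w c d → Reversed O O' c d := by
  have := Fintype.ofFinite J
  -- the lengths of the paths of reversed edges
  let L : Set ℕ := {m | ∃ (u v : Fin n ⊕ J) (w : G.graph.Walk u v), w.IsPath ∧ w.length = m ∧
    0 < m ∧ ∀ c d, G.WalkArc w c d → Reversed O O' c d}
  have hLne : L.Nonempty := by
    have h := hO.adj hab.1
    refine ⟨1, a, b, h.toWalk, ?_, by simp, one_pos, ?_⟩
    · exact SimpleGraph.Walk.IsPath.of_adj h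
    · rintro c d ⟨h', hm⟩
      simp only [SimpleGraph.Adj.toWalk, SimpleGraph.Walk.darts_cons, SimpleGraph.Walk.darts_nil,
        List.mem_singleton, SimpleGraph.Dart.mk.injEq, Prod.mk.injEq] at hm
      obtain ⟨rfl, rfl⟩ := hm
      exact hab
  have hLb : BddAbove L := ⟨Fintype.card (Fin n ⊕ J), by
    rintro _ ⟨u, v, w, hp, rfl, -, -⟩
    exact hp.length_lt.le⟩
  obtain ⟨u, v, w, hp, hlen, hpos, hw⟩ := Nat.sSup_mem hLne hLb
  have hmax : ∀ {u' v' : Fin n ⊕ J} (w' : G.graph.Walk u' v'), w'.IsPath → 0 < w'.length →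
      (∀ c d, G.WalkArc w' c d → Reversed O O' c d) → w'.length ≤ w.length := by
    intro u' v' w' h1 h2 h3
    rw [hlen]
    exact le_csSup hLb ⟨u', v', w', h1, rfl, h2, h3⟩
  rw [← hlen] at hpos
  -- a reversed edge from the end of a path of reversed edges to its start closes a cycle
  have hclose : ∀ {s t : Fin n ⊕ J} (q : G.graph.Walk s t), q.IsPath →
      (∀ c d, G.WalkArc q c d → Reversed O O' c d) → Reversed O O' t s →
      ∃ (u : Fin n ⊕ J) (w : G.graph.Walk u u), w.IsCycle ∧
        ∀ c d, G.WalkArc w c d → Reversed O O' c d := by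
    intro s t q hq hr hts
    have h := hO.adj hts.1
    refine ⟨t, SimpleGraph.Walk.cons h q, ?_, ?_⟩
    · rw [SimpleGraph.Walk.cons_isCycle_iff]
      refine ⟨hq, fun hm => ?_⟩
      rw [SimpleGraph.Walk.edges, List.mem_map] at hm
      obtain ⟨⟨⟨c, d⟩, hcd⟩, hm, he⟩ := hm
      rcases Sym2.eq_iff.mp he with ⟨h1, h2⟩ | ⟨h1, h2⟩
      · have harc : G.WalkArc q c d := ⟨hcd, hm⟩
        obtain ⟨k, hk, hc, -⟩ := (walkArc_iff q _ _).mp harc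
        have h1' : c = t := h1
        have : k = q.length := hq.getVert_injOn hk.le (show q.length ≤ q.length from le_rfl)
          (by rw [← hc, h1', SimpleGraph.Walk.getVert_length])
        omega
      · have h1' : c = s := h1
        have h2' : d = t := h2
        subst h1' h2'
        exact hO.asymm _ _ hts.1 (hr c d ⟨hcd, hm⟩).1
    · rintro c d ⟨h', hm⟩
      rw [SimpleGraph.Walk.darts_cons, List.mem_cons] at hm
      rcases hm with hm | hm
      · simp only [SimpleGraph.Dart.mk.injEq, Prod.mk.injEq] at hm
        obtain ⟨rfl, rfl⟩ := hm
        exact hts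
      · exact hr c d ⟨h', hm⟩
  have hfirst : G.WalkArc w u (w.getVert 1) :=
    (walkArc_iff w _ _).mpr ⟨0, hpos, by simp, rfl⟩
  have hlast : G.WalkArc w (w.getVert (w.length - 1)) v :=
    (walkArc_iff w _ _).mpr ⟨w.length - 1, by omega, rfl, by
      rw [show w.length - 1 + 1 = w.length by omega, SimpleGraph.Walk.getVert_length]⟩
  rcases v with j | y
  · rcases u with i | x
    · exact Or.inl ⟨i, j, w, hp, hpos, hw⟩
    · right
      obtain ⟨c, hc⟩ := exists_reversed_in hO hO' (hw _ _ hfirst)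
      by_cases hcs : c ∈ w.support
      · exact hclose (w.takeUntil c hcs) (hp.takeUntil hcs)
          (fun d e ⟨h, hm⟩ => hw d e ⟨h, w.darts_takeUntil_subset_darts hcs hm⟩) hc
      · have hle := hmax (SimpleGraph.Walk.cons (hO.adj hc.1) w)
          ((SimpleGraph.Walk.cons_isPath_iff _ _).mpr ⟨hp, hcs⟩) (by simp) (by
            rintro d e ⟨h', hm⟩
            rw [SimpleGraph.Walk.darts_cons, List.mem_cons] at hm
            rcases hm with hm | hm
            · simp only [SimpleGraph.Dart.mk.injEq, Prod.mk.injEq] at hm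
              obtain ⟨rfl, rfl⟩ := hm
              exact hc
            · exact hw d e ⟨h', hm⟩)
        rw [SimpleGraph.Walk.length_cons] at hle
        omega
  · right
    obtain ⟨c, hc⟩ := exists_reversed_out hO hO' (hw _ _ hlast)
    by_cases hcs : c ∈ w.support
    · exact hclose (w.dropUntil c hcs) (hp.dropUntil hcs)
        (fun d e ⟨h, hm⟩ => hw d e ⟨h, w.darts_dropUntil_subset_darts hcs hm⟩) hc
    · have hle := hmax (w.concat (hO.adj hc.1)) (hp.concat hcs _) (by simp) (by
          rintro d e ⟨h', hm⟩
          rw [SimpleGraph.Walk.darts_concat, List.concat_eq_append, List.mem_append,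
            List.mem_singleton] at hm
          rcases hm with hm | hm
          · exact hw d e ⟨h', hm⟩
          · simp only [SimpleGraph.Dart.mk.injEq, Prod.mk.injEq] at hm
            obtain ⟨rfl, rfl⟩ := hm
            exact hc)
      rw [SimpleGraph.Walk.length_concat] at hle
      omega

lemma reversed_reverseAlong {O O' : Fin n ⊕ J → Fin n ⊕ J → Prop}
    (hO' : G.IsPerfectOrientation O') {u v : Fin n ⊕ J} {w : G.graph.Walk u v}
    (hw : ∀ c d, G.WalkArc w c d → Reversed O O' c d) {a b : Fin n ⊕ J}
    (h : Reversed (G.reverseAlong O w) O' a b) : Reversed O O' a b ∧ ¬ G.WalkArc w a b := by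
  obtain ⟨⟨h1, h2⟩ | h1, h3⟩ := h
  · exact ⟨⟨h1, h3⟩, h2⟩
  · exact absurd h3 (hO'.asymm _ _ (hw _ _ h1).2)

namespace GaugedGraph

/-- Perfect orientations of a drawing are connected by reversals, by induction on the number of
edges in which they differ. -/
lemma connected_withArc [Finite J] (N : G.GaugedGraph) {O' : Fin n ⊕ J → Fin n ⊕ J → Prop}
    (hO' : G.IsPerfectOrientation O') : Connected N (N.withArc O' hO') := by
  induction hm : {q : (Fin n ⊕ J) × (Fin n ⊕ J) | Reversed N.arc O' q.1 q.2}.ncard using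
    Nat.strong_induction_on generalizing N with
  | _ m ih =>
    by_cases hex : ∃ a b, Reversed N.arc O' a b
    · -- reverse a path or a cycle of edges in which the orientations differ
      have hstep : ∀ {u v : Fin n ⊕ J} (w : G.graph.Walk u v), 0 < w.length →
          (∀ c d, G.WalkArc w c d → Reversed N.arc O' c d) →
          ∀ hO : G.IsPerfectOrientation (G.reverseAlong N.arc w),
          Connected N (N.withArc _ hO) → Connected N (N.withArc O' hO') := by
        intro u v w hlen hw hO hc
        refine hc.trans (ih _ ?_ (N.withArc _ hO) rfl)
        rw [← hm]
        refine Set.ncard_lt_ncard ⟨fun q hq => (reversed_reverseAlong hO' hw hq).1, fun hsub => ?_⟩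
          (Set.toFinite _)
        have harc : G.WalkArc w (w.getVert 0) (w.getVert 1) :=
          (walkArc_iff w _ _).mpr ⟨0, hlen, rfl, rfl⟩
        exact (reversed_reverseAlong hO' hw
          (hsub (a := (w.getVert 0, w.getVert 1)) (hw _ _ harc))).2 harc
      obtain ⟨a, b, hab⟩ := hex
      rcases exists_reversed_path_or_cycle N.perfect hO' hab with
        ⟨i, j, w, hp, hlen, hw⟩ | ⟨u, w, hcyc, hw⟩
      · have hrev : N.IsReversiblePath i j w := by
          refine ⟨⟨w.getVert 1, ?_⟩, ⟨w.getVert (w.length - 1), ?_⟩, hp, fun a b h => (hw a b h).1⟩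
          · exact (hw _ _ ((walkArc_iff w _ _).mpr ⟨0, hlen, by simp, rfl⟩)).1
          · exact (hw _ _ ((walkArc_iff w _ _).mpr ⟨w.length - 1, by omega, rfl, by
              rw [show w.length - 1 + 1 = w.length by omega,
                SimpleGraph.Walk.getVert_length]⟩)).1
        obtain ⟨hO, -⟩ := exists_gaugeTransforms_path hrev
        exact hstep w hlen hw hO (Elementary.path N i j w hrev hO).connected
      · have hrev : N.IsReversibleCycle w := ⟨hcyc, fun a b h => (hw a b h).1⟩
        obtain ⟨hO, -⟩ := exists_gaugeTransforms_cycle hrev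
        exact hstep w (lt_of_lt_of_le (by norm_num) hcyc.three_le_length) hw hO
          (Elementary.cycle N u w hrev hO).connected
    · have hO : O' = N.arc := by
        funext a b
        refine propext ⟨fun h => ?_, fun h => ?_⟩
        · exact ((N.perfect.adj_iff _ _).mp (hO'.adj h)).resolve_right
            fun h' => hex ⟨b, a, h', h⟩
        · exact ((hO'.adj_iff _ _).mp (N.perfect.adj h)).resolve_right
            fun h' => hex ⟨a, b, h, h'⟩
      subst hO
      exact Connected.refl N

end GaugedGraph

end PlabicGraph

/-! ### Drawings near a drawing -/

/-- Segments with a common end are disjoint otherwise, if neither contains the other end of the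
other one. -/
lemma disjoint_openSegment_of_common {a b c : ℂ} (hbc : b ≠ c) (hb : b ∉ openSegment ℝ a c)
    (hc : c ∉ openSegment ℝ a b) : Disjoint (openSegment ℝ a b) (openSegment ℝ a c) := by
  rw [Set.disjoint_left]
  intro z hz hz'
  rw [openSegment_eq_image'] at hz hz'
  obtain ⟨s, ⟨hs, -⟩, rfl⟩ := hz
  obtain ⟨t, ⟨ht, -⟩, h⟩ := hz'
  have key : t • (c - a) = s • (b - a) := by simpa using h
  rcases lt_trichotomy s t with hlt | rfl | hlt
  · refine hc ?_
    rw [openSegment_eq_image']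
    refine ⟨s / t, ⟨by positivity, (div_lt_one ht).mpr hlt⟩, ?_⟩
    beta_reduce
    rw [div_eq_inv_mul, mul_smul, ← key, smul_smul, inv_mul_cancel₀ ht.ne', one_smul]; ring
  · exact hbc (by simpa using (smul_right_injective ℂ hs.ne' key).symm)
  · refine hb ?_
    rw [openSegment_eq_image']
    refine ⟨t / s, ⟨by positivity, (div_lt_one hs).mpr hlt⟩, ?_⟩
    beta_reduce
    rw [div_eq_inv_mul, mul_smul, key, smul_smul, inv_mul_cancel₀ hs.ne', one_smul]; ring

lemma eventually_notMem_segment {X : Type*} [TopologicalSpace X] {x a b : X → ℂ}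
    (hx : Continuous x) (ha : Continuous a) (hb : Continuous b) {q : X}
    (h : x q ∉ segment ℝ (a q) (b q)) : ∀ᶠ y in 𝓝 q, x y ∉ segment ℝ (a y) (b y) := by
  have := isCompact_Icc.eventually_forall_of_forall_eventually (x₀ := q) (K := Set.Icc (0 : ℝ) 1)
    (P := fun y t => a y + t • (b y - a y) ≠ x y) (fun t ht => by
      have hc : IsOpen {z : X × ℝ | a z.1 + z.2 • (b z.1 - a z.1) ≠ x z.1} :=
        isOpen_ne_fun (by fun_prop) (by fun_prop)
      refine hc.mem_nhds fun he => h ?_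
      rw [segment_eq_image']
      exact ⟨t, ht, he⟩)
  refine this.mono fun y hy hm => ?_
  rw [segment_eq_image'] at hm
  obtain ⟨t, ht, he⟩ := hm
  exact hy t ht he

lemma eventually_disjoint_segment {X : Type*} [TopologicalSpace X] {a b c d : X → ℂ}
    (ha : Continuous a) (hb : Continuous b) (hc : Continuous c) (hd : Continuous d) {q : X}
    (h : Disjoint (segment ℝ (a q) (b q)) (segment ℝ (c q) (d q))) :
    ∀ᶠ y in 𝓝 q, Disjoint (segment ℝ (a y) (b y)) (segment ℝ (c y) (d y)) := by
  have := (isCompact_Icc.prod isCompact_Icc).eventually_forall_of_forall_eventually (x₀ := q)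
    (K := Set.Icc (0 : ℝ) 1 ×ˢ Set.Icc (0 : ℝ) 1)
    (P := fun y t => a y + t.1 • (b y - a y) ≠ c y + t.2 • (d y - c y)) (fun t ht => by
      have hc : IsOpen {z : X × (ℝ × ℝ) | a z.1 + z.2.1 • (b z.1 - a z.1) ≠
          c z.1 + z.2.2 • (d z.1 - c z.1)} := isOpen_ne_fun (by fun_prop) (by fun_prop)
      refine hc.mem_nhds fun he => ?_
      have m1 : a q + t.1 • (b q - a q) ∈ segment ℝ (a q) (b q) := by
        rw [segment_eq_image']; exact ⟨t.1, ht.1, rfl⟩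
      have m2 : a q + t.1 • (b q - a q) ∈ segment ℝ (c q) (d q) := by
        rw [segment_eq_image']; exact ⟨t.2, ht.2, he.symm⟩
      exact Set.disjoint_left.mp h m1 m2)
  refine this.mono fun y hy => Set.disjoint_left.mpr fun z hz hz' => ?_
  rw [segment_eq_image'] at hz hz'
  obtain ⟨s, hs, rfl⟩ := hz
  obtain ⟨t, ht, he⟩ := hz'
  exact hy (s, t) ⟨hs, ht⟩ he.symm

namespace PlabicGraph

variable {n : ℕ} {J : Type*} {G : PlabicGraph n J}

lemma IsDrawing.notMem_segment {p : Fin n ⊕ J → ℂ} (hp : G.IsDrawing p) {u v w : Fin n ⊕ J}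
    (h : G.graph.Adj u v) (hu : w ≠ u) (hv : w ≠ v) : p w ∉ segment ℝ (p u) (p v) := by
  rw [← insert_endpoints_openSegment]
  rintro (h' | h' | h')
  · exact hu (hp.injective h')
  · exact hv (hp.injective h')
  · exact hp.vertex_not_on_edge u v w h h'

lemma left_notMem_openSegment' {a b : ℂ} (h : a ≠ b) : a ∉ openSegment ℝ a b := by
  rwa [left_mem_openSegment_iff]

lemma right_notMem_openSegment' {a b : ℂ} (h : a ≠ b) : b ∉ openSegment ℝ a b := by
  rwa [right_mem_openSegment_iff]

/-- Small perturbations of the internal vertices of a drawing give drawings. -/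
lemma IsDrawing.eventually [Finite J] {p : Fin n ⊕ J → ℂ} (hp : G.IsDrawing p) :
    ∀ᶠ q in 𝓝 p, (∀ i, q (Sum.inl i) = p (Sum.inl i)) → G.IsDrawing q := by
  have hc : ∀ v, Continuous fun q : Fin n ⊕ J → ℂ => q v := fun v => continuous_apply v
  have e1 : ∀ᶠ q in 𝓝 p, ∀ v : J, 0 < (q (Sum.inr v)).im := Filter.eventually_all.mpr fun v =>
    (Complex.continuous_im.comp (hc _)).continuousAt.eventually (lt_mem_nhds (hp.internal_pos v))
  have e2 : ∀ᶠ q in 𝓝 p, ∀ u v : Fin n ⊕ J, u ≠ v → q u ≠ q v :=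
    Filter.eventually_all.mpr fun u => Filter.eventually_all.mpr fun v => by
      by_cases h : u = v
      · exact Filter.Eventually.of_forall fun _ h' => absurd h h'
      · have h0 : ∀ᶠ q in 𝓝 p, q u ≠ q v := (isOpen_ne_fun (hc u) (hc v)).mem_nhds
          fun h' => h (hp.injective h')
        exact h0.mono fun q hq _ => hq
  -- Disjointness of closed segments is an open condition. It takes care of edges without common
  -- vertices; for edges with a common vertex it is enough that no vertex is on an edge.
  have e3 : ∀ᶠ q in 𝓝 p, ∀ u v w : Fin n ⊕ J, G.graph.Adj u v → w ≠ u → w ≠ v →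
      q w ∉ segment ℝ (q u) (q v) :=
    Filter.eventually_all.mpr fun u => Filter.eventually_all.mpr fun v =>
      Filter.eventually_all.mpr fun w => by
        by_cases h : G.graph.Adj u v ∧ w ≠ u ∧ w ≠ v
        · exact (eventually_notMem_segment (hc w) (hc u) (hc v)
            (hp.notMem_segment h.1 h.2.1 h.2.2)).mono fun q hq _ _ _ => hq
        · exact Filter.Eventually.of_forall fun _ h1 h2 h3 => absurd ⟨h1, h2, h3⟩ h
  have e4 : ∀ᶠ q in 𝓝 p, ∀ u v u' v' : Fin n ⊕ J, G.graph.Adj u v ∧ G.graph.Adj u' v' ∧ u ≠ u' ∧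
      u ≠ v' ∧ v ≠ u' ∧ v ≠ v' → Disjoint (segment ℝ (q u) (q v)) (segment ℝ (q u') (q v')) :=
    Filter.eventually_all.mpr fun u => Filter.eventually_all.mpr fun v =>
      Filter.eventually_all.mpr fun u' => Filter.eventually_all.mpr fun v' => by
        by_cases h : G.graph.Adj u v ∧ G.graph.Adj u' v' ∧ u ≠ u' ∧ u ≠ v' ∧ v ≠ u' ∧ v ≠ v'
        · refine (eventually_disjoint_segment (hc u) (hc v) (hc u') (hc v') ?_).mono fun q hq _ =>
              hq
          obtain ⟨h1, h2, h3, h4, h5, h6⟩ := h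
          rw [Set.disjoint_left]
          intro z hz hz'
          rw [← insert_endpoints_openSegment] at hz
          rcases hz with rfl | rfl | hz
          · exact hp.notMem_segment h2 h3 h4 hz'
          · exact hp.notMem_segment h2 h5 h6 hz'
          · rw [← insert_endpoints_openSegment] at hz'
            rcases hz' with rfl | rfl | hz'
            · exact hp.vertex_not_on_edge u v u' h1 hz
            · exact hp.vertex_not_on_edge u v v' h1 hz
            · refine Set.disjoint_left.mp (hp.edges_disjoint u v u' v' h1 h2 fun hs => ?_) hz hz'
              rcases Sym2.eq_iff.mp hs with ⟨h, -⟩ | ⟨h, -⟩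
              · exact h3 h
              · exact h4 h
        · exact Filter.Eventually.of_forall fun _ h' => absurd h' h
  filter_upwards [e1, e2, e3, e4] with q h1 h2 h3 h4 hb
  have hne : ∀ u v w, G.graph.Adj u v → q w ∉ openSegment ℝ (q u) (q v) := by
    intro u v w h
    by_cases hu : w = u
    · subst hu; exact left_notMem_openSegment' (h2 _ _ h.ne)
    by_cases hv : w = v
    · subst hv; exact right_notMem_openSegment' (h2 _ _ h.ne)
    exact fun hm => h3 u v w h hu hv (openSegment_subset_segment _ _ _ hm)
  -- edges with a common vertex
  have hcom : ∀ u v v', G.graph.Adj u v → G.graph.Adj u v' → v ≠ v' →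
      Disjoint (openSegment ℝ (q u) (q v)) (openSegment ℝ (q u) (q v')) := fun u v v' h h' hvv =>
    disjoint_openSegment_of_common (h2 _ _ hvv) (hne _ _ _ h') (hne _ _ _ h)
  exact
    { boundary_real := fun i => by rw [hb]; exact hp.boundary_real i
      boundary_clockwise := by simp only [hb]; exact hp.boundary_clockwise
      internal_pos := h1
      injective := fun u v h => by
        by_contra hne
        exact h2 u v hne h
      vertex_not_on_edge := hne
      edges_disjoint := fun u v u' v' h h' hs => by
        by_cases k1 : u = u'
        · subst k1
          exact hcom u v v' h h' fun hv => hs (by rw [hv])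
        by_cases k2 : u = v'
        · subst k2
          rw [openSegment_symm ℝ (q u')]
          exact hcom u v u' h h'.symm fun hv => hs (by rw [hv, Sym2.eq_swap])
        by_cases k3 : v = u'
        · subst k3
          rw [openSegment_symm ℝ (q u)]
          exact hcom v u v' h.symm h' k2
        by_cases k4 : v = v'
        · subst k4
          rw [openSegment_symm ℝ (q u), openSegment_symm ℝ (q u')]
          exact hcom v u u' h.symm h'.symm k1
        exact (h4 u v u' v' ⟨h, h', k1, k2, k3, k4⟩).mono (openSegment_subset_segment _ _ _)
          (openSegment_subset_segment _ _ _) }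

/-! ### Generic ray directions -/

/-- At most one of the directions `x + i` is parallel to `d`. -/
lemma finite_bad_directions {d : ℂ} (hd : d ≠ 0) :
    {x : ℝ | planeCross (x + Complex.I) d = 0}.Finite := by
  refine Set.Subsingleton.finite fun x hx y hy => ?_
  have e : ∀ t : ℝ, planeCross (t + Complex.I) d = t * d.im - d.re := fun t => by simp [planeCross]
  rw [Set.mem_ofPred_eq, e] at hx hy
  by_cases h : d.im = 0
  · rw [h, mul_zero, zero_sub, neg_eq_zero] at hx
    exact absurd (Complex.ext hx h) hd
  · exact mul_right_cancel₀ h (by linarith)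

/-- Two drawings have a common gauge ray direction: only finitely many of the directions `x + i`
are parallel to a vector between two vertices. -/
lemma exists_common_gauge [Finite J] {q q' : Fin n ⊕ J → ℂ} (hq : G.IsDrawing q)
    (hq' : G.IsDrawing q') : ∃ l, G.IsGaugeDirection q l ∧ G.IsGaugeDirection q' l := by
  have hfin : ∀ {p : Fin n ⊕ J → ℂ}, G.IsDrawing p →
      {x : ℝ | ∃ u v : Fin n ⊕ J, u ≠ v ∧ planeCross (x + Complex.I) (p v - p u) = 0}.Finite := by
    intro p hp
    have : {x : ℝ | ∃ u v : Fin n ⊕ J, u ≠ v ∧ planeCross (x + Complex.I) (p v - p u) = 0} =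
        ⋃ u, ⋃ v, {x : ℝ | u ≠ v ∧ planeCross (x + Complex.I) (p v - p u) = 0} := by
      ext x; simp
    rw [this]
    refine Set.finite_iUnion fun u => Set.finite_iUnion fun v => ?_
    by_cases h : u = v
    · simp [h]
    · exact (finite_bad_directions (sub_ne_zero.mpr fun h' => h (hp.injective h').symm)).subset
        fun x hx => hx.2
  obtain ⟨x, hx⟩ := ((hfin hq).union (hfin hq')).exists_notMem
  have hgen : ∀ {p : Fin n ⊕ J → ℂ}, G.IsDrawing p →
      (∀ u v : Fin n ⊕ J, u ≠ v → planeCross (x + Complex.I) (p v - p u) ≠ 0) →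
      G.IsGaugeDirection p (x + Complex.I) := by
    intro p hp h
    refine ⟨by simp, fun u v huv => h u v huv.ne, fun i v t _ e => ?_⟩
    refine h (Sum.inl i) (Sum.inr v) (by simp) ?_
    rw [e, add_sub_cancel_left]
    simp [planeCross, mul_comm]
  rw [Set.mem_union, not_or] at hx
  exact ⟨x + Complex.I, hgen hq fun u v huv h => hx.1 ⟨u, v, huv, h⟩,
    hgen hq' fun u v huv h => hx.2 ⟨u, v, huv, h⟩⟩

/-! ### Isotopic drawings are connected by elementary transformations -/

open GaugedGraph

/-- Any two gauged graphs with the drawings `q`, `q'` and the same orientation are connected by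
elementary transformations, whatever their ray directions are. -/
def DrawingsConnected (G : PlabicGraph n J) (q q' : Fin n ⊕ J → ℂ) : Prop :=
  ∀ N N' : G.GaugedGraph, N.pos = q → N'.pos = q' → N.arc = N'.arc → Connected N N'

lemma drawingsConnected_self (q : Fin n ⊕ J → ℂ) : G.DrawingsConnected q q := by
  rintro ⟨p, O, l, h1, h2, h3⟩ ⟨p', O', l', h1', h2', h3'⟩ rfl hp hO
  simp only at hp hO
  subst hp hO
  exact (Elementary.rotation ⟨p', O, l, h1, h2, h3⟩ l' h3').connected

lemma DrawingsConnected.trans [Finite J] {q q' q'' : Fin n ⊕ J → ℂ} (hq' : G.IsDrawing q')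
    (h : G.DrawingsConnected q q') (h' : G.DrawingsConnected q' q'') :
    G.DrawingsConnected q q'' := by
  intro N N'' hN hN'' hO
  obtain ⟨l, hl, -⟩ := exists_common_gauge hq' hq'
  exact (h N ⟨q', N.arc, l, hq', N.perfect, hl⟩ hN rfl rfl).trans (h' _ N'' rfl hN'' hO)

/-- A vertex can be moved along a segment if all drawings on the way are drawings of the graph:
the ray direction is first changed to one that is generic at both ends of the motion. -/
lemma drawingsConnected_moveVertex [Finite J] {q : Fin n ⊕ J → ℂ} {u : J} {z : ℂ}
    (h : ∀ y ∈ segment ℝ (q (Sum.inr u)) z, G.IsDrawing (moveVertex q u y)) :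
    G.DrawingsConnected q (moveVertex q u z) := by
  have hq : G.IsDrawing q := by
    have := h _ (left_mem_segment ℝ _ _)
    rwa [moveVertex_pos] at this
  have hz : G.IsDrawing (moveVertex q u z) := h z (right_mem_segment ℝ _ _)
  obtain ⟨l, hl, hl'⟩ := exists_common_gauge hq hz
  intro N N' hN hN' hO
  let N₁ : G.GaugedGraph := ⟨q, N.arc, l, hq, N.perfect, hl⟩
  let c : Path (N₁.pos (Sum.inr u)) z :=
    { toFun := fun t => AffineMap.lineMap (q (Sum.inr u)) z (t : ℝ)
      continuous_toFun := by
        have : Continuous (AffineMap.lineMap (q (Sum.inr u)) z : ℝ →ᵃ[ℝ] ℂ) :=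
          AffineMap.lineMap_continuous
        exact this.comp continuous_subtype_val
      source' := by simp [N₁]
      target' := by simp }
  have hc : ∀ t, G.IsDrawing (moveVertex N₁.pos u (c t)) := fun t => h _ (by
    rw [segment_eq_image_lineMap]
    exact ⟨t, t.2, rfl⟩)
  have h1 : Connected N N₁ := drawingsConnected_self q N N₁ hN rfl rfl
  have h2 := (Elementary.motion N₁ u z c hc hz hl').connected
  exact (h1.trans h2).trans (drawingsConnected_self _ _ N' rfl hN' hO)

open Classical in
/-- Two drawings in a box of drawings are connected: the vertices are moved one by one. -/
lemma drawingsConnected_of_box [Finite J] {q₀ q q' : Fin n ⊕ J → ℂ} {ε : ℝ}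
    (hbox : ∀ y : Fin n ⊕ J → ℂ, (∀ i, y (Sum.inl i) = q₀ (Sum.inl i)) →
      (∀ v, y (Sum.inr v) ∈ Metric.ball (q₀ (Sum.inr v)) ε) → G.IsDrawing y)
    (hq : ∀ i, q (Sum.inl i) = q₀ (Sum.inl i))
    (hqε : ∀ v, q (Sum.inr v) ∈ Metric.ball (q₀ (Sum.inr v)) ε)
    (hq' : ∀ i, q' (Sum.inl i) = q₀ (Sum.inl i))
    (hqε' : ∀ v, q' (Sum.inr v) ∈ Metric.ball (q₀ (Sum.inr v)) ε) : G.DrawingsConnected q q' := by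
  have := Fintype.ofFinite J
  let y : Finset J → Fin n ⊕ J → ℂ := fun T =>
    Sum.elim (fun i => q (Sum.inl i)) fun v => if v ∈ T then q' (Sum.inr v) else q (Sum.inr v)
  have hyε : ∀ T v, y T (Sum.inr v) ∈ Metric.ball (q₀ (Sum.inr v)) ε := by
    intro T v
    by_cases h : v ∈ T
    · simpa [y, h] using hqε' v
    · simpa [y, h] using hqε v
  have hy : ∀ T, G.IsDrawing (y T) := fun T => hbox _ (fun i => hq i) (hyε T)
  have key : ∀ T, G.DrawingsConnected q (y T) := by
    intro T
    induction T using Finset.induction_on with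
    | empty =>
      have : y ∅ = q := by
        funext a; rcases a with i | v <;> simp [y]
      rw [this]
      exact drawingsConnected_self q
    | insert u T hu ih =>
      have : y (insert u T) = moveVertex (y T) u (q' (Sum.inr u)) := by
        funext a
        by_cases ha : a = Sum.inr u
        · subst ha; rw [moveVertex_self]; simp [y]
        · rw [moveVertex_of_ne _ _ ha]
          rcases a with i | v
          · rfl
          · have hv : v ≠ u := fun h => ha (by rw [h])
            simp [y, hv]
      rw [this]
      refine ih.trans (hy T) (drawingsConnected_moveVertex fun x hx => hbox _ ?_ ?_)
      · intro i
        rw [moveVertex_of_ne _ _ (by simp)]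
        exact hq i
      · intro v
        by_cases hv : v = u
        · subst hv
          rw [moveVertex_self]
          exact (convex_ball _ _).segment_subset (hyε T v) (hqε' v) hx
        · rw [moveVertex_of_ne _ _ fun h => hv (Sum.inr_injective h)]
          exact hyε T v
  have : y Finset.univ = q' := by
    funext a
    rcases a with i | v
    · exact (hq i).trans (hq' i).symm
    · simp [y]
  rw [← this]
  exact key _

/-- Connectedness along the isotopy is a local condition, and near each drawing there is a box of
drawings. -/
lemma drawingsConnected_of_isotopic [Finite J] {p q q' : Fin n ⊕ J → ℂ} (h : G.Isotopic p q)
    (h' : G.Isotopic p q') : G.DrawingsConnected q q' := by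
  have := Fintype.ofFinite J
  obtain ⟨γ, hγ⟩ := h.symm.trans h'
  refine (isPreconnected_range γ.continuous).induction₂' G.DrawingsConnected ?_ ?_
    ⟨0, γ.source⟩ ⟨1, γ.target⟩
  · rintro _ ⟨t, rfl⟩
    obtain ⟨ε, hε, hb⟩ := Metric.eventually_nhds_iff.mp (hγ t).1.eventually
    have hbox : ∀ y : Fin n ⊕ J → ℂ, (∀ i, y (Sum.inl i) = γ t (Sum.inl i)) →
        (∀ v, y (Sum.inr v) ∈ Metric.ball (γ t (Sum.inr v)) ε) → G.IsDrawing y := by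
      intro y h1 h2
      refine hb ((dist_pi_lt_iff hε).mpr ?_) h1
      rintro (i | v)
      · rw [h1, dist_self]; exact hε
      · exact h2 v
    filter_upwards [self_mem_nhdsWithin, nhdsWithin_le_nhds (Metric.ball_mem_nhds (γ t) hε)]
      with y hy hyε
    obtain ⟨s, rfl⟩ := hy
    have h1 : ∀ i, γ s (Sum.inl i) = γ t (Sum.inl i) := fun i =>
      ((hγ s).2 i).trans ((hγ t).2 i).symm
    have h2 : ∀ v, γ s (Sum.inr v) ∈ Metric.ball (γ t (Sum.inr v)) ε := fun v =>
      (dist_le_pi_dist _ _ _).trans_lt hyε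
    have h3 : ∀ v, γ t (Sum.inr v) ∈ Metric.ball (γ t (Sum.inr v)) ε := fun v =>
      Metric.mem_ball_self hε
    exact ⟨drawingsConnected_of_box hbox (fun _ => rfl) h3 h1 h2,
      drawingsConnected_of_box hbox h1 h2 (fun _ => rfl) h3⟩
  · rintro _ _ _ - ⟨s, rfl⟩ - h1 h2
    exact h1.trans (hγ s).1 h2

/-- Gauged graphs with isotopic drawings are connected by elementary transformations. -/
lemma connected_of_isotopic [Finite J] {p : Fin n ⊕ J → ℂ} {N N' : G.GaugedGraph}
    (h : G.Isotopic p N.pos) (h' : G.Isotopic p N'.pos) : Connected N N' :=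
  (connected_withArc N N'.perfect).trans (drawingsConnected_of_isotopic h h' _ _ rfl rfl rfl)

lemma GaugeEquivalent.trans {ε ε' ε'' : Fin n ⊕ J → Fin n ⊕ J → ZMod 2}
    (h : G.GaugeEquivalent ε ε') (h' : G.GaugeEquivalent ε' ε'') : G.GaugeEquivalent ε ε'' :=
  ⟨_, h.choose_spec.trans h'.choose_spec⟩

end PlabicGraph

theorem mainTheorem3 {n : ℕ} {J : Type*} [Finite J] (G : PlabicGraph n J)
    (p : Fin n ⊕ J → ℂ) (hp : G.IsDrawing p)
    (O : Fin n ⊕ J → Fin n ⊕ J → Prop) (hO : G.IsPerfectOrientation O) :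
    -- there is exactly one class of geometric signatures
    (∃ ε, ∀ ε', G.IsGeometricSignature p ε' ↔ G.GaugeEquivalent ε ε') ∧
    -- any change of orientation, gauge ray direction and positions is a composition of elementary
    -- transformations, and acts by the sum of their gauge functions
    (∀ N N' : G.GaugedGraph, G.Isotopic p N.pos → G.Isotopic p N'.pos →
      ∃ η, PlabicGraph.GaugedGraph.Composition N N' η ∧
        G.GaugeTransforms η N.signature N'.signature) ∧
    -- reversal of the orientation along a path
    (∀ (N : G.GaugedGraph) (i j : Fin n) (w : G.graph.Walk (Sum.inl i) (Sum.inl j)),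
      N.IsReversiblePath i j w →
      ∃ h : G.IsPerfectOrientation (G.reverseAlong N.arc w),
        G.GaugeTransforms (N.reversalGauge w (N.pathMinus i j w))
          N.signature (N.withArc _ h).signature) ∧
    -- reversal of the orientation along a cycle
    (∀ (N : G.GaugedGraph) (u : Fin n ⊕ J) (w : G.graph.Walk u u), N.IsReversibleCycle w →
      ∃ h : G.IsPerfectOrientation (G.reverseAlong N.arc w),
        G.GaugeTransforms (N.reversalGauge w (N.cycleMinus w))
          N.signature (N.withArc _ h).signature) ∧
    -- change of the gauge ray direction
    (∀ (N : G.GaugedGraph) (l' : ℂ) (h : G.IsGaugeDirection N.pos l'),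
      G.GaugeTransforms (N.rotationGauge l') N.signature (N.withRay l' h).signature) ∧
    -- motion of an internal vertex
    (∀ (N : G.GaugedGraph) (u : J) (z : ℂ) (c : Path (N.pos (Sum.inr u)) z),
      (∀ t, G.IsDrawing (PlabicGraph.moveVertex N.pos u (c t))) →
      ∀ (hz : G.IsDrawing (PlabicGraph.moveVertex N.pos u z))
        (hl : G.IsGaugeDirection (PlabicGraph.moveVertex N.pos u z) N.ray),
      G.GaugeTransforms (N.motionGauge u c) N.signature (N.withPos _ hz hl).signature) := by
  have hconn : ∀ N N' : G.GaugedGraph, G.Isotopic p N.pos → G.Isotopic p N'.pos →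
      ∃ η, PlabicGraph.GaugedGraph.Composition N N' η ∧
        G.GaugeTransforms η N.signature N'.signature := by
    intro N N' h h'
    obtain ⟨η, hη⟩ := PlabicGraph.connected_of_isotopic h h'
    exact ⟨η, hη, hη.gaugeTransforms⟩
  refine ⟨?_, hconn,
    fun N i j w hw => PlabicGraph.GaugedGraph.exists_gaugeTransforms_path hw,
    fun N u w hw => PlabicGraph.GaugedGraph.exists_gaugeTransforms_cycle hw,
    PlabicGraph.GaugedGraph.gaugeTransforms_rotation,
    PlabicGraph.GaugedGraph.gaugeTransforms_motion⟩
  obtain ⟨l, hl, -⟩ := PlabicGraph.exists_common_gauge hp hp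
  have hN : G.Isotopic p p := JoinedIn.refl ⟨hp, fun _ => rfl⟩
  refine ⟨(⟨p, O, l, hp, hO, hl⟩ : G.GaugedGraph).signature, fun ε' => ⟨?_, fun h => ⟨_, hN, h⟩⟩⟩
  rintro ⟨N, h, hε⟩
  obtain ⟨η, -, hη⟩ := hconn ⟨p, O, l, hp, hO, hl⟩ N hN h
  exact PlabicGraph.GaugeEquivalent.trans ⟨η, hη⟩ hε
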